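/- **Setting.** Let $Q$ be a finite-dimensional (Hausdorff, second countable, boundaryless) smooth manifold with a smooth, free and proper left action of a finite-dimensional Lie group $G$ with Lie algebra $\mathfrak g$, and let $\pi:Q\to Q/G$ be the principal $G$-bundle. Let $g$ be a $G$-invariant Riemannian (kinetic energy) metric on $Q$ and $V$ a smooth $G$-invariant potential. For $\xi\in\mathfrak g$ let $\xi_Q$ be the infinitesimal generator, and let $\mathcal A:TQ\to\mathfrak g$ be the mechanical connection, $\mathcal A(v_q)=\mathbb I(q)^{-1}J(v_q)$, with $\langle J(v_q),\xi\rangle=g(v_q,\xi_Q(q))$ and $\langle\mathbb I(q)\xi,\eta\rangle=g(\xi_Q(q),\eta_Q(q))$. Write $p=g(v,\cdot)$ and $H=\tfrac12 g(v,v)+V$. *Flow.* Let $f$ be an external force (a covector $f(q,v)\in T_q^*Q$ for each state $(q,v)$). Between impacts the state $(q,v)\in TQ$ follows the vector field $X$, assumed $C^1$, given by $\dot q=\partial H/\partial p$, $\dot p=-\partial H/\partial q+f$, transported to $TQ$ by the Legendre transform. The flow is called dissipative if $\langle f(q,v),v\rangle\le 0$ for all $(q,v)$ (for instance $f=-\alpha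 p$ with $\alpha>0$). *Impacts.* Let $\mathcal S_1,\dots,\mathcal S_m\subset Q$ be embedded codimension-one submanifolds (impact surfaces), with controlled reset maps $\Delta_{u,i}:TQ|_{\mathcal S_i}\to TQ$, $u$ in a set of controls. The resets obey the Weierstrass–Erdmann corner conditions: $\Delta_{u,i}(q,v^-)=(q,v^+)$ with $$p^+=p^-+\varepsilon\,dh_q,\qquad H^--H^+=\varepsilon\,\nu,$$ where $h$ is a local defining function of $\mathcal S_i$ and $\varepsilon,\nu\in\mathbb R$ ($\nu$ is the normal velocity of the surface at the collision) may depend on $i$, $u$ and $(q,v^-)$. Impacts on the $i$-th surface occur when the state reaches the guard $\mathcal G_i$, a relatively open subset of $TQ|_{\mathcal S_i}$ (e.g. the states with velocity pointing into the wall). A feedback law $u=k_i(q,v^-)$ is applied, such that the closed-loop resets are of class $C^1$ on the guards. Hybrid trajectories are right-continuous, with a closed discrete set of impact times; between impacts they are integral curves of $X$, their values lie off all guards, and at an impact time the left limit lies in some $\mathcal G_i$ and the state jumps to the value of the $i$-th closed-loop reset at this left limit. A surface $\mathcal S\subset Q$ is *vertical* if $\mathcal S=\pi^{-1}(\Sigma)$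 for an embedded codimension-one submanifold $\Sigma\subset Q/G$. **Theorem.** Let $\gamma$ be a periodic hybrid orbit of the closed-loop system. 1. If an impact surface $\mathcal S_i$ met by $\gamma$ is vertical, then for every control $u$ the reset preserves the connection, $\Delta_{u,i}^*\mathcal A=\iota_i^*\mathcal A$; that is, $\mathcal A(\Delta_{u,i}(q,v))=\mathcal A(q,v)$ for all $(q,v)\in TQ|_{\mathcal S_i}$. 2. Consequently, if under some feedback law the reset on some surface met by $\gamma$ changes the value of $\mathcal A$ at some state over this surface, then at least one surface $\mathcal S_i$ met by $\gamma$ is non-vertical and satisfies $\Delta_{u,i}^*\mathcal A\ne\iota_i^*\mathcal A$ for some control $u$. 3. Suppose in addition that the flow is dissipative and that $\gamma$ meets the guards transversally: its states (post-impact states at impact times) lie off the closures of all guards, and each pre-impact limit $x^-$ lies in exactly one guard, off the closures of the others, with $X(x^-)$ not tangent to that guard. Let $x_0=\gamma(\tau)$, where $\tau>0$ is not an impact time, let $\Sigma\subset TQ$ be an embedded codimension-one local section transverse to $X$ at $x_0$ with $\gamma\cap\Sigma=\{x_0\}$, let $P_\gamma$ be the Poincaré first return map, defined on a neighbourhood of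 $x_0$ in $\Sigma$, and let the monodromy matrix $M_\gamma=DP_\gamma(x_0):T_{x_0}\Sigma\to T_{x_0}\Sigma$ be its linearization. If $\rho(M_\gamma)<1$, where $\rho$ is the largest modulus of a complex eigenvalue, then $\gamma$ is locally exponentially orbitally stable: for every distance function $d$ on $TQ$ that induces the topology and is locally bi-Lipschitz to the norm in charts, there are an open neighbourhood $W$ of $\gamma([0,\infty))$ and constants $C,\lambda>0$ such that from every $x\in W$ there starts a hybrid trajectory on $[0,\infty)$, and every such trajectory $c$ satisfies $$d\big(c(t),\gamma([0,\infty))\big)\le C e^{-\lambda t}\,d\big(x,\gamma([0,\infty))\big)\qquad(t\ge 0).$$ -/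

import Mathlib

open Set Filter Topology Bundle
open scoped Manifold ContDiff TensorProduct

namespace HybridMech

noncomputable section

/-! ### Embedded hypersurfaces -/

section Hypersurface

variable {E : Type*} [NormedAddCommGroup E] [NormedSpace ℝ E]
  {H : Type*} [TopologicalSpace H] (I : ModelWithCorners ℝ E H)
  {M : Type*} [TopologicalSpace M] [ChartedSpace H M]

/-- On the open set `U`, the set `S` is the zero level of the smooth function `h`, whose
differential vanishes nowhere on `U`. -/
structure IsLocalDefiningFunction (S U : Set M) (h : M → ℝ) : Prop where
  isOpen : IsOpen U
  smooth : ContMDiffOn I 𝓘(ℝ) ∞ h U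
  regular : ∀ y ∈ U, mfderiv I 𝓘(ℝ) h y ≠ 0
  mem_iff : ∀ y ∈ U, (y ∈ S ↔ h y = 0)

/-- Embedded submanifolds of codimension one: locally, regular zero levels of a smooth function. -/
def IsEmbeddedHypersurface (S : Set M) : Prop :=
  ∀ x ∈ S, ∃ U h, x ∈ U ∧ IsLocalDefiningFunction I S U h

/-- The tangent space `T_x S` of an embedded hypersurface `S` at `x ∈ S`: the common kernel of the
differentials of the local defining functions (all of them have the same kernel). -/
def hypersurfaceTangent (S : Set M) (x : M) : Submodule ℝ (TangentSpace I x) where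
  carrier := {w | ∀ U h, x ∈ U → IsLocalDefiningFunction I S U h → mfderiv I 𝓘(ℝ) h x w = 0}
  add_mem' := by
    intro a b ha hb U h hx hU
    rw [map_add, ha U h hx hU, hb U h hx hU, add_zero]
  zero_mem' := by
    intro U h _ _
    exact map_zero _
  smul_mem' := by
    intro c a ha U h hx hU
    rw [map_smul, ha U h hx hU, smul_zero]

end Hypersurface

/-! ### Hybrid systems, their trajectories and periodic orbits -/

section Hybrid

variable {E : Type*} [NormedAddCommGroup E] [NormedSpace ℝ E]
  {H : Type*} [TopologicalSpace H] (I : ModelWithCorners ℝ E H)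
  (M : Type*) [TopologicalSpace M] [ChartedSpace H M] (ι : Type*)

/-- The data of a hybrid system: a vector field, and a family of switching surfaces (guards)
with their reset maps, of which only the values on the respective guard matter. -/
structure HybridSystem where
  field : ∀ x : M, TangentSpace I x
  guard : ι → Set M
  reset : ι → M → M

variable {I M ι}

/-- `c` is a trajectory of the hybrid system over the time interval `D` (of the form `[0, b]` or
`[0, ∞)`) with set of impact times `J`: the impact times are closed and discrete, between impacts
`c` is an integral curve of the vector field that stays off the guards, and at an impact time `c`
has a left limit in one of the guards and jumps to the value of the reset map there. Thus `c` is
right-continuous: `c t` at an impact time `t` is the state after the impact. -/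
structure HybridSystem.IsTrajectoryOn (S : HybridSystem I M ι) (c : ℝ → M) (J D : Set ℝ) :
    Prop where
  impacts_subset : J ⊆ D ∩ Ioi 0
  impacts_finite : ∀ b : ℝ, (J ∩ Iic b).Finite
  flow : ∀ a b : ℝ, a < b → Icc a b ⊆ D → Disjoint (Ioc a b) J →
    IsMIntegralCurveOn c S.field (Icc a b)
  notMem_guard : ∀ t ∈ D, ∀ i, c t ∉ S.guard i
  impact : ∀ t ∈ J, ∃ i, ∃ x ∈ S.guard i, Tendsto c (𝓝[<] t) (𝓝 x) ∧ c t = S.reset i x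

/-- `γ` is a periodic hybrid orbit with impact times `J` and period `T`. -/
structure HybridSystem.IsPeriodicOrbit (S : HybridSystem I M ι) (γ : ℝ → M) (J : Set ℝ) (T : ℝ) :
    Prop where
  trajectory : S.IsTrajectoryOn γ J (Ici 0)
  period_pos : 0 < T
  periodic : ∀ t, 0 ≤ t → γ (t + T) = γ t

/-- The `i`-th switching surface is hit by `c` at one of the impact times in `J`. -/
def HybridSystem.Encounters (S : HybridSystem I M ι) (c : ℝ → M) (J : Set ℝ) (i : ι) : Prop :=
  ∃ t ∈ J, ∃ x ∈ S.guard i, Tendsto c (𝓝[<] t) (𝓝 x)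

/-- `γ` meets the guards transversally: its states (taken after the reset at impact times) are off
the closures of all guards, and at an impact it reaches exactly one guard, off the closures of the
other guards and with the vector field not tangent to the guard it reaches. -/
structure HybridSystem.IsTransverse (S : HybridSystem I M ι) (γ : ℝ → M) (J : Set ℝ) : Prop where
  off_guards : ∀ t, 0 ≤ t → ∀ i, γ t ∉ closure (S.guard i)
  single : ∀ t ∈ J, ∀ i, ∀ x ∈ S.guard i, Tendsto γ (𝓝[<] t) (𝓝 x) →
    ∀ j, j ≠ i → x ∉ closure (S.guard j)
  transversal : ∀ t ∈ J, ∀ i, ∀ x ∈ S.guard i, Tendsto γ (𝓝[<] t) (𝓝 x) →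
    S.field x ∉ hypersurfaceTangent I (S.guard i) x

/-- `Sec` is a local section transverse to the orbit `γ` at the point `x₀`, and `P` is the
Poincaré (first return) map of `Sec`, defined on a neighbourhood of `x₀` in `Sec`. -/
structure HybridSystem.IsPoincareMap (S : HybridSystem I M ι) (γ : ℝ → M) (Sec : Set M) (x₀ : M)
    (P : M → M) : Prop where
  hypersurface : IsEmbeddedHypersurface I Sec
  inter : γ '' Ici 0 ∩ Sec = {x₀}
  transversal : S.field x₀ ∉ hypersurfaceTangent I Sec x₀
  fixed : P x₀ = x₀
  return_map : ∀ᶠ x in 𝓝[Sec] x₀, ∃ (c : ℝ → M) (J : Set ℝ) (t : ℝ), 0 < t ∧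
    S.IsTrajectoryOn c J (Icc 0 t) ∧ c 0 = x ∧
    (∀ s ∈ Ioo 0 t, c s ∉ Sec) ∧ c t ∈ Sec ∧ P x = c t

/-- `Mon` is the monodromy operator: the linearization at the fixed point `x₀` of the
Poincaré map `P`, as an endomorphism of the tangent space of the section. -/
def IsMonodromy (Sec : Set M) (x₀ : M) (P : M → M)
    (Mon : Module.End ℝ (hypersurfaceTangent I Sec x₀)) : Prop :=
  ∃ D : TangentSpace I x₀ →L[ℝ] TangentSpace I (P x₀),
    HasMFDerivWithinAt I I P Sec x₀ D ∧
      ∀ w : hypersurfaceTangent I Sec x₀,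
        (D (w : TangentSpace I x₀) : E) = ((Mon w : TangentSpace I x₀) : E)

/-- The spectral radius of an endomorphism of a real vector space: the largest modulus of a
complex eigenvalue. -/
def complexSpectralRadius {V : Type*} [AddCommGroup V] [Module ℝ V] (f : Module.End ℝ V) :
    ENNReal :=
  spectralRadius ℂ (LinearMap.baseChange ℂ f : Module.End ℂ (ℂ ⊗[ℝ] V))

variable (I) in
/-- `d` is a distance function on the manifold that induces its topology and is comparable to the
norm in charts, locally around every point (for instance, a Riemannian distance). -/
structure IsChartCompatibleDist (d : M → M → ℝ) : Prop where
  eq_zero_iff : ∀ x y, d x y = 0 ↔ x = y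
  symm : ∀ x y, d x y = d y x
  triangle : ∀ x y z, d x z ≤ d x y + d y z
  nhds_basis : ∀ x, (𝓝 x).HasBasis (fun ε : ℝ => 0 < ε) (fun ε => {y | d x y < ε})
  bilipschitz : ∀ x, ∃ K : ℝ, 0 < K ∧ ∃ U ∈ 𝓝 x, ∀ y ∈ U, ∀ z ∈ U,
    K⁻¹ * ‖extChartAt I x y - extChartAt I x z‖ ≤ d y z ∧
      d y z ≤ K * ‖extChartAt I x y - extChartAt I x z‖

/-- The distance from `x` to the orbit `{γ t | t ≥ 0}`. -/
def orbitDist (d : M → M → ℝ) (γ : ℝ → M) (x : M) : ℝ :=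
  ⨅ t : Ici (0 : ℝ), d x (γ t)

/-- Local exponential orbital stability: from every point of an open neighbourhood of the orbit
there starts a trajectory for all forward times, and along every such trajectory the distance to
the orbit decays exponentially, with uniform constants. -/
def HybridSystem.IsExpOrbitallyStable (S : HybridSystem I M ι) (γ : ℝ → M) : Prop :=
  ∀ d : M → M → ℝ, IsChartCompatibleDist I d →
    ∃ U : Set M, IsOpen U ∧ γ '' Ici 0 ⊆ U ∧ ∃ C lam : ℝ, 0 < C ∧ 0 < lam ∧ ∀ x ∈ U,
      (∃ c J, S.IsTrajectoryOn c J (Ici 0) ∧ c 0 = x) ∧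
      ∀ c J, S.IsTrajectoryOn c J (Ici 0) → c 0 = x → ∀ t, 0 ≤ t →
        orbitDist d γ (c t) ≤ C * Real.exp (-lam * t) * orbitDist d γ x

end Hybrid

/-! ### Principal bundles and the mechanical connection -/

section Bundle

variable {E : Type*} [NormedAddCommGroup E] [NormedSpace ℝ E]
  {Q : Type*} [TopologicalSpace Q] [ChartedSpace E Q]
  {F : Type*} [NormedAddCommGroup F] [NormedSpace ℝ F]
  {B : Type*} [TopologicalSpace B] [ChartedSpace F B]
  {L : Type*} [NormedAddCommGroup L] [NormedSpace ℝ L]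
  (G : Type*) [TopologicalSpace G] [ChartedSpace L G] [Group G] [MulAction G Q]

/-- `pr : Q → B` is the principal bundle of a smooth, free and proper left action of `G` on `Q`:
`pr` is a surjective submersion whose fibres are the orbits, so that `B` is the orbit
manifold `Q / G`. -/
structure IsPrincipalBundle (pr : Q → B) : Prop where
  smooth_action : ContMDiff (𝓘(ℝ, L).prod 𝓘(ℝ, E)) 𝓘(ℝ, E) ∞ (fun p : G × Q => p.1 • p.2)
  free : ∀ (a : G) (q : Q), a • q = q → a = 1
  proper : ProperSMul G Q
  smooth : ContMDiff 𝓘(ℝ, E) 𝓘(ℝ, F) ∞ pr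
  surjective : Function.Surjective pr
  submersion : ∀ q, Function.Surjective (mfderiv 𝓘(ℝ, E) 𝓘(ℝ, F) pr q)
  fibre : ∀ q q', pr q = pr q' ↔ ∃ a : G, a • q = q'

/-- A surface in `Q` is vertical if it is the preimage of an embedded codimension-one submanifold
of the shape space. -/
def IsVertical (pr : Q → B) (S : Set Q) : Prop :=
  ∃ Sig : Set B, IsEmbeddedHypersurface 𝓘(ℝ, F) Sig ∧ S = pr ⁻¹' Sig

/-- The Lie algebra of `G`, as the tangent space at the identity. -/
abbrev LieAlg (L : Type*) [NormedAddCommGroup L] [NormedSpace ℝ L] (G : Type*)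
    [TopologicalSpace G] [ChartedSpace L G] [Group G] : Type _ :=
  TangentSpace 𝓘(ℝ, L) (1 : G)

/-- The infinitesimal generator `ξ ↦ ξ_Q(q)` of the action. -/
def infGen (q : Q) : LieAlg L G →L[ℝ] TangentSpace 𝓘(ℝ, E) q :=
  mfderiv 𝓘(ℝ, L) 𝓘(ℝ, E) (fun a : G => a • q) 1

variable [IsManifold 𝓘(ℝ, E) ∞ Q]

/-- Smooth Riemannian metrics on `Q`. -/
abbrev Metric (E : Type*) [NormedAddCommGroup E] [NormedSpace ℝ E]
    (Q : Type*) [TopologicalSpace Q] [ChartedSpace E Q] [IsManifold 𝓘(ℝ, E) ∞ Q] : Type _ :=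
  ContMDiffRiemannianMetric 𝓘(ℝ, E) ∞ E (fun q : Q => TangentSpace 𝓘(ℝ, E) q)

variable (g : Metric E Q)

/-- The momentum map `⟨J(v), ξ⟩ = g(v, ξ_Q(q))` on `T_q Q`. -/
def momentumMap (q : Q) : TangentSpace 𝓘(ℝ, E) q →L[ℝ] (LieAlg L G →L[ℝ] ℝ) :=
  (ContinuousLinearMap.precomp ℝ (infGen G q)).comp (g.inner q)

/-- The locked inertia tensor `⟨𝕀(q) ξ, η⟩ = g(ξ_Q(q), η_Q(q))`. -/
def lockedInertia (q : Q) : LieAlg L G →L[ℝ] (LieAlg L G →L[ℝ] ℝ) :=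
  (momentumMap G g q).comp (infGen G q)

/-- The mechanical connection `𝒜(q, v) = 𝕀(q)⁻¹ J(q, v)` (the locked inertia tensor is invertible
for a free action of a Lie group). -/
def mechanicalConnection (x : TangentBundle 𝓘(ℝ, E) Q) : LieAlg L G :=
  (lockedInertia G g x.proj).inverse (momentumMap G g x.proj x.2)

end Bundle

/-! ### Mechanical systems with impacts -/

section Mechanics

variable {E : Type*} [NormedAddCommGroup E] [NormedSpace ℝ E]
  {Q : Type*} [TopologicalSpace Q] [ChartedSpace E Q]

/-- The vector at `q` whose coordinate vector is `b` in the chart centred at `q₀`. -/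
def chartVector (q₀ q : Q) (b : E) : TangentSpace 𝓘(ℝ, E) q :=
  mfderiv 𝓘(ℝ, E) 𝓘(ℝ, E) (extChartAt 𝓘(ℝ, E) q₀).symm (extChartAt 𝓘(ℝ, E) q₀ q) b

/-- The coordinate vector of `v ∈ T_q Q` in the chart centred at `q₀`. -/
def chartCoord (q₀ q : Q) (v : TangentSpace 𝓘(ℝ, E) q) : E :=
  mfderiv 𝓘(ℝ, E) 𝓘(ℝ, E) (extChartAt 𝓘(ℝ, E) q₀) q v

/-- The state with configuration coordinate `y` and velocity coordinate `w` in the chart centred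
at `q₀`. -/
def chartState (q₀ : Q) (y w : E) : TangentBundle 𝓘(ℝ, E) Q :=
  ⟨(extChartAt 𝓘(ℝ, E) q₀).symm y,
    mfderiv 𝓘(ℝ, E) 𝓘(ℝ, E) (extChartAt 𝓘(ℝ, E) q₀).symm y w⟩

variable (E Q) in
/-- Force fields: a covector at `q` for every state `(q, v)`. -/
abbrev ForceField : Type _ :=
  ∀ q : Q, TangentSpace 𝓘(ℝ, E) q → (TangentSpace 𝓘(ℝ, E) q →L[ℝ] ℝ)

/-- A force field is dissipative if its power is never positive. -/
def IsDissipative (f : ForceField E Q) : Prop :=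
  ∀ q v, f q v v ≤ 0

variable [IsManifold 𝓘(ℝ, E) ∞ Q]

/-- The Lagrangian `L(q, v) = ½ g(v, v) - V(q)`. -/
def lagrangian (g : Metric E Q) (V : Q → ℝ) (x : TangentBundle 𝓘(ℝ, E) Q) : ℝ :=
  1 / 2 * g.inner x.proj x.2 x.2 - V x.proj

/-- The energy `½ g(v, v) + V(q)`, which is the Hamiltonian at the momentum `p = g(v, ·)`. -/
def energy (g : Metric E Q) (V : Q → ℝ) (x : TangentBundle 𝓘(ℝ, E) Q) : ℝ :=
  1 / 2 * g.inner x.proj x.2 x.2 + V x.proj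

/-- The component along `b` of the momentum `p = g(v, ·)` in the chart centred at `q₀`. -/
def momentum (g : Metric E Q) (q₀ : Q) (b : E) (x : TangentBundle 𝓘(ℝ, E) Q) : ℝ :=
  g.inner x.proj x.2 (chartVector q₀ x.proj b)

/-- The force `-α p` with `p = g(v, ·)`. -/
def linearDamping (g : Metric E Q) (α : ℝ) : ForceField E Q :=
  fun q v => -(α • g.inner q v)

theorem isDissipative_linearDamping (g : Metric E Q) {α : ℝ} (hα : 0 ≤ α) :
    IsDissipative (linearDamping g α) := by
  intro q v
  have h : 0 ≤ g.inner q v v := by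
    by_cases hv : v = 0
    · simp [hv]
    · exact (g.pos q v hv).le
  have h2 : linearDamping g α q v v = -(α * g.inner q v v) := rfl
  rw [h2]
  nlinarith [mul_nonneg hα h]

/-- `X` is the vector field on `TQ` of the mechanical system with kinetic energy metric `g`,
potential `V` and force `f`. It is Hamilton's equations `q̇ = ∂H/∂p`, `ṗ = -∂H/∂q + f` transported
to `TQ` by the Legendre transform: along `X` the velocity is `q̇ = v`, and in every chart
`ṗ_b = ∂_b L + f(b)` where `∂_b L` is the partial derivative of the Lagrangian in the
configuration coordinates, at a fixed velocity coordinate, in the direction `b`. -/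
structure IsMechanicalField (g : Metric E Q) (V : Q → ℝ) (f : ForceField E Q)
    (X : ∀ x : TangentBundle 𝓘(ℝ, E) Q, TangentSpace 𝓘(ℝ, E).tangent x) : Prop where
  velocity : ∀ x : TangentBundle 𝓘(ℝ, E) Q,
    (mfderiv 𝓘(ℝ, E).tangent 𝓘(ℝ, E)
      (fun y : TangentBundle 𝓘(ℝ, E) Q => y.proj) x (X x) : E) = x.2
  momentum_balance : ∀ (q₀ : Q) (x : TangentBundle 𝓘(ℝ, E) Q),
    x.proj ∈ (extChartAt 𝓘(ℝ, E) q₀).source → ∀ b : E,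
    (mfderiv 𝓘(ℝ, E).tangent 𝓘(ℝ) (momentum g q₀ b) x (X x) : ℝ) =
      fderiv ℝ (fun y : E => lagrangian g V (chartState q₀ y (chartCoord q₀ x.proj x.2)))
          (extChartAt 𝓘(ℝ, E) q₀ x.proj) b
        + f x.proj x.2 (chartVector q₀ x.proj b)

/-- The differential of `h : Q → ℝ` at `q`, evaluated at `w`. -/
def differential (h : Q → ℝ) (q : Q) (w : TangentSpace 𝓘(ℝ, E) q) : ℝ :=
  mfderiv 𝓘(ℝ, E) 𝓘(ℝ) h q w

/-- The Weierstrass--Erdmann corner conditions for an impact on the surface `S` at `q ∈ S`, from the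
velocity `v` to the velocity `v'`, for a surface moving with some normal velocity `ν` at the instant
of collision: `p⁺ = p⁻ + ε dh` and `H⁻ - H⁺ = ε ν`, where `h` is a local defining function of `S`
and `p = g(v, ·)`. -/
def IsImpact (g : Metric E Q) (V : Q → ℝ) (S : Set Q) (q : Q) (v v' : TangentSpace 𝓘(ℝ, E) q) :
    Prop :=
  ∀ U h, q ∈ U → IsLocalDefiningFunction 𝓘(ℝ, E) S U h → ∃ ε ν : ℝ,
    (∀ w : TangentSpace 𝓘(ℝ, E) q,
      g.inner q v' w = g.inner q v w + ε * differential h q w) ∧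
    energy g V ⟨q, v⟩ - energy g V ⟨q, v'⟩ = ε * ν

variable (E Q) in
/-- A mechanical system with `G`-invariant kinetic energy metric and potential, an external force,
and controlled impacts on a family of surfaces. -/
structure HybridMechanicalSystem (G : Type*) [Group G] [MulAction G Q] (ι U : Type*) where
  /-- the kinetic energy metric -/
  metric : Metric E Q
  metric_invariant : ∀ (a : G) (q : Q) (v w : TangentSpace 𝓘(ℝ, E) q),
    metric.inner (a • q) (mfderiv 𝓘(ℝ, E) 𝓘(ℝ, E) (fun q' : Q => a • q') q v)
      (mfderiv 𝓘(ℝ, E) 𝓘(ℝ, E) (fun q' : Q => a • q') q w) = metric.inner q v w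
  /-- the potential energy -/
  potential : Q → ℝ
  potential_smooth : ContMDiff 𝓘(ℝ, E) 𝓘(ℝ) ∞ potential
  potential_invariant : ∀ (a : G) (q : Q), potential (a • q) = potential q
  /-- the external force that acts between impacts -/
  force : ForceField E Q
  /-- the vector field of the continuous flow on `TQ`, determined by the previous data -/
  field : ∀ x : TangentBundle 𝓘(ℝ, E) Q, TangentSpace 𝓘(ℝ, E).tangent x
  field_smooth : ContMDiff 𝓘(ℝ, E).tangent 𝓘(ℝ, E).tangent.tangent 1
    (fun x => (⟨x, field x⟩ : TangentBundle 𝓘(ℝ, E).tangent (TangentBundle 𝓘(ℝ, E) Q)))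
  field_mechanical : IsMechanicalField metric potential force field
  /-- the impact surfaces in configuration space -/
  surface : ι → Set Q
  surface_hypersurface : ∀ i, IsEmbeddedHypersurface 𝓘(ℝ, E) (surface i)
  /-- the switching surfaces in phase space: the states over the `i`-th impact surface (for
  instance, those with velocity pointing into the wall) at which an impact takes place -/
  guard : ι → Set (TangentBundle 𝓘(ℝ, E) Q)
  guard_eq : ∀ i, ∃ O : Set (TangentBundle 𝓘(ℝ, E) Q), IsOpen O ∧
    guard i = {x | x ∈ O ∧ x.proj ∈ surface i}
  /-- the velocity after an impact on the `i`-th surface, under the control `u ∈ U`; only the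
  values over the `i`-th surface matter -/
  postVelocity : ι → U → ∀ q : Q, TangentSpace 𝓘(ℝ, E) q → TangentSpace 𝓘(ℝ, E) q
  impact_law : ∀ i u, ∀ q ∈ surface i, ∀ v,
    IsImpact metric potential (surface i) q v (postVelocity i u q v)

variable {G : Type*} [Group G] [MulAction G Q] {ι U : Type*}

/-- The controlled reset map `Δ_{u,i}`, to be considered on `TQ` restricted to the `i`-th
surface. -/
def HybridMechanicalSystem.reset (S : HybridMechanicalSystem E Q G ι U) (i : ι) (u : U)
    (x : TangentBundle 𝓘(ℝ, E) Q) : TangentBundle 𝓘(ℝ, E) Q :=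
  ⟨x.proj, S.postVelocity i u x.proj x.2⟩

/-- The hybrid system on `TQ` obtained by closing the loop with the feedback law `u = k i x` at
impacts on the `i`-th surface. -/
def HybridMechanicalSystem.closedLoop (S : HybridMechanicalSystem E Q G ι U)
    (k : ι → TangentBundle 𝓘(ℝ, E) Q → U) :
    HybridSystem 𝓘(ℝ, E).tangent (TangentBundle 𝓘(ℝ, E) Q) ι where
  field := S.field
  guard := S.guard
  reset := fun i x => S.reset i (k i x) x

variable {L : Type*} [NormedAddCommGroup L] [NormedSpace ℝ L]
  [TopologicalSpace G] [ChartedSpace L G]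

variable (L) in
/-- The identity `Δ_{u,i}^* 𝒜 = ι_i^* 𝒜` on `TQ` restricted to the `i`-th surface. -/
def HybridMechanicalSystem.PreservesConnection (S : HybridMechanicalSystem E Q G ι U)
    (i : ι) (u : U) : Prop :=
  ∀ x : TangentBundle 𝓘(ℝ, E) Q, x.proj ∈ S.surface i →
    (mechanicalConnection G S.metric (S.reset i u x) : LieAlg L G) =
      mechanicalConnection G S.metric x

variable (L) in
/-- Under the feedback law `k`, the reset on the `i`-th surface acts on the symmetry direction:
it changes the connection-induced symmetry variable `𝒜` of some state. -/
def HybridMechanicalSystem.CorrectsSymmetry (S : HybridMechanicalSystem E Q G ι U)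
    (k : ι → TangentBundle 𝓘(ℝ, E) Q → U) (i : ι) : Prop :=
  ∃ x : TangentBundle 𝓘(ℝ, E) Q, x.proj ∈ S.surface i ∧
    (mechanicalConnection G S.metric (S.reset i (k i x) x) : LieAlg L G) ≠
      mechanicalConnection G S.metric x

end Mechanics

end

end HybridMech

open HybridMech

namespace HybridMech

section LocalFlow

variable {E : Type*} [NormedAddCommGroup E] [NormedSpace ℝ E]

/-- A `C^1` vector field has a local flow near every point, which stays in a given neighbourhood
and is Lipschitz in the initial point and the time together. -/
theorem exists_lipschitz_local_flow [CompleteSpace E] {f : E → E} {u₀ : E}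
    (hf : ContDiffAt ℝ 1 f u₀) {W : Set E} (hW : W ∈ 𝓝 u₀) :
    ∃ r > (0 : ℝ), ∃ δ > (0 : ℝ), ∃ K : ℝ, 0 ≤ K ∧ ∃ α : E → ℝ → E, ∀ x ∈ Metric.ball u₀ r,
      α x 0 = x ∧
      (∀ t ∈ Icc (-δ) δ, α x t ∈ W ∧ HasDerivWithinAt (α x) (f (α x t)) (Icc (-δ) δ) t) ∧
      ∀ z ∈ Metric.ball u₀ r, ∀ t ∈ Icc (-δ) δ, ∀ t' ∈ Icc (-δ) δ,
        ‖α x t - α z t'‖ ≤ K * (‖x - z‖ + |t - t'|) := by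
  obtain ⟨ε, hε, a, r, L, K, hr, hpl⟩ := IsPicardLindelof.of_contDiffAt_one hf
  obtain ⟨α, hα, L', hL'⟩ :=
    (hpl 0).exists_forall_mem_closedBall_eq_hasDerivWithinAt_lipschitzOnWith
  simp only [zero_sub, zero_add] at hα hL'
  have hu₀ : u₀ ∈ Metric.closedBall u₀ (r : ℝ) := Metric.mem_closedBall_self r.2
  have hb : {u | ‖f u‖ < ‖f u₀‖ + 1} ∈ 𝓝 u₀ :=
    hf.continuousAt.norm.eventually_lt_const (lt_add_one _)
  obtain ⟨ρ, hρ, hρW⟩ := Metric.mem_nhds_iff.1 (inter_mem hW hb)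
  have h0 : (0 : ℝ) ∈ Icc (-ε) ε := ⟨by linarith, hε.le⟩
  have hcont : Tendsto (α u₀) (𝓝 0) (𝓝 u₀) := by
    have h1 := ((hα u₀ hu₀).2 0 h0).continuousWithinAt.continuousAt
      (Icc_mem_nhds (by linarith) hε)
    have h2 := (hα u₀ hu₀).1
    rw [ContinuousAt, h2] at h1
    exact h1
  obtain ⟨η, hη, hηρ⟩ := Metric.eventually_nhds_iff.1
    (hcont.eventually (Metric.ball_mem_nhds u₀ (half_pos hρ)))
  set δ := min (η / 2) ε with hδ
  have hδ0 : 0 < δ := lt_min (half_pos hη) hε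
  have hδε : Icc (-δ) δ ⊆ Icc (-ε) ε :=
    Icc_subset_Icc (neg_le_neg (min_le_right _ _)) (min_le_right _ _)
  set r' := min (r : ℝ) (ρ / 2 / (L' + 1)) with hr'
  have hr'0 : 0 < r' := lt_min hr (by positivity)
  have hball : Metric.ball u₀ r' ⊆ Metric.closedBall u₀ (r : ℝ) :=
    Metric.ball_subset_closedBall.trans (Metric.closedBall_subset_closedBall (min_le_left _ _))
  have hmem : ∀ x ∈ Metric.ball u₀ r', ∀ t ∈ Icc (-δ) δ, α x t ∈ Metric.ball u₀ ρ := by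
    intro x hx t ht
    have h1 : dist (α x t) (α u₀ t) ≤ L' * dist x u₀ :=
      (hL' t (hδε ht)).dist_le_mul x (hball hx) u₀ hu₀
    have h2 : dist (α u₀ t) u₀ < ρ / 2 := by
      refine hηρ ?_
      rw [Real.dist_eq, sub_zero]
      have : |t| ≤ δ := abs_le.2 ht
      have : δ ≤ η / 2 := min_le_left _ _
      linarith
    have h3 : dist x u₀ < ρ / 2 / (L' + 1) := lt_of_lt_of_le hx (min_le_right _ _)
    have h4 : (L' : ℝ) * dist x u₀ ≤ ρ / 2 := by
      have : (L' + 1 : ℝ) * dist x u₀ ≤ ρ / 2 := by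
        rw [lt_div_iff₀ (by positivity)] at h3
        linarith
      nlinarith [dist_nonneg (x := x) (y := u₀)]
    have := dist_triangle (α x t) (α u₀ t) u₀
    exact Metric.mem_ball.2 (by linarith)
  refine ⟨r', hr'0, δ, hδ0, L' + (‖f u₀‖ + 1), by positivity, α, fun x hx => ?_⟩
  have hder : ∀ x ∈ Metric.ball u₀ r', ∀ t ∈ Icc (-δ) δ,
      HasDerivWithinAt (α x) (f (α x t)) (Icc (-δ) δ) t := fun x hx t ht =>
    ((hα x (hball hx)).2 t (hδε ht)).mono hδε
  refine ⟨(hα x (hball hx)).1, fun t ht => ⟨(hρW (hmem x hx t ht)).1, hder x hx t ht⟩, ?_⟩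
  intro z hz t ht t' ht'
  have h1 : ‖α x t - α z t‖ ≤ L' * ‖x - z‖ := by
    simpa [dist_eq_norm] using (hL' t (hδε ht)).dist_le_mul x (hball hx) z (hball hz)
  have h2 : ‖α z t - α z t'‖ ≤ (‖f u₀‖ + 1) * ‖t - t'‖ :=
    (convex_Icc (-δ) δ).norm_image_sub_le_of_norm_hasDerivWithin_le
      (fun s hs => hder z hz s hs) (fun s hs => (hρW (hmem z hz s hs)).2.le) ht' ht
  have h3 : ‖α x t - α z t'‖ ≤ ‖α x t - α z t‖ + ‖α z t - α z t'‖ := by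
    simpa using norm_add_le (α x t - α z t) (α z t - α z t')
  rw [Real.norm_eq_abs] at h2
  have := norm_nonneg (x - z)
  have := abs_nonneg (t - t')
  have := norm_nonneg (f u₀)
  have := L'.2
  nlinarith [mul_nonneg L'.2 (abs_nonneg (t - t')),
    mul_nonneg (norm_nonneg (f u₀)) (norm_nonneg (x - z))]

end LocalFlow

section Straightening

variable {E : Type*} [NormedAddCommGroup E] [NormedSpace ℝ E]

/-- Near a regular zero `u₀` of `h`, a local diffeomorphism `ψ` that is tangent to the identity
carries the tangent hyperplane to the zero level of `h`. -/
theorem exists_straightening [CompleteSpace E] {h : E → ℝ} {u₀ : E} (hh : ContDiffAt ℝ 1 h u₀)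
    (h0 : h u₀ = 0) (hl : fderiv ℝ h u₀ ≠ 0) :
    ∃ ψ Ψ : E → E, ContDiffAt ℝ 1 ψ u₀ ∧ ContDiffAt ℝ 1 Ψ u₀ ∧ ψ u₀ = u₀ ∧ Ψ u₀ = u₀ ∧
      HasFDerivAt ψ (ContinuousLinearMap.id ℝ E) u₀ ∧
      (∀ᶠ w in 𝓝 u₀, fderiv ℝ h u₀ (w - u₀) = 0 → h (ψ w) = 0) ∧
      (∀ᶠ u in 𝓝 u₀, ψ (Ψ u) = u) ∧
      (∀ u, h u = 0 → fderiv ℝ h u₀ (Ψ u - u₀) = 0) := by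
  set ℓ := fderiv ℝ h u₀ with hℓ
  obtain ⟨e', he'⟩ : ∃ e, ℓ e ≠ 0 := by
    by_contra! hc
    exact hl (ContinuousLinearMap.ext hc)
  set e := (ℓ e')⁻¹ • e' with he
  have hle : ℓ e = 1 := by simp [he, he']
  set Ψ : E → E := fun u => u + (h u - ℓ (u - u₀)) • e with hΨ
  have hℓΨ : ∀ u, ℓ (Ψ u - u₀) = h u := by
    intro u
    simp only [hΨ, map_sub, map_add, map_smul, hle, smul_eq_mul]
    ring
  have hΨc : ContDiffAt ℝ 1 Ψ u₀ := by
    refine contDiffAt_id.add ((hh.sub ?_).smul contDiffAt_const)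
    exact (ℓ.contDiff.comp (contDiff_id.sub contDiff_const)).contDiffAt
  have hΨ' : HasFDerivAt Ψ ((ContinuousLinearEquiv.refl ℝ E : E ≃L[ℝ] E) : E →L[ℝ] E) u₀ := by
    have h1 : HasFDerivAt h ℓ u₀ := (hh.differentiableAt (by simp)).hasFDerivAt
    have h2 : HasFDerivAt (fun u => ℓ (u - u₀)) ℓ u₀ := by
      exact ℓ.hasFDerivAt.comp u₀ ((hasFDerivAt_id u₀).sub_const u₀)
    have h3 := (hasFDerivAt_id u₀).add ((h1.sub h2).smul_const e)
    have h4 : ((ContinuousLinearEquiv.refl ℝ E : E ≃L[ℝ] E) : E →L[ℝ] E) =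
        ContinuousLinearMap.id ℝ E + (ℓ - ℓ).smulRight e := by
      ext v
      simp
    rw [h4]
    exact h3
  have hΨ0 : Ψ u₀ = u₀ := by simp [hΨ, h0]
  set Φ := hΨc.toOpenPartialHomeomorph Ψ hΨ' (by simp) with hΦ
  have hmem : u₀ ∈ Φ.source := hΨc.mem_toOpenPartialHomeomorph_source hΨ' (by simp)
  have hcoe : ∀ u, Φ u = Ψ u := fun u => by
    rw [hΦ, ContDiffAt.toOpenPartialHomeomorph_coe]
  have hψ : ContDiffAt ℝ 1 (Φ.symm) u₀ := by
    have := hΨc.to_localInverse hΨ' (by simp)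
    rw [hΨ0] at this
    exact this
  have hψ0 : Φ.symm u₀ = u₀ := by
    have := Φ.left_inv hmem
    rwa [hcoe, hΨ0] at this
  have htgt : u₀ ∈ Φ.target := by
    have := Φ.map_source hmem
    rwa [hcoe, hΨ0] at this
  refine ⟨Φ.symm, Ψ, hψ, hΨc, hψ0, hΨ0, ?_, ?_, ?_, fun u hu => by rw [hℓΨ, hu]⟩
  · refine Φ.hasFDerivAt_symm (f' := ContinuousLinearEquiv.refl ℝ E) htgt ?_
    rw [hψ0]
    refine hΨ'.congr_of_eventuallyEq (Eventually.of_forall fun u => (hcoe u))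
  · filter_upwards [Φ.open_target.mem_nhds htgt] with w hw hw0
    have := Φ.right_inv hw
    rw [hcoe] at this
    rw [← hℓΨ, this, hw0]
  · filter_upwards [Φ.open_source.mem_nhds hmem] with u hu
    have := Φ.left_inv hu
    rwa [hcoe] at this

/-- The kernel of the differential of a defining function is contained in the kernel of the
differential of any function that vanishes on the zero level. -/
theorem fderiv_apply_eq_zero_of_zero_level [CompleteSpace E] {h k : E → ℝ} {u₀ : E}
    (hh : ContDiffAt ℝ 1 h u₀) (h0 : h u₀ = 0) (hl : fderiv ℝ h u₀ ≠ 0)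
    (hk : DifferentiableAt ℝ k u₀) (hk0 : ∀ᶠ u in 𝓝 u₀, h u = 0 → k u = 0) {w : E}
    (hw : fderiv ℝ h u₀ w = 0) : fderiv ℝ k u₀ w = 0 := by
  obtain ⟨ψ, Ψ, hψ, -, hψ0, -, hψ', hz, -, -⟩ := exists_straightening hh h0 hl
  have hline : HasDerivAt (fun t : ℝ => u₀ + t • w) w 0 := by
    simpa using ((hasDerivAt_id (0 : ℝ)).smul_const w).const_add u₀
  have hψ'' : HasFDerivAt ψ (ContinuousLinearMap.id ℝ E) (u₀ + (0 : ℝ) • w) := by simpa using hψ'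
  have h1 : HasDerivAt (fun t : ℝ => ψ (u₀ + t • w)) w 0 :=
    HasFDerivAt.comp_hasDerivAt (f := fun t : ℝ => u₀ + t • w) (0 : ℝ) hψ'' hline
  have hk' : HasFDerivAt k (fderiv ℝ k u₀) (ψ (u₀ + (0 : ℝ) • w)) := by
    simpa [hψ0] using hk.hasFDerivAt
  have h2 : HasDerivAt (fun t : ℝ => k (ψ (u₀ + t • w))) (fderiv ℝ k u₀ w) 0 :=
    hk'.comp_hasDerivAt (0 : ℝ) h1
  have ht : Tendsto (fun t : ℝ => u₀ + t • w) (𝓝 0) (𝓝 u₀) := by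
    simpa [ContinuousAt] using hline.continuousAt
  have ht2 : Tendsto (fun t : ℝ => ψ (u₀ + t • w)) (𝓝 0) (𝓝 u₀) := by
    simpa [ContinuousAt, hψ0] using h1.continuousAt
  have h3 : (fun t : ℝ => k (ψ (u₀ + t • w))) =ᶠ[𝓝 0] fun _ => (0 : ℝ) := by
    filter_upwards [ht.eventually hz, ht2.eventually hk0] with t h4 h5
    exact h5 (h4 (by simp [hw]))
  exact (h2.congr_of_eventuallyEq h3.symm).unique (hasDerivAt_const _ _)

/-- A map that is `C^1` within the regular zero level of a function is Lipschitz on this level,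
locally. -/
theorem ContDiffWithinAt.exists_lipschitz_of_zero_level [CompleteSpace E]
    {F : Type*} [NormedAddCommGroup F] [NormedSpace ℝ F] {h : E → ℝ} {u₀ : E}
    (hh : ContDiffAt ℝ 1 h u₀) (h0 : h u₀ = 0) (hl : fderiv ℝ h u₀ ≠ 0) {S : Set E}
    (hS : ∀ᶠ u in 𝓝 u₀, u ∈ S ↔ h u = 0) {f : E → F} (hf : ContDiffWithinAt ℝ 1 f S u₀) :
    ∃ K : ℝ, 0 ≤ K ∧ ∃ W ∈ 𝓝 u₀, ∀ x ∈ S ∩ W, ∀ z ∈ S ∩ W, ‖f x - f z‖ ≤ K * ‖x - z‖ := by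
  obtain ⟨ψ, Ψ, hψ, hΨ, hψ0, hΨ0, hψ', hz, hinv, hzΨ⟩ := exists_straightening hh h0 hl
  set ℓ := fderiv ℝ h u₀
  have hψt : Tendsto ψ (𝓝 u₀) (𝓝 u₀) := by simpa [ContinuousAt, hψ0] using hψ.continuousAt
  have hΨt : Tendsto Ψ (𝓝 u₀) (𝓝 u₀) := by simpa [ContinuousAt, hΨ0] using hΨ.continuousAt
  obtain ⟨ρ, hρ, hball⟩ := Metric.eventually_nhds_iff_ball.1 (hz.and (hψt.eventually hS))
  set C : Set E := Metric.ball u₀ ρ ∩ {w | ℓ (w - u₀) = 0} with hC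
  have hCconv : Convex ℝ C := by
    refine (convex_ball _ _).inter ?_
    intro a ha b hb s t _ _ hst
    have ha' : ℓ a = ℓ u₀ := by simpa [sub_eq_zero] using ha
    have hb' : ℓ b = ℓ u₀ := by simpa [sub_eq_zero] using hb
    have : ℓ (s • a + t • b) = ℓ u₀ := by
      simp only [map_add, map_smul, ha', hb', smul_eq_mul]
      rw [← add_mul, hst, one_mul]
    simp [this]
  have hmaps : MapsTo ψ C S := fun w hw =>
    ((hball w hw.1).2).2 ((hball w hw.1).1 hw.2)
  have hcomp : ContDiffWithinAt ℝ 1 (f ∘ ψ) C u₀ := by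
    refine ContDiffWithinAt.comp u₀ (t := S) ?_ hψ.contDiffWithinAt hmaps
    rwa [hψ0]
  obtain ⟨K₁, t, ht, hK₁⟩ := hcomp.exists_lipschitzOnWith hCconv
  obtain ⟨K₂, t₂, ht₂, hK₂⟩ := hΨ.exists_lipschitzOnWith
  obtain ⟨O, hO, hOt⟩ := mem_nhdsWithin_iff_exists_mem_nhds_inter.1 ht
  refine ⟨K₁ * K₂, by positivity, {u | Ψ u ∈ O ∩ Metric.ball u₀ ρ} ∩ t₂ ∩
    ({u | ψ (Ψ u) = u} ∩ {u | u ∈ S ↔ h u = 0}), ?_, ?_⟩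
  · exact inter_mem (inter_mem (hΨt (inter_mem hO (Metric.ball_mem_nhds _ hρ))) ht₂)
      (inter_mem hinv hS)
  · have key : ∀ x ∈ S ∩ ({u | Ψ u ∈ O ∩ Metric.ball u₀ ρ} ∩ t₂ ∩
        ({u | ψ (Ψ u) = u} ∩ {u | u ∈ S ↔ h u = 0})), Ψ x ∈ t ∧ x ∈ t₂ ∧ ψ (Ψ x) = x := by
      rintro x ⟨hxS, ⟨⟨hxO, hxb⟩, hxt⟩, hxi, hxS'⟩
      exact ⟨hOt ⟨hxO, hxb, hzΨ x (hxS'.1 hxS)⟩, hxt, hxi⟩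
    intro x hx z hz'
    obtain ⟨hx1, hx2, hx3⟩ := key x hx
    obtain ⟨hz1, hz2, hz3⟩ := key z hz'
    have h1 := hK₁.dist_le_mul _ hx1 _ hz1
    have h2 := hK₂.dist_le_mul _ hx2 _ hz2
    simp only [Function.comp_apply, hx3, hz3, dist_eq_norm] at h1 h2
    calc _ ≤ K₁ * ‖Ψ x - Ψ z‖ := h1
      _ ≤ K₁ * (K₂ * ‖x - z‖) := by gcongr
      _ = _ := by ring

end Straightening

section AdaptedNorm

/-- The powers of a complex square matrix of spectral radius less than one tend to zero. -/
theorem tendsto_pow_zero_of_spectralRadius_lt_one {n : ℕ} (A : Matrix (Fin n) (Fin n) ℂ)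
    (hA : spectralRadius ℂ A < 1) (i j : Fin n) :
    Tendsto (fun k : ℕ => (A ^ k) i j) atTop (𝓝 0) := by
  let _ := Matrix.linftyOpNormedRing (n := Fin n) (α := ℂ)
  let _ := Matrix.linftyOpNormedAlgebra (n := Fin n) (R := ℂ) (α := ℂ)
  have : CompleteSpace (Matrix (Fin n) (Fin n) ℂ) := FiniteDimensional.complete ℂ _
  have hG := spectrum.pow_nnnorm_pow_one_div_tendsto_nhds_spectralRadius A
  obtain ⟨r, hr1, hr2⟩ := ENNReal.lt_iff_exists_nnreal_btwn.1 hA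
  have hr2' : (r : ℝ) < 1 := by exact_mod_cast hr2
  have hev := hG.eventually (gt_mem_nhds hr1)
  have hle : ∀ᶠ k : ℕ in atTop, ‖(A ^ k) i j‖ ≤ (r : ℝ) ^ k := by
    filter_upwards [hev, eventually_gt_atTop 0] with k hk hk0
    have h1 : (‖A ^ k‖₊ : ENNReal) ≤ (r : ENNReal) ^ k := by
      have h2 := ENNReal.rpow_le_rpow hk.le (Nat.cast_nonneg (α := ℝ) k)
      rw [← ENNReal.rpow_mul, one_div, inv_mul_cancel₀ (by positivity), ENNReal.rpow_one,
        ENNReal.rpow_natCast] at h2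
      exact h2
    have h3 : ‖A ^ k‖₊ ≤ r ^ k := by exact_mod_cast h1
    have h4 : ‖(A ^ k) i j‖₊ ≤ ‖A ^ k‖₊ := by
      rw [Matrix.linfty_opNNNorm_def]
      exact (Finset.single_le_sum (f := fun j => ‖(A ^ k) i j‖₊) (fun _ _ => zero_le)
        (Finset.mem_univ j)).trans
        (Finset.le_sup (f := fun i => ∑ j, ‖(A ^ k) i j‖₊) (Finset.mem_univ i))
    exact_mod_cast h4.trans h3
  exact squeeze_zero_norm' hle (tendsto_pow_atTop_nhds_zero_of_lt_one r.2 hr2')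

theorem spectralRadius_toMatrix_map_algebraMap {V : Type*} [AddCommGroup V] [Module ℝ V]
    {n : ℕ} (b : Module.Basis (Fin n) ℝ V) (f : Module.End ℝ V) :
    spectralRadius ℂ ((LinearMap.toMatrix b b f).map (algebraMap ℝ ℂ)) =
      complexSpectralRadius f := by
  have h1 : spectrum ℂ (LinearMap.toMatrixAlgEquiv (b.baseChange ℂ) (LinearMap.baseChange ℂ f)) =
      spectrum ℂ (LinearMap.baseChange ℂ f : Module.End ℂ (ℂ ⊗[ℝ] V)) :=
    AlgEquiv.spectrum_eq _ _
  have h2 : LinearMap.toMatrixAlgEquiv (b.baseChange ℂ) (LinearMap.baseChange ℂ f) =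
      (LinearMap.toMatrix b b f).map (algebraMap ℝ ℂ) := by
    ext i j
    rw [LinearMap.toMatrixAlgEquiv_apply, Matrix.map_apply, LinearMap.toMatrix_apply]
    simp [Module.Basis.baseChange_repr_tmul, Algebra.smul_def]
  rw [h2] at h1
  unfold complexSpectralRadius spectralRadius
  rw [h1]

variable {V : Type*} [NormedAddCommGroup V] [NormedSpace ℝ V] [FiniteDimensional ℝ V]

/-- The powers of a real endomorphism all of whose complex eigenvalues have modulus less than one
tend to zero. -/
theorem tendsto_pow_zero_of_complexSpectralRadius_lt_one (f : Module.End ℝ V)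
    (hf : complexSpectralRadius f < 1) :
    Tendsto (fun k : ℕ => LinearMap.toContinuousLinearMap (f ^ k)) atTop (𝓝 0) := by
  set b := Module.finBasis ℝ V
  set A := LinearMap.toMatrix b b f with hA
  have hsp : spectralRadius ℂ (A.map (algebraMap ℝ ℂ)) < 1 :=
    (spectralRadius_toMatrix_map_algebraMap b f).trans_lt hf
  have hpow : ∀ i j, Tendsto (fun k : ℕ => (A ^ k) i j) atTop (𝓝 0) := by
    intro i j
    have h1 := (Complex.continuous_re.tendsto 0).comp
      (tendsto_pow_zero_of_spectralRadius_lt_one _ hsp i j)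
    refine h1.congr fun k => ?_
    have h2 : (A.map (algebraMap ℝ ℂ)) ^ k = (A ^ k).map (algebraMap ℝ ℂ) :=
      ((algebraMap ℝ ℂ).mapMatrix.map_pow A k).symm
    rw [Function.comp_apply, h2]
    simp
  have hpow' : Tendsto (fun k : ℕ => A ^ k) atTop (𝓝 0) :=
    tendsto_pi_nhds.2 fun i => tendsto_pi_nhds.2 fun j => hpow i j
  let Φ : Matrix (Fin _) (Fin _) ℝ →ₗ[ℝ] (V →L[ℝ] V) :=
    (LinearMap.toContinuousLinearMap : (V →ₗ[ℝ] V) ≃ₗ[ℝ] (V →L[ℝ] V)).toLinearMap ∘ₗ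
      (Matrix.toLin b b).toLinearMap
  have hΦ : Continuous Φ := LinearMap.continuous_of_finiteDimensional Φ
  have h3 := (hΦ.tendsto 0).comp hpow'
  rw [map_zero] at h3
  refine h3.congr fun k => ?_
  have h4 : Matrix.toLin b b (A ^ k) = f ^ k := by
    have : A ^ k = LinearMap.toMatrix b b (f ^ k) := (LinearMap.toMatrix_pow b f k)
    rw [this, Matrix.toLin_toMatrix]
  simp [Φ, h4]

/-- An endomorphism of spectral radius less than one is a contraction in an equivalent norm. -/
theorem exists_adapted_norm (f : Module.End ℝ V) (hf : complexSpectralRadius f < 1) :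
    ∃ κ : ℝ, 0 < κ ∧ κ < 1 ∧ ∃ C : ℝ, 0 < C ∧ ∃ ν : V → ℝ, (∀ v w, ν (v + w) ≤ ν v + ν w) ∧
      (∀ v, ‖v‖ ≤ ν v) ∧ (∀ v, ν v ≤ C * ‖v‖) ∧ ∀ v, ν (f v) ≤ κ * ν v := by
  have h1 := (tendsto_pow_zero_of_complexSpectralRadius_lt_one f hf).norm
  rw [norm_zero] at h1
  obtain ⟨m, hm, hm0⟩ := ((h1.eventually (gt_mem_nhds (by norm_num : (0 : ℝ) < 1 / 2))).and
    (eventually_gt_atTop 0)).exists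
  obtain ⟨κ, hκ0, hκ1, hκ⟩ : ∃ κ : ℝ, 0 < κ ∧ κ < 1 ∧ κ ^ m = 1 / 2 := by
    refine ⟨(1 / 2 : ℝ) ^ (1 / (m : ℝ)), by positivity,
      Real.rpow_lt_one (by norm_num) (by norm_num) (by positivity), ?_⟩
    rw [← Real.rpow_natCast, ← Real.rpow_mul (by norm_num), one_div_mul_cancel (by positivity),
      Real.rpow_one]
  have hfm : ∀ v, ‖(f ^ m) v‖ ≤ κ ^ m * ‖v‖ := fun v => by
    rw [hκ]
    exact ((LinearMap.toContinuousLinearMap (f ^ m)).le_opNorm v).trans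
      (by gcongr)
  set ν : V → ℝ := fun v => ∑ j ∈ Finset.range m, (κ ^ j)⁻¹ * ‖(f ^ j) v‖ with hν
  refine ⟨κ, hκ0, hκ1, ∑ j ∈ Finset.range m, (κ ^ j)⁻¹ *
    ‖LinearMap.toContinuousLinearMap (f ^ j)‖ + 1, by positivity, ν, ?_, ?_, ?_, ?_⟩
  · intro v w
    rw [hν, ← Finset.sum_add_distrib]
    refine Finset.sum_le_sum fun j _ => ?_
    rw [← mul_add, map_add]
    gcongr
    exact norm_add_le _ _
  · intro v
    have h2 := Finset.single_le_sum (f := fun j => (κ ^ j)⁻¹ * ‖(f ^ j) v‖)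
      (fun _ _ => by positivity) (Finset.mem_range.2 hm0)
    simpa using h2
  · intro v
    have h2 : ν v ≤ (∑ j ∈ Finset.range m, (κ ^ j)⁻¹ *
        ‖LinearMap.toContinuousLinearMap (f ^ j)‖) * ‖v‖ := by
      rw [hν, Finset.sum_mul]
      refine Finset.sum_le_sum fun j _ => ?_
      rw [mul_assoc]
      gcongr
      exact (LinearMap.toContinuousLinearMap (f ^ j)).le_opNorm v
    nlinarith [norm_nonneg v]
  · intro v
    have h2 : ∀ j, (κ ^ j)⁻¹ * ‖(f ^ j) (f v)‖ = κ * ((κ ^ (j + 1))⁻¹ * ‖(f ^ (j + 1)) v‖) := by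
      intro j
      rw [pow_succ f, Module.End.mul_apply, pow_succ κ]
      field_simp
    have h3 : ν (f v) = κ * ∑ j ∈ Finset.range m, (κ ^ (j + 1))⁻¹ * ‖(f ^ (j + 1)) v‖ := by
      rw [hν, Finset.mul_sum]
      exact Finset.sum_congr rfl fun j _ => h2 j
    have h4 := Finset.sum_range_succ' (fun j => (κ ^ j)⁻¹ * ‖(f ^ j) v‖) m
    have h5 := Finset.sum_range_succ (fun j => (κ ^ j)⁻¹ * ‖(f ^ j) v‖) m
    rw [h3]
    have h6 : (κ ^ m)⁻¹ * ‖(f ^ m) v‖ ≤ ‖v‖ := by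
      rw [inv_mul_le_iff₀ (by positivity)]
      exact hfm v
    simp only [pow_zero, inv_one, one_mul, Module.End.one_apply] at h4
    gcongr
    simp only [hν]
    linarith

end AdaptedNorm

section ChartDist

variable {E : Type*} [NormedAddCommGroup E] [NormedSpace ℝ E]
  {H : Type*} [TopologicalSpace H] {I : ModelWithCorners ℝ E H}
  {M : Type*} [TopologicalSpace M] [ChartedSpace H M] {d : M → M → ℝ}

namespace IsChartCompatibleDist

theorem self_eq_zero (hd : IsChartCompatibleDist I d) (x : M) : d x x = 0 :=
  (hd.eq_zero_iff x x).2 rfl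

theorem nonneg (hd : IsChartCompatibleDist I d) (x y : M) : 0 ≤ d x y := by
  have h1 := hd.triangle x y x
  rw [hd.self_eq_zero, hd.symm y x] at h1
  linarith

theorem ball_mem_nhds (hd : IsChartCompatibleDist I d) (x : M) {ε : ℝ} (hε : 0 < ε) :
    {y | d x y < ε} ∈ 𝓝 x :=
  (hd.nhds_basis x).mem_of_mem hε

theorem tendsto_nhds_iff (hd : IsChartCompatibleDist I d) {α : Type*} {l : Filter α} {f : α → M}
    {x : M} : Tendsto f l (𝓝 x) ↔ Tendsto (fun a => d x (f a)) l (𝓝 0) := by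
  rw [(hd.nhds_basis x).tendsto_right_iff, Metric.tendsto_nhds]
  simp only [mem_ofPred_eq, Real.dist_eq, sub_zero, abs_of_nonneg (hd.nonneg _ _)]

theorem tendsto_self (hd : IsChartCompatibleDist I d) (x : M) :
    Tendsto (fun y => d x y) (𝓝 x) (𝓝 0) :=
  hd.tendsto_nhds_iff.1 tendsto_id

theorem t2Space (hd : IsChartCompatibleDist I d) : T2Space M := by
  refine ⟨fun x y hxy => ?_⟩
  have hpos : 0 < d x y :=
    lt_of_le_of_ne (hd.nonneg x y) fun h => hxy ((hd.eq_zero_iff x y).1 h.symm)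
  have hdisj : Disjoint (𝓝 x) (𝓝 y) := by
    rw [(hd.nhds_basis x).disjoint_iff (hd.nhds_basis y)]
    refine ⟨d x y / 2, half_pos hpos, d x y / 2, half_pos hpos, ?_⟩
    rw [Set.disjoint_left]
    intro z (hz : d x z < _) (hz' : d y z < _)
    have := hd.triangle x z y
    rw [hd.symm z y] at this
    linarith
  obtain ⟨u, hu, w, hw, huw⟩ := Filter.disjoint_iff.1 hdisj
  exact ⟨interior u, interior w, isOpen_interior, isOpen_interior, mem_interior_iff_mem_nhds.2 hu,
    mem_interior_iff_mem_nhds.2 hw, huw.mono interior_subset interior_subset⟩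

end IsChartCompatibleDist

end ChartDist

section FlowBox

variable {E : Type*} [NormedAddCommGroup E] [NormedSpace ℝ E]
  {H : Type*} [TopologicalSpace H] {I : ModelWithCorners ℝ E H}
  {M : Type*} [TopologicalSpace M] [ChartedSpace H M]

/-- `Φ` is a local flow of `v`, defined on the open set `N` for times in `[-δ, δ]`, with values in
`U` and Lipschitz for the distance `d`. -/
structure IsFlowBox (d : M → M → ℝ) (v : ∀ x : M, TangentSpace I x) (U N : Set M) (δ K : ℝ)
    (Φ : M → ℝ → M) : Prop where
  isOpen : IsOpen N
  pos : 0 < δ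
  nonneg : 0 ≤ K
  zero : ∀ x ∈ N, Φ x 0 = x
  mem : ∀ x ∈ N, ∀ t ∈ Icc (-δ) δ, Φ x t ∈ U
  integral : ∀ x ∈ N, IsMIntegralCurveOn (Φ x) v (Icc (-δ) δ)
  lipschitz : ∀ x ∈ N, ∀ z ∈ N, ∀ t ∈ Icc (-δ) δ, ∀ t' ∈ Icc (-δ) δ,
    d (Φ x t) (Φ z t') ≤ K * (d x z + |t - t'|)

theorem IsFlowBox.mono {d : M → M → ℝ} {v : ∀ x : M, TangentSpace I x} {U N N' : Set M}
    {δ K K' : ℝ} {Φ : M → ℝ → M} (h : IsFlowBox d v U N δ K Φ) (hd : IsChartCompatibleDist I d)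
    (hN : N' ⊆ N) (hN' : IsOpen N') (hK : K ≤ K') : IsFlowBox d v U N' δ K' Φ where
  isOpen := hN'
  pos := h.pos
  nonneg := h.nonneg.trans hK
  zero := fun x hx => h.zero x (hN hx)
  mem := fun x hx => h.mem x (hN hx)
  integral := fun x hx => h.integral x (hN hx)
  lipschitz := fun x hx z hz t ht t' ht' => (h.lipschitz x (hN hx) z (hN hz) t ht t' ht').trans
    (mul_le_mul_of_nonneg_right hK (add_nonneg (hd.nonneg _ _) (abs_nonneg _)))

variable [I.Boundaryless] [IsManifold I 1 M]

/-- The image under the inverse chart of an integral curve of the vector field in coordinates is an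
integral curve. -/
theorem hasMFDerivAt_extChartAt_symm_comp {v : ∀ x : M, TangentSpace I x} {y : M} {f : ℝ → E}
    {t : ℝ} (hf : f t ∈ (extChartAt I y).target)
    (h : HasDerivAt f (tangentCoordChange I ((extChartAt I y).symm (f t)) y
      ((extChartAt I y).symm (f t)) (v ((extChartAt I y).symm (f t)))) t) :
    HasMFDerivAt 𝓘(ℝ, ℝ) I ((extChartAt I y).symm ∘ f) t
      ((1 : ℝ →L[ℝ] ℝ).smulRight (v ((extChartAt I y).symm (f t)))) := by
  have hft1 := (extChartAt I y).map_target hf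
  set xₜ : M := (extChartAt I y).symm (f t) with hxt
  have hft2 := mem_extChartAt_source (I := I) xₜ
  have key₁ : ∀ (g : ℝ → E) (w : E), HasDerivAt g w t →
      HasFDerivAt g ((1 : ℝ →L[ℝ] ℝ).smulRight w) t := fun g w hg => by
    simpa [ContinuousLinearMap.smulRight_one_eq_toSpanSingleton] using hg.hasFDerivAt
  suffices hs : HasDerivAt ((extChartAt I xₜ ∘ (extChartAt I y).symm) ∘ f) (v xₜ) t from
    ⟨(continuousAt_extChartAt_symm'' hf).comp h.continuousAt,
      (key₁ _ _ hs).hasFDerivWithinAt⟩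
  have hself : ∀ w : E, tangentCoordChange I y xₜ xₜ (tangentCoordChange I xₜ y xₜ w) = w := by
    intro w
    rw [tangentCoordChange_comp ⟨⟨hft2, hft1⟩, hft2⟩, tangentCoordChange_self hft2]
  refine (hself (v xₜ)) ▸ ?_
  have key : ∀ (g : E → E) (A : E →L[ℝ] E) (w : E), HasDerivAt f w t → HasFDerivAt g A (f t) →
      HasDerivAt (g ∘ f) (A w) t := fun g A w hw hg => hg.comp_hasDerivAt t hw
  refine key _ (tangentCoordChange I y xₜ xₜ) _ h ?_
  have h2 := hasFDerivWithinAt_tangentCoordChange (I := I) (x := y) (y := xₜ) (z := xₜ)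
    ⟨hft1, hft2⟩
  rw [I.range_eq_univ, hasFDerivWithinAt_univ] at h2
  rw [hxt, (extChartAt I y).right_inv hf] at h2
  exact h2

/-- A `C^1` vector field has flow boxes around every point. -/
theorem exists_isFlowBox [CompleteSpace E] {d : M → M → ℝ} (hd : IsChartCompatibleDist I d)
    {v : ∀ x : M, TangentSpace I x}
    (hv : ContMDiff I I.tangent 1 (fun x => (⟨x, v x⟩ : TangentBundle I M))) (y : M) {U : Set M}
    (hU : U ∈ 𝓝 y) : ∃ N δ K Φ, y ∈ N ∧ IsFlowBox d v U N δ K Φ := by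
  obtain ⟨K₁, hK₁, U₁, hU₁, hbi⟩ := hd.bilipschitz y
  set φ := extChartAt I y with hφ
  have hvy := hv y
  rw [contMDiffAt_iff] at hvy
  have hf : ContDiffAt ℝ 1 (fun u : E => tangentCoordChange I (φ.symm u) y (φ.symm u)
      (v (φ.symm u))) (φ y) := by
    have := hvy.2.contDiffAt (by simp [I.range_eq_univ])
    exact this.snd
  have hW : φ.symm ⁻¹' (U ∩ U₁) ∩ φ.target ∈ 𝓝 (φ y) :=
    inter_mem ((continuousAt_extChartAt_symm y).preimage_mem_nhds
      (by simpa [hφ] using inter_mem hU hU₁)) (extChartAt_target_mem_nhds y)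
  obtain ⟨r, hr, δ, hδ, K, hK, α, hα⟩ := exists_lipschitz_local_flow hf hW
  have hN : φ.source ∩ φ ⁻¹' (Metric.ball (φ y) r) ∩ interior U₁ ∈ 𝓝 y :=
    inter_mem (inter_mem (extChartAt_source_mem_nhds y)
      ((continuousAt_extChartAt y).preimage_mem_nhds (Metric.ball_mem_nhds _ hr)))
      (interior_mem_nhds.2 hU₁)
  set N := interior (φ.source ∩ φ ⁻¹' (Metric.ball (φ y) r) ∩ interior U₁) with hNdef
  have hNsub : ∀ x ∈ N, x ∈ φ.source ∧ φ x ∈ Metric.ball (φ y) r ∧ x ∈ U₁ := fun x hx =>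
    ⟨(interior_subset hx).1.1, (interior_subset hx).1.2, interior_subset (interior_subset hx).2⟩
  have hsub : Icc (-(δ / 2)) (δ / 2) ⊆ Ioo (-δ) δ := fun t ht =>
    ⟨by linarith [ht.1], by linarith [ht.2]⟩
  refine ⟨N, δ / 2, K₁ * K * (K₁ + 1), fun x t => φ.symm (α (φ x) t),
    mem_interior_iff_mem_nhds.2 hN,
    isOpen_interior, half_pos hδ, by positivity, ?_, ?_, ?_, ?_⟩
  · intro x hx
    obtain ⟨h1, h2, h3⟩ := hNsub x hx
    rw [(hα _ h2).1, φ.left_inv h1]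
  · intro x hx t ht
    exact (((hα _ (hNsub x hx).2.1).2.1 t (Ioo_subset_Icc_self (hsub ht))).1.1).1
  · intro x hx t ht
    obtain ⟨h1, h2⟩ := (hα _ (hNsub x hx).2.1).2.1 t (Ioo_subset_Icc_self (hsub ht))
    exact (hasMFDerivAt_extChartAt_symm_comp h1.2
      (h2.hasDerivAt (Icc_mem_nhds (hsub ht).1 (hsub ht).2))).hasMFDerivWithinAt
  · intro x hx z hz t ht t' ht'
    obtain ⟨hx1, hx2, hx3⟩ := hNsub x hx
    obtain ⟨hz1, hz2, hz3⟩ := hNsub z hz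
    have htx := ((hα _ hx2).2.1 t (Ioo_subset_Icc_self (hsub ht))).1
    have htz := ((hα _ hz2).2.1 t' (Ioo_subset_Icc_self (hsub ht'))).1
    have h1 := (hbi _ htx.1.2 _ htz.1.2).2
    rw [φ.right_inv htx.2, φ.right_inv htz.2] at h1
    have h2 := (hα _ hx2).2.2 _ hz2 t (Ioo_subset_Icc_self (hsub ht)) t'
      (Ioo_subset_Icc_self (hsub ht'))
    have h3 := (hbi _ hx3 _ hz3).1
    rw [inv_mul_le_iff₀ hK₁] at h3
    have h4 : ‖φ x - φ z‖ + |t - t'| ≤ (K₁ + 1) * (d x z + |t - t'|) := by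
      nlinarith [hd.nonneg x z, abs_nonneg (t - t'), mul_nonneg hK₁.le (abs_nonneg (t - t'))]
    calc _ ≤ K₁ * ‖α (φ x) t - α (φ z) t'‖ := h1
      _ ≤ K₁ * (K * (‖φ x - φ z‖ + |t - t'|)) := by gcongr
      _ ≤ K₁ * (K * ((K₁ + 1) * (d x z + |t - t'|))) := by gcongr
      _ = _ := by ring

end FlowBox

section Level

/-- The derivative of a real function `h` at `x` along the tangent vector `w`. -/
noncomputable def derivAlong {E : Type*} [NormedAddCommGroup E] [NormedSpace ℝ E]
    {H : Type*} [TopologicalSpace H] (I : ModelWithCorners ℝ E H)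
    {M : Type*} [TopologicalSpace M] [ChartedSpace H M] (h : M → ℝ) (x : M)
    (w : TangentSpace I x) : ℝ :=
  mfderiv I 𝓘(ℝ) h x w

variable {E : Type*} [NormedAddCommGroup E] [NormedSpace ℝ E]
  {H : Type*} [TopologicalSpace H] {I : ModelWithCorners ℝ E H}
  {M : Type*} [TopologicalSpace M] [ChartedSpace H M]

theorem IsLocalDefiningFunction.neg {S U : Set M} {h : M → ℝ}
    (hh : IsLocalDefiningFunction I S U h) : IsLocalDefiningFunction I S U (-h) where
  isOpen := hh.isOpen
  smooth := hh.smooth.neg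
  regular := fun y hy => by
    rw [mfderiv_neg]
    exact neg_ne_zero.2 (hh.regular y hy)
  mem_iff := fun y hy => by simp [hh.mem_iff y hy]

/-- A defining function along which a vector that is not tangent points upwards. -/
theorem exists_isLocalDefiningFunction_pos {S : Set M} {x : M} {w : TangentSpace I x}
    (hw : w ∉ hypersurfaceTangent I S x) :
    ∃ U h, x ∈ U ∧ IsLocalDefiningFunction I S U h ∧ 0 < derivAlong I h x w := by
  have h1 : ¬ ∀ U h, x ∈ U → IsLocalDefiningFunction I S U h → mfderiv I 𝓘(ℝ) h x w = 0 := hw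
  push Not at h1
  obtain ⟨U, h, hx, hh, hne⟩ := h1
  rcases lt_or_gt_of_ne (show derivAlong I h x w ≠ 0 from hne) with hlt | hgt
  · refine ⟨U, -h, hx, hh.neg, ?_⟩
    have h2 : derivAlong I (-h) x w = -derivAlong I h x w := by
      unfold derivAlong
      rw [mfderiv_neg]
      rfl
    rw [h2]
    exact neg_pos.2 hlt
  · exact ⟨U, h, hx, hh, hgt⟩

theorem IsLocalDefiningFunction.contMDiffAt {S U : Set M} {h : M → ℝ} {y : M}
    (hh : IsLocalDefiningFunction I S U h) (hy : y ∈ U) : ContMDiffAt I 𝓘(ℝ) ∞ h y :=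
  hh.smooth.contMDiffAt (hh.isOpen.mem_nhds hy)

theorem IsLocalDefiningFunction.eventually_lt_derivAlong [IsManifold I 1 M]
    {S U : Set M} {h : M → ℝ} {y : M}
    (hh : IsLocalDefiningFunction I S U h) (hyU : y ∈ U) {v : ∀ x : M, TangentSpace I x}
    (hv : Continuous (fun x => (⟨x, v x⟩ : TangentBundle I M))) {c : ℝ}
    (hc : c < derivAlong I h y (v y)) :
    ∀ᶠ x in 𝓝 y, c < derivAlong I h x (v x) := by
  have h1 := (hh.smooth.of_le (m := 1) (by simp)).continuousOn_tangentMapWithin le_rfl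
    hh.isOpen.uniqueMDiffOn
  have h2 : ContinuousOn (fun x => tangentMapWithin I 𝓘(ℝ) h U ⟨x, v x⟩) U :=
    h1.comp hv.continuousOn fun x hx => hx
  have h3 : ContinuousAt (fun x => (tangentBundleModelSpaceHomeomorph 𝓘(ℝ)
      (tangentMapWithin I 𝓘(ℝ) h U ⟨x, v x⟩)).2) y :=
    (continuous_snd.comp (tangentBundleModelSpaceHomeomorph 𝓘(ℝ)).continuous).continuousAt.comp
      (h2.continuousAt (hh.isOpen.mem_nhds hyU))
  have h4 : ∀ x ∈ U, (tangentBundleModelSpaceHomeomorph 𝓘(ℝ)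
      (tangentMapWithin I 𝓘(ℝ) h U ⟨x, v x⟩)).2 = derivAlong I h x (v x) := by
    intro x hx
    unfold derivAlong
    rw [← mfderivWithin_of_isOpen hh.isOpen hx]
    rfl
  filter_upwards [h3.eventually (lt_mem_nhds (hc.trans_eq (h4 y hyU).symm)),
    hh.isOpen.mem_nhds hyU] with x hx hxU
  rwa [h4 x hxU] at hx

variable [I.Boundaryless]

theorem IsLocalDefiningFunction.contDiffAt_chart {S U : Set M} {h : M → ℝ} {y : M}
    (hh : IsLocalDefiningFunction I S U h) (hy : y ∈ U) :
    ContDiffAt ℝ 1 (h ∘ (extChartAt I y).symm) (extChartAt I y y) := by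
  have h1 := (contMDiffAt_iff.1 ((hh.contMDiffAt hy).of_le (m := 1) (by simp))).2
  exact h1.contDiffAt (by simp [I.range_eq_univ])

theorem IsLocalDefiningFunction.fderiv_chart {S U : Set M} {h : M → ℝ} {y : M}
    (hh : IsLocalDefiningFunction I S U h) (hy : y ∈ U) :
    (mfderiv I 𝓘(ℝ) h y : E →L[ℝ] ℝ) =
      fderiv ℝ (h ∘ (extChartAt I y).symm) (extChartAt I y y) := by
  have h1 := ((hh.contMDiffAt hy).mdifferentiableAt (by simp)).mfderiv
  rw [h1, I.range_eq_univ, fderivWithin_univ]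
  rfl

/-- A map that is `C^1` within an embedded hypersurface is locally Lipschitz on it. -/
theorem IsLocalDefiningFunction.exists_lipschitz [CompleteSpace E] {d : M → M → ℝ}
    (hd : IsChartCompatibleDist I d) {S U : Set M} {h : M → ℝ} {y : M}
    (hh : IsLocalDefiningFunction I S U h) (hyU : y ∈ U) (hyS : y ∈ S) {R : M → M}
    (hR : ContMDiffWithinAt I I 1 R S y) :
    ∃ K : ℝ, 0 ≤ K ∧ ∃ W ∈ 𝓝 y, ∀ x ∈ S ∩ W, ∀ z ∈ S ∩ W, d (R x) (R z) ≤ K * d x z := by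
  obtain ⟨K₁, hK₁, U₁, hU₁, hbi₁⟩ := hd.bilipschitz y
  obtain ⟨K₂, hK₂, U₂, hU₂, hbi₂⟩ := hd.bilipschitz (R y)
  set φ := extChartAt I y with hφ
  have hsymm : Tendsto φ.symm (𝓝 (φ y)) (𝓝 y) := by
    have := continuousAt_extChartAt_symm (I := I) y
    rwa [ContinuousAt, extChartAt_to_inv] at this
  obtain ⟨hRc, hR'⟩ := contMDiffWithinAt_iff.1 hR
  rw [I.range_eq_univ, inter_univ] at hR'
  have hS : ∀ᶠ u in 𝓝 (φ y), u ∈ φ.symm ⁻¹' S ↔ (h ∘ φ.symm) u = 0 := by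
    filter_upwards [hsymm (hh.isOpen.mem_nhds hyU)] with u hu
    exact hh.mem_iff _ hu
  have h0 : (h ∘ φ.symm) (φ y) = 0 := by
    simpa [hφ] using (hh.mem_iff y hyU).1 hyS
  have hl : fderiv ℝ (h ∘ φ.symm) (φ y) ≠ 0 := by
    rw [← hh.fderiv_chart hyU]
    exact hh.regular y hyU
  obtain ⟨K, hK, W, hW, hlip⟩ := ContDiffWithinAt.exists_lipschitz_of_zero_level
    (hh.contDiffAt_chart hyU) h0 hl hS hR'
  obtain ⟨O, hO, hOt⟩ :=
    mem_nhdsWithin_iff_exists_mem_nhds_inter.1 (hRc.preimage_mem_nhdsWithin hU₂)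
  refine ⟨K₂ * (K * K₁), by positivity, φ.source ∩ φ ⁻¹' W ∩ U₁ ∩ O, ?_, ?_⟩
  · exact inter_mem (inter_mem (inter_mem (extChartAt_source_mem_nhds y)
      ((continuousAt_extChartAt y).preimage_mem_nhds hW)) hU₁) hO
  · rintro x ⟨hxS, ⟨⟨hxs, hxW⟩, hxU⟩, hxO⟩ z ⟨hzS, ⟨⟨hzs, hzW⟩, hzU⟩, hzO⟩
    have h1 := (hbi₂ _ (hOt ⟨hxO, hxS⟩) _ (hOt ⟨hzO, hzS⟩)).2
    have h2 := hlip (φ x) ⟨by simpa [φ.left_inv hxs] using hxS, hxW⟩ (φ z)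
      ⟨by simpa [φ.left_inv hzs] using hzS, hzW⟩
    simp only [Function.comp_apply, ← hφ, φ.left_inv hxs, φ.left_inv hzs] at h2
    have h3 := (hbi₁ _ hxU _ hzU).1
    rw [inv_mul_le_iff₀ hK₁] at h3
    calc _ ≤ K₂ * ‖extChartAt I (R y) (R x) - extChartAt I (R y) (R z)‖ := h1
      _ ≤ K₂ * (K * ‖φ x - φ z‖) := by gcongr
      _ ≤ K₂ * (K * (K₁ * d x z)) := by gcongr
      _ = _ := by ring

theorem IsLocalDefiningFunction.exists_lipschitz_self {d : M → M → ℝ}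
    (hd : IsChartCompatibleDist I d) {S U : Set M} {h : M → ℝ} {y : M}
    (hh : IsLocalDefiningFunction I S U h) (hyU : y ∈ U) :
    ∃ K : ℝ, 0 ≤ K ∧ ∃ W ∈ 𝓝 y, ∀ x ∈ W, ∀ z ∈ W, |h x - h z| ≤ K * d x z := by
  obtain ⟨K₁, hK₁, U₁, hU₁, hbi₁⟩ := hd.bilipschitz y
  obtain ⟨K, W, hW, hlip⟩ := (hh.contDiffAt_chart hyU).exists_lipschitzOnWith
  set φ := extChartAt I y with hφ
  refine ⟨K * K₁, by positivity, φ.source ∩ φ ⁻¹' W ∩ U₁, ?_, ?_⟩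
  · exact inter_mem (inter_mem (extChartAt_source_mem_nhds y)
      ((continuousAt_extChartAt y).preimage_mem_nhds hW)) hU₁
  · rintro x ⟨⟨hxs, hxW⟩, hxU⟩ z ⟨⟨hzs, hzW⟩, hzU⟩
    have h2 := hlip.dist_le_mul _ hxW _ hzW
    simp only [Function.comp_apply, φ.left_inv hxs, φ.left_inv hzs, dist_eq_norm,
      Real.norm_eq_abs] at h2
    have h3 := (hbi₁ _ hxU _ hzU).1
    rw [inv_mul_le_iff₀ hK₁] at h3
    calc _ ≤ K * ‖φ x - φ z‖ := h2
      _ ≤ K * (K₁ * d x z) := by gcongr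
      _ = _ := by ring

variable [IsManifold I 1 M]

/-- The flow box around a point at which a vector field crosses a hypersurface, with the crossing
time `θ`. -/
theorem exists_isFlowBox_crossing [CompleteSpace E] {d : M → M → ℝ}
    (hd : IsChartCompatibleDist I d) {v : ∀ x : M, TangentSpace I x}
    (hv : ContMDiff I I.tangent 1 (fun x => (⟨x, v x⟩ : TangentBundle I M))) {y : M} {S U : Set M}
    {h : M → ℝ} (hh : IsLocalDefiningFunction I S U h) (hyU : y ∈ U) (hyS : y ∈ S)
    (hpos : 0 < derivAlong I h y (v y)) {U' : Set M} (hU' : U' ∈ 𝓝 y) :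
    ∃ N δ K Φ, y ∈ N ∧ IsFlowBox d v (U' ∩ U) N δ K Φ ∧ ∃ θ : M → ℝ, θ y = 0 ∧
      (∀ x ∈ N, |θ x| < δ ∧ ∀ t ∈ Icc (-δ) δ,
        (h (Φ x t) = 0 ↔ t = θ x)) ∧
      ∀ x ∈ N, ∀ z ∈ N, |θ x - θ z| ≤ K * d x z := by
  set c := derivAlong I h y (v y) / 2 with hc
  have hc0 : 0 < c := half_pos hpos
  obtain ⟨Kh, hKh, W, hW, hWlip⟩ := hh.exists_lipschitz_self hd hyU
  have hder := hh.eventually_lt_derivAlong hyU hv.continuous (half_lt_self hpos)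
  obtain ⟨N, δ, K, Φ, hyN, hbox⟩ := exists_isFlowBox hd hv y
    (inter_mem (inter_mem hU' (hh.isOpen.mem_nhds hyU)) (inter_mem hW hder))
  have hδ := hbox.pos
  have hK := hbox.nonneg
  have h0mem : (0 : ℝ) ∈ Icc (-δ) δ := ⟨by linarith, hδ.le⟩
  have hcont : ∀ x ∈ N, ContinuousOn (fun t => h (Φ x t)) (Icc (-δ) δ) := fun x hx =>
    hh.smooth.continuousOn.comp (hbox.integral x hx).continuousOn
      fun t ht => (hbox.mem x hx t ht).1.2
  have hmono : ∀ x ∈ N, ∀ t ∈ Icc (-δ) δ, ∀ t' ∈ Icc (-δ) δ, t ≤ t' →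
      c * (t' - t) ≤ h (Φ x t') - h (Φ x t) := by
    intro x hx
    have hd' : ∀ t ∈ Ioo (-δ) δ, HasDerivAt (fun t => h (Φ x t))
        (derivAlong I h (Φ x t) (v (Φ x t))) t := by
      intro t ht
      have h1 := (hbox.integral x hx t (Ioo_subset_Icc_self ht)).hasMFDerivAt
        (Icc_mem_nhds ht.1 ht.2)
      have h2 := ((hh.contMDiffAt (hbox.mem x hx t (Ioo_subset_Icc_self ht)).1.2).mdifferentiableAt
        (by simp)).hasMFDerivAt
      have key : ∀ (f : ℝ → ℝ) (A : E →L[ℝ] ℝ) (w : E),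
          HasFDerivAt f (A.comp ((1 : ℝ →L[ℝ] ℝ).smulRight w)) t → HasDerivAt f (A w) t :=
        fun f A w hf => by simpa using hf.hasDerivAt
      exact key _ _ _ (hasMFDerivAt_iff_hasFDerivAt.1 (h2.comp t h1))
    refine (convex_Icc (-δ) δ).mul_sub_le_image_sub_of_le_deriv (hcont x hx) ?_ ?_
    · rw [interior_Icc]
      exact fun t ht => (hd' t ht).differentiableAt.differentiableWithinAt
    · rw [interior_Icc]
      intro t ht
      rw [(hd' t ht).deriv]
      exact (hbox.mem x hx t (Ioo_subset_Icc_self ht)).2.2.le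
  have hy0 : h y = 0 := (hh.mem_iff y hyU).1 hyS
  have hN' : {x | |h x| < c * δ / 2} ∈ 𝓝 y := by
    have := (hh.contMDiffAt hyU).continuousAt.abs
    refine this.eventually_lt_const ?_
    simp only [hy0, abs_zero]
    positivity
  set N' := N ∩ interior {x | |h x| < c * δ / 2} with hN'def
  have hN'sub : N' ⊆ N := inter_subset_left
  have hN'o : IsOpen N' := hbox.isOpen.inter isOpen_interior
  have hex : ∀ x ∈ N', ∃ θ, |θ| < δ ∧ h (Φ x θ) = 0 := by
    intro x hx
    have h1 : |h x| < c * δ / 2 := interior_subset (s := {x | |h x| < c * δ / 2}) hx.2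
    obtain ⟨h2, h3⟩ := abs_lt.1 h1
    have h4 := hmono x hx.1 0 h0mem (δ / 2) ⟨by linarith, by linarith⟩ (by linarith)
    have h5 := hmono x hx.1 (-(δ / 2)) ⟨by linarith, by linarith⟩ 0 h0mem (by linarith)
    rw [hbox.zero x hx.1] at h4 h5
    have hsub : Icc (-(δ / 2)) (δ / 2) ⊆ Icc (-δ) δ := Icc_subset_Icc (by linarith) (by linarith)
    obtain ⟨θ, hθ, hθ0⟩ := intermediate_value_Icc (by linarith) ((hcont x hx.1).mono hsub)
      (show (0 : ℝ) ∈ Icc _ _ from ⟨by linarith, by linarith⟩)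
    exact ⟨θ, abs_lt.2 ⟨by linarith [hθ.1], by linarith [hθ.2]⟩, hθ0⟩
  classical
  choose! θ hθ1 hθ2 using hex
  have hyN' : y ∈ N' := ⟨hyN, mem_interior_iff_mem_nhds.2 hN'⟩
  have hmemθ : ∀ x ∈ N', θ x ∈ Icc (-δ) δ := fun x hx => abs_le.1 (hθ1 x hx).le
  have hiff : ∀ x ∈ N', ∀ t ∈ Icc (-δ) δ, (h (Φ x t) = 0 ↔ t = θ x) := by
    intro x hx t ht
    refine ⟨fun h0 => ?_, fun h0 => h0 ▸ hθ2 x hx⟩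
    rcases lt_trichotomy t (θ x) with hlt | heq | hgt
    · have := hmono x hx.1 t ht (θ x) (hmemθ x hx) hlt.le
      have h6 : 0 < c * (θ x - t) := mul_pos hc0 (by linarith)
      rw [hθ2 x hx] at this
      linarith
    · exact heq
    · have := hmono x hx.1 (θ x) (hmemθ x hx) t ht hgt.le
      have h6 : 0 < c * (t - θ x) := mul_pos hc0 (by linarith)
      rw [hθ2 x hx] at this
      linarith
  have hθy : θ y = 0 := by
    have := (hiff y hyN' 0 h0mem).1 (by rw [hbox.zero y hyN, hy0])
    exact this.symm
  have hθlip : ∀ x ∈ N', ∀ z ∈ N', θ x ≤ θ z → θ z - θ x ≤ Kh * K / c * d x z := by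
    intro x hx z hz hle
    have h1 := hmono z hz.1 (θ x) (hmemθ x hx) (θ z) (hmemθ z hz) hle
    rw [hθ2 z hz, zero_sub] at h1
    have h2 := hWlip _ (hbox.mem x hx.1 _ (hmemθ x hx)).2.1 _ (hbox.mem z hz.1 _ (hmemθ x hx)).2.1
    rw [hθ2 x hx, zero_sub] at h2
    have h3 := hbox.lipschitz x hx.1 z hz.1 _ (hmemθ x hx) _ (hmemθ x hx)
    rw [sub_self, abs_zero, add_zero] at h3
    have h4 : c * (θ z - θ x) ≤ Kh * K * d x z := by
      calc c * (θ z - θ x) ≤ - h (Φ z (θ x)) := h1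
        _ ≤ |(-h (Φ z (θ x)))| := le_abs_self _
        _ ≤ Kh * d (Φ x (θ x)) (Φ z (θ x)) := h2
        _ ≤ Kh * (K * d x z) := by gcongr
        _ = _ := by ring
    rw [div_mul_eq_mul_div, le_div_iff₀ hc0]
    linarith
  refine ⟨N', δ, K + Kh * K / c, Φ, hyN', ?_, θ, hθy, fun x hx => ⟨hθ1 x hx, hiff x hx⟩, ?_⟩
  · have hb := hbox.mono hd hN'sub hN'o (show K ≤ K + Kh * K / c from
      le_add_of_nonneg_right (by positivity))
    exact { hb with mem := fun x hx t ht => (hb.mem x hx t ht).1 }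
  · intro x hx z hz
    have hdn := hd.nonneg x z
    have h7 : Kh * K / c * d x z ≤ (K + Kh * K / c) * d x z := by nlinarith
    refine le_trans ?_ h7
    rcases le_total (θ x) (θ z) with hle | hle
    · rw [abs_sub_comm, abs_of_nonneg (by linarith)]
      exact hθlip x hx z hz hle
    · rw [abs_of_nonneg (by linarith), hd.symm]
      exact hθlip z hz x hx hle

end Level

theorem Icc_induction {P : ℝ → Prop} {b : ℝ} (h0 : P 0)
    (hright : ∀ r ∈ Ico 0 b, P r → ∃ e ∈ Ioc r b, ∀ s ∈ Ioc r e, P s)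
    (hleft : ∀ r ∈ Ioc 0 b, (∀ s ∈ Ico 0 r, P s) → P r) : ∀ r ∈ Icc 0 b, P r := by
  intro r₀ hr₀
  have hb : 0 ≤ b := hr₀.1.trans hr₀.2
  set A := {r | r ∈ Icc 0 b ∧ ∀ s ∈ Icc 0 r, P s} with hA
  have hA0 : (0 : ℝ) ∈ A := ⟨⟨le_rfl, hb⟩, fun s hs => by
    rw [le_antisymm hs.2 hs.1]; exact h0⟩
  have hbdd : BddAbove A := ⟨b, fun r hr => hr.1.2⟩
  set R := sSup A with hR
  have hR0 : 0 ≤ R := le_csSup hbdd hA0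
  have hRb : R ≤ b := csSup_le ⟨0, hA0⟩ fun r hr => hr.1.2
  have hlt : ∀ s ∈ Ico 0 R, P s := by
    intro s hs
    obtain ⟨r, hr, hsr⟩ := exists_lt_of_lt_csSup ⟨0, hA0⟩ hs.2
    exact hr.2 s ⟨hs.1, hsr.le⟩
  have hPR : P R := by
    rcases hR0.eq_or_lt with h | h
    · rw [← h]; exact h0
    · exact hleft R ⟨h, hRb⟩ hlt
  have hRA : ∀ s ∈ Icc 0 R, P s := fun s hs => by
    rcases hs.2.eq_or_lt with h | h
    · rw [h]; exact hPR
    · exact hlt s ⟨hs.1, h⟩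
  rcases hRb.eq_or_lt with h | h
  · exact hRA r₀ (h ▸ hr₀)
  · obtain ⟨e, he, hPe⟩ := hright R ⟨hR0, h⟩ hPR
    have heA : e ∈ A := ⟨⟨hR0.trans he.1.le, he.2⟩, fun s hs => by
      rcases le_or_gt s R with h1 | h1
      · exact hRA s ⟨hs.1, h1⟩
      · exact hPe s ⟨h1, hs.2⟩⟩
    exact absurd (le_csSup hbdd heA) (not_le.2 he.1)

section IntegralCurve

variable {E : Type*} [NormedAddCommGroup E] [NormedSpace ℝ E]
  {H : Type*} [TopologicalSpace H] {I : ModelWithCorners ℝ E H}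
  {M : Type*} [TopologicalSpace M] [ChartedSpace H M] {v : ∀ x : M, TangentSpace I x}

theorem hasMFDerivWithinAt_smulRight_congr {c c' : ℝ → M} {s : Set ℝ} {t : ℝ}
    (h : HasMFDerivWithinAt 𝓘(ℝ, ℝ) I c s t ((1 : ℝ →L[ℝ] ℝ).smulRight (v (c t))))
    (hc : c' =ᶠ[𝓝[s] t] c) (ht : c' t = c t) :
    HasMFDerivWithinAt 𝓘(ℝ, ℝ) I c' s t ((1 : ℝ →L[ℝ] ℝ).smulRight (v (c' t))) := by
  have hv : ∀ x y : M, x = y → ((1 : ℝ →L[ℝ] ℝ).smulRight (v x : E)) =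
      ((1 : ℝ →L[ℝ] ℝ).smulRight (v y : E)) := by
    rintro x _ rfl
    rfl
  have h1 := h.congr_of_eventuallyEq hc ht
  exact h1.congr_mfderiv (hv _ _ ht).symm

theorem _root_.IsMIntegralCurveOn.congr {c c' : ℝ → M} {s : Set ℝ}
    (h : IsMIntegralCurveOn c v s) (hc : EqOn c' c s) : IsMIntegralCurveOn c' v s := fun t ht =>
  hasMFDerivWithinAt_smulRight_congr (h t ht) (hc.eventuallyEq_of_mem self_mem_nhdsWithin) (hc ht)

/-- Two integral curves that meet at the time `m` can be glued. -/
theorem _root_.IsMIntegralCurveOn.glue {c₁ c₂ : ℝ → M} {s : Set ℝ} {m : ℝ}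
    (h₁ : IsMIntegralCurveOn c₁ v (s ∩ Iic m)) (h₂ : IsMIntegralCurveOn c₂ v (s ∩ Ici m))
    (h : c₁ m = c₂ m) : IsMIntegralCurveOn (fun t => if t < m then c₁ t else c₂ t) v s := by
  set c : ℝ → M := fun t => if t < m then c₁ t else c₂ t with hc
  have hc₁ : EqOn c c₁ (s ∩ Iic m) := by
    intro t ht
    rcases (show t ≤ m from ht.2).eq_or_lt with h3 | h3
    · simp [hc, h3, h]
    · simp [hc, h3]
  have hc₂ : EqOn c c₂ (s ∩ Ici m) := by
    intro t ht
    simp [hc, not_lt.2 (show m ≤ t from ht.2)]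
  have h₁' := h₁.congr hc₁
  have h₂' := h₂.congr hc₂
  intro t ht
  rcases lt_trichotomy t m with h3 | h3 | h3
  · exact (h₁' t ⟨ht, h3.le⟩).mono_of_mem_nhdsWithin
      (inter_mem_nhdsWithin s (Iic_mem_nhds h3))
  · have h4 := (h₁' t ⟨ht, h3.le⟩).union (h₂' t ⟨ht, h3.ge⟩)
    rwa [← inter_union_distrib_left, Iic_union_Ici, inter_univ] at h4
  · exact (h₂' t ⟨ht, h3.le⟩).mono_of_mem_nhdsWithin
      (inter_mem_nhdsWithin s (Ici_mem_nhds h3))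

variable [CompleteSpace E] [I.Boundaryless] [IsManifold I 1 M] [T2Space M]

/-- Integral curves of a `C^1` vector field are determined by their value at the left end of the
interval. -/
theorem IsMIntegralCurveOn_Icc_eqOn
    (hv : ContMDiff I I.tangent 1 (fun x => (⟨x, v x⟩ : TangentBundle I M))) {c c' : ℝ → M}
    {a b : ℝ} (hab : a < b) (hc : IsMIntegralCurveOn c v (Icc a b))
    (hc' : IsMIntegralCurveOn c' v (Icc a b)) (h : c a = c' a) : EqOn c c' (Icc a b) := by
  obtain ⟨σ, hσ0, hσ⟩ := exists_isMIntegralCurveAt_of_contMDiffAt_boundaryless a (hv (c a))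
  obtain ⟨ε, hε, hσ⟩ := isMIntegralCurveAt_iff'.1 hσ
  have hext : ∀ f : ℝ → M, IsMIntegralCurveOn f v (Icc a b) → f a = c a →
      IsMIntegralCurveOn (fun t => if t < a then σ t else f t) v (Ioo (a - ε) b) := by
    intro f hf hfa
    refine IsMIntegralCurveOn.glue (hσ.mono ?_) (hf.mono ?_) (by rw [hσ0, hfa])
    · rintro t ⟨ht, ht'⟩
      rw [Metric.mem_ball, Real.dist_eq]
      exact abs_lt.2 ⟨by linarith [ht.1], by linarith [show t ≤ a from ht']⟩
    · rintro t ⟨ht, ht'⟩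
      exact ⟨ht', ht.2.le⟩
  have heq := isMIntegralCurveOn_Ioo_eqOn_of_contMDiff_boundaryless (t₀ := a)
    ⟨by linarith, hab⟩ hv (hext c hc rfl) (hext c' hc' h.symm) (by simpa using h)
  have hIco : EqOn c c' (Ico a b) := by
    intro t ht
    have := heq (show t ∈ Ioo (a - ε) b from ⟨by linarith [ht.1], ht.2⟩)
    simpa [not_lt.2 ht.1] using this
  intro t ht
  rcases ht.2.eq_or_lt with h1 | h1
  · subst h1
    have l1 : Tendsto c (𝓝[<] t) (𝓝 (c t)) :=
      (hc.continuousOn t ht).mono_left (by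
        rw [← nhdsWithin_Ico_eq_nhdsLT hab]; exact nhdsWithin_mono _ Ico_subset_Icc_self)
    have l2 : Tendsto c' (𝓝[<] t) (𝓝 (c' t)) :=
      (hc'.continuousOn t ht).mono_left (by
        rw [← nhdsWithin_Ico_eq_nhdsLT hab]; exact nhdsWithin_mono _ Ico_subset_Icc_self)
    refine tendsto_nhds_unique_of_eventuallyEq l1 l2 ?_
    filter_upwards [Ico_mem_nhdsLT hab] with s hs using hIco hs
  · exact hIco ⟨ht.1, h1⟩

end IntegralCurve

section Trajectory

variable {E : Type*} [NormedAddCommGroup E] [NormedSpace ℝ E]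
  {H : Type*} [TopologicalSpace H] {I : ModelWithCorners ℝ E H}
  {M : Type*} [TopologicalSpace M] [ChartedSpace H M] {ι : Type*}

namespace HybridSystem

variable {S : HybridSystem I M ι} {c c' : ℝ → M} {J J' D D' : Set ℝ} {b t : ℝ}

/-- At every impact, the state before the impact lies in one guard only. -/
def HasUniqueImpacts (S : HybridSystem I M ι) (c : ℝ → M) (J : Set ℝ) : Prop :=
  ∀ t ∈ J, ∀ i, ∀ x ∈ S.guard i, Tendsto c (𝓝[<] t) (𝓝 x) → ∀ j, x ∈ S.guard j → j = i

theorem HasUniqueImpacts.mono (h : S.HasUniqueImpacts c J) (hJ : J' ⊆ J) :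
    S.HasUniqueImpacts c J' := fun t ht => h t (hJ ht)

theorem IsTrajectoryOn.mono (h : S.IsTrajectoryOn c J D) (hD : D' ⊆ D) :
    S.IsTrajectoryOn c (J ∩ D') D' where
  impacts_subset := fun t ht => ⟨ht.2, (h.impacts_subset ht.1).2⟩
  impacts_finite := fun b => (h.impacts_finite b).subset
    (inter_subset_inter_left _ inter_subset_left)
  flow := fun a b hab hI hdis => h.flow a b hab (hI.trans hD) (by
    rw [Set.disjoint_left] at hdis ⊢
    exact fun t ht htJ => hdis ht ⟨htJ, hI (Ioc_subset_Icc_self ht)⟩)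
  notMem_guard := fun t ht => h.notMem_guard t (hD ht)
  impact := fun t ht => h.impact t ht.1

theorem IsTrajectoryOn.exists_left (h : S.IsTrajectoryOn c J D) (ht : 0 < t) :
    ∃ a, 0 ≤ a ∧ a < t ∧ Disjoint (Ico a t) J := by
  have hfin : ((J ∩ Iic t) \ {t}).Finite := (h.impacts_finite t).sdiff
  have hmem : ((J ∩ Iic t) \ {t})ᶜ ∈ 𝓝 t := hfin.isClosed.isOpen_compl.mem_nhds (by simp)
  obtain ⟨l, u, hlu, hsub⟩ := mem_nhds_iff_exists_Ioo_subset.1 hmem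
  refine ⟨max 0 ((l + t) / 2), le_max_left _ _, max_lt ht (by linarith [hlu.1]), ?_⟩
  rw [Set.disjoint_left]
  intro s hs hsJ
  have h1 : (l + t) / 2 ≤ s := (le_max_right _ _).trans hs.1
  exact hsub ⟨by linarith [hlu.1], hs.2.trans hlu.2⟩ ⟨⟨hsJ, hs.2.le⟩, hs.2.ne⟩

theorem IsTrajectoryOn.exists_right (h : S.IsTrajectoryOn c J D) (htb : t < b) :
    ∃ e, t < e ∧ e ≤ b ∧ Disjoint (Ioc t e) J := by
  have hfin : ((J ∩ Iic b) \ {t}).Finite := (h.impacts_finite b).sdiff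
  have hmem : ((J ∩ Iic b) \ {t})ᶜ ∈ 𝓝 t := hfin.isClosed.isOpen_compl.mem_nhds (by simp)
  obtain ⟨l, u, hlu, hsub⟩ := mem_nhds_iff_exists_Ioo_subset.1 hmem
  refine ⟨min b ((u + t) / 2), lt_min htb (by linarith [hlu.2]), min_le_left _ _, ?_⟩
  rw [Set.disjoint_left]
  intro s hs hsJ
  have h1 : s ≤ (u + t) / 2 := hs.2.trans (min_le_right _ _)
  exact hsub ⟨hlu.1.trans hs.1, by linarith [hlu.2]⟩
    ⟨⟨hsJ, hs.2.trans (min_le_left _ _)⟩, hs.1.ne'⟩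

theorem IsTrajectoryOn.exists_flow_left (h : S.IsTrajectoryOn c J D) (ht : 0 < t)
    (hD : Icc 0 t ⊆ D) (htJ : t ∉ J) :
    ∃ a, 0 ≤ a ∧ a < t ∧ IsMIntegralCurveOn c S.field (Icc a t) := by
  obtain ⟨a, ha0, hat, hdis⟩ := h.exists_left ht
  refine ⟨a, ha0, hat, h.flow a t hat ((Icc_subset_Icc_left ha0).trans hD) ?_⟩
  rw [Set.disjoint_left] at hdis ⊢
  intro s hs hsJ
  rcases hs.2.eq_or_lt with h1 | h1
  · exact htJ (h1 ▸ hsJ)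
  · exact hdis ⟨hs.1.le, h1⟩ hsJ

theorem _root_.IsMIntegralCurveOn.tendsto_left {v : ∀ x : M, TangentSpace I x} {a : ℝ}
    (hc : IsMIntegralCurveOn c v (Icc a t)) (hat : a < t) : Tendsto c (𝓝[<] t) (𝓝 (c t)) :=
  (hc.continuousOn t ⟨hat.le, le_rfl⟩).mono_left (by
    rw [← nhdsWithin_Ico_eq_nhdsLT hat]; exact nhdsWithin_mono _ Ico_subset_Icc_self)

theorem IsTrajectoryOn.tendsto_left (h : S.IsTrajectoryOn c J D) (ht : 0 < t)
    (hD : Icc 0 t ⊆ D) (htJ : t ∉ J) : Tendsto c (𝓝[<] t) (𝓝 (c t)) := by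
  obtain ⟨a, -, hat, hflow⟩ := h.exists_flow_left ht hD htJ
  exact hflow.tendsto_left hat

theorem IsTrajectoryOn.mem_impacts_iff [T2Space M] (h : S.IsTrajectoryOn c J D) (ht : 0 < t)
    (hD : Icc 0 t ⊆ D) : t ∈ J ↔ ¬ Tendsto c (𝓝[<] t) (𝓝 (c t)) := by
  refine ⟨fun htJ hl => ?_, fun hl => by_contra fun htJ => hl (h.tendsto_left ht hD htJ)⟩
  obtain ⟨i, x, hx, hlx, -⟩ := h.impact t htJ
  have := tendsto_nhds_unique hl hlx
  exact h.notMem_guard t (hD ⟨ht.le, le_rfl⟩) i (this ▸ hx)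

theorem IsTrajectoryOn.shift (h : S.IsTrajectoryOn c J (Ici 0)) {s : ℝ} (hs : 0 ≤ s) :
    S.IsTrajectoryOn (fun t => c (t + s)) {t | 0 < t ∧ t + s ∈ J} (Ici 0) where
  impacts_subset := fun t ht => ⟨ht.1.le, ht.1⟩
  impacts_finite := fun b => by
    refine ((h.impacts_finite (b + s)).preimage (f := fun t => t + s)
      (fun x _ y _ hxy => by simpa using hxy)).subset ?_
    rintro t ⟨ht, htb⟩
    exact ⟨ht.2, by simpa using htb⟩
  flow := fun a b hab hI hdis => by
    have ha : 0 ≤ a := hI ⟨le_rfl, hab.le⟩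
    have h1 := h.flow (a + s) (b + s) (by linarith)
      (fun t ht => by have := ht.1; exact mem_Ici.2 (by linarith)) (by
        rw [Set.disjoint_left] at hdis ⊢
        intro t ht htJ
        refine hdis (a := t - s) ⟨by linarith [ht.1], by linarith [ht.2]⟩
          ⟨by linarith [ht.1], by simpa using htJ⟩)
    refine (h1.comp_add s).mono fun t ht => ?_
    exact ⟨by linarith [ht.1], by linarith [ht.2]⟩
  notMem_guard := fun t ht => h.notMem_guard _ (add_nonneg ht hs)
  impact := fun t ht => by
    obtain ⟨i, x, hx, hl, hr⟩ := h.impact _ ht.2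
    refine ⟨i, x, hx, hl.comp ?_, hr⟩
    refine tendsto_nhdsWithin_of_tendsto_nhds_of_eventually_within _
      (((continuous_add_const s).tendsto t).mono_left nhdsWithin_le_nhds) ?_
    filter_upwards [self_mem_nhdsWithin] with r hr
    exact add_lt_add_left hr s

/-- Concatenation of trajectories. -/
theorem IsTrajectoryOn.concat {c₁ c₂ : ℝ → M} {J₁ J₂ : Set ℝ} {t₁ t₂ : ℝ} (ht₁ : 0 ≤ t₁)
    (ht₂ : 0 ≤ t₂) (h₁ : S.IsTrajectoryOn c₁ J₁ (Icc 0 t₁)) (h₂ : S.IsTrajectoryOn c₂ J₂ (Icc 0 t₂))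
    (hu₁ : S.HasUniqueImpacts c₁ J₁) (hu₂ : S.HasUniqueImpacts c₂ J₂) (h : c₁ t₁ = c₂ 0) :
    ∃ c J, S.IsTrajectoryOn c J (Icc 0 (t₁ + t₂)) ∧ S.HasUniqueImpacts c J ∧
      (∀ t, t ≤ t₁ → c t = c₁ t) ∧ ∀ t, t₁ ≤ t → c t = c₂ (t - t₁) := by
  set c : ℝ → M := fun t => if t < t₁ then c₁ t else c₂ (t - t₁) with hc
  have hc₁ : ∀ t, t ≤ t₁ → c t = c₁ t := by
    intro t ht
    rcases ht.eq_or_lt with h3 | h3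
    · simp [hc, h3, h]
    · simp [hc, h3]
  have hc₂ : ∀ t, t₁ ≤ t → c t = c₂ (t - t₁) := fun t ht => by simp [hc, not_lt.2 ht]
  have hlim₁ : ∀ t ≤ t₁, c =ᶠ[𝓝[<] t] c₁ := fun t ht => by
    filter_upwards [self_mem_nhdsWithin] with r hr
    exact hc₁ r ((show r < t from hr).le.trans ht)
  have hlim₂ : ∀ t, t₁ < t → c =ᶠ[𝓝[<] t] fun r => c₂ (r - t₁) := fun t ht => by
    filter_upwards [Ioo_mem_nhdsLT ht] with r hr
    exact hc₂ r hr.1.le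
  have hsub : ∀ t, Tendsto (fun r : ℝ => r - t₁) (𝓝[<] t) (𝓝[<] (t - t₁)) := fun t => by
    refine tendsto_nhdsWithin_of_tendsto_nhds_of_eventually_within _
      (((continuous_id.sub continuous_const).tendsto t).mono_left nhdsWithin_le_nhds) ?_
    filter_upwards [self_mem_nhdsWithin] with r hr
    exact sub_lt_sub_right hr t₁
  have hadd : ∀ t, Tendsto (fun r : ℝ => r + t₁) (𝓝[<] t) (𝓝[<] (t + t₁)) := fun t => by
    refine tendsto_nhdsWithin_of_tendsto_nhds_of_eventually_within _
      (((continuous_add_const t₁).tendsto t).mono_left nhdsWithin_le_nhds) ?_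
    filter_upwards [self_mem_nhdsWithin] with r hr
    exact add_lt_add_left hr t₁
  refine ⟨c, J₁ ∪ {t | t - t₁ ∈ J₂}, ⟨?_, ?_, ?_, ?_, ?_⟩, ?_, hc₁, hc₂⟩
  · rintro t (ht | ht)
    · obtain ⟨h3, h4⟩ := h₁.impacts_subset ht
      exact ⟨⟨h3.1, h3.2.trans (by linarith)⟩, h4⟩
    · obtain ⟨h3, h4⟩ := h₂.impacts_subset ht
      have h4' : 0 < t - t₁ := h4
      exact ⟨⟨by linarith, by linarith [h3.2]⟩, mem_Ioi.2 (by linarith)⟩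
  · intro b
    rw [union_inter_distrib_right]
    refine (h₁.impacts_finite b).union (((h₂.impacts_finite (b - t₁)).preimage
      (f := fun t => t - t₁) (fun x _ y _ hxy => by simpa using hxy)).subset ?_)
    rintro t ⟨ht, htb⟩
    exact ⟨ht, by simpa using htb⟩
  · intro a b hab hI hdis
    have ha : 0 ≤ a := (hI ⟨le_rfl, hab.le⟩).1
    have hb : b ≤ t₁ + t₂ := (hI ⟨hab.le, le_rfl⟩).2
    have hleft : ∀ b' ≤ b, b' ≤ t₁ → a < b' → IsMIntegralCurveOn c₁ S.field (Icc a b') := by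
      intro b' hb' hb't hab'
      refine h₁.flow a b' hab' (fun t ht => ⟨ha.trans ht.1, ht.2.trans hb't⟩) ?_
      exact (hdis.mono_left (Ioc_subset_Ioc_right hb')).mono_right subset_union_left
    have hright : ∀ a' ≥ a, t₁ ≤ a' → a' < b →
        IsMIntegralCurveOn (fun t => c₂ (t - t₁)) S.field (Icc a' b) := by
      intro a' ha' ha't hab'
      have h3 := h₂.flow (a' - t₁) (b - t₁) (by linarith)
        (fun t ht => ⟨by linarith [ht.1], by linarith [ht.2]⟩) (by
          rw [Set.disjoint_left] at hdis ⊢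
          intro t ht htJ
          refine hdis (a := t + t₁) ⟨by linarith [ht.1], by linarith [ht.2]⟩ (Or.inr ?_)
          simpa using htJ)
      refine (isMIntegralCurveOn_comp_sub.2 h3).mono fun t ht => ?_
      exact ⟨by linarith [ht.1], by linarith [ht.2]⟩
    rcases le_or_gt b t₁ with h3 | h3
    · exact (hleft b le_rfl h3 hab).congr fun t ht => hc₁ t (ht.2.trans h3)
    · rcases le_or_gt t₁ a with h4 | h4
      · exact (hright a le_rfl h4 hab).congr fun t ht => hc₂ t (h4.trans ht.1)
      · refine IsMIntegralCurveOn.glue ((hleft t₁ h3.le le_rfl h4).mono ?_)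
          ((hright t₁ h4.le le_rfl h3).mono ?_) (by simpa using h)
        · exact fun t ht => ⟨ht.1.1, ht.2⟩
        · exact fun t ht => ⟨ht.2, ht.1.2⟩
  · intro t ht i
    rcases le_or_gt t t₁ with h3 | h3
    · rw [hc₁ t h3]
      exact h₁.notMem_guard t ⟨ht.1, h3⟩ i
    · rw [hc₂ t h3.le]
      exact h₂.notMem_guard _ ⟨by linarith, by linarith [ht.2]⟩ i
  · rintro t (ht | ht)
    · have h3 := (h₁.impacts_subset ht).1.2
      obtain ⟨i, x, hx, hl, hr⟩ := h₁.impact t ht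
      exact ⟨i, x, hx, hl.congr' (hlim₁ t h3).symm, (hc₁ t h3).trans hr⟩
    · have h3 : t₁ < t := by
        have : 0 < t - t₁ := (h₂.impacts_subset ht).2
        linarith
      obtain ⟨i, x, hx, hl, hr⟩ := h₂.impact _ ht
      exact ⟨i, x, hx, (hl.comp (hsub t)).congr' (hlim₂ t h3).symm, (hc₂ t h3.le).trans hr⟩
  · rintro t (ht | ht) i x hx hl
    · have h3 := (h₁.impacts_subset ht).1.2
      exact hu₁ t ht i x hx (hl.congr' (hlim₁ t h3))
    · have h3 : t₁ < t := by
        have : 0 < t - t₁ := (h₂.impacts_subset ht).2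
        linarith
      refine hu₂ _ ht i x hx ?_
      have h4 := (hl.congr' (hlim₂ t h3))
      have h5 := hadd (t - t₁)
      rw [sub_add_cancel] at h5
      refine (h4.comp h5).congr fun r => ?_
      simp

variable [CompleteSpace E] [I.Boundaryless] [IsManifold I 1 M] [T2Space M]

/-- A trajectory with unique impacts is determined by its initial value. -/
theorem IsTrajectoryOn.eqOn
    (hv : ContMDiff I I.tangent 1 (fun x => (⟨x, S.field x⟩ : TangentBundle I M)))
    (h : S.IsTrajectoryOn c J D) (hu : S.HasUniqueImpacts c J) (h' : S.IsTrajectoryOn c' J' D')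
    (hD : Icc 0 b ⊆ D) (hD' : Icc 0 b ⊆ D') (h0 : c 0 = c' 0) : EqOn c c' (Icc 0 b) := by
  intro r hr
  refine Icc_induction (P := fun r => c r = c' r) h0 ?_ ?_ r hr
  · intro r hr hrr
    obtain ⟨e, hre, heb, hdis⟩ := h.exists_right hr.2
    obtain ⟨e', hre', heb', hdis'⟩ := h'.exists_right hr.2
    set m := min e e'
    have hrm : r < m := lt_min hre hre'
    have hsub : Icc r m ⊆ Icc 0 b := Icc_subset_Icc hr.1 ((min_le_left _ _).trans heb)
    have h1 := h.flow r m hrm (hsub.trans hD)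
      (hdis.mono_left (Ioc_subset_Ioc_right (min_le_left _ _)))
    have h2 := h'.flow r m hrm (hsub.trans hD')
      (hdis'.mono_left (Ioc_subset_Ioc_right (min_le_right _ _)))
    exact ⟨m, ⟨hrm, (min_le_left _ _).trans heb⟩, fun s hs =>
      IsMIntegralCurveOn_Icc_eqOn hv hrm h1 h2 hrr (Ioc_subset_Icc_self hs)⟩
  · intro r hr hlt
    have hsub : Icc 0 r ⊆ Icc 0 b := Icc_subset_Icc_right hr.2
    have hev : c =ᶠ[𝓝[<] r] c' := by
      filter_upwards [Ico_mem_nhdsLT hr.1] with s hs using hlt s hs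
    by_cases hJ : r ∈ J
    · obtain ⟨i, x, hx, hl, hri⟩ := h.impact r hJ
      by_cases hJ' : r ∈ J'
      · obtain ⟨j, x', hx', hl', hrj⟩ := h'.impact r hJ'
        have hxx : x = x' := tendsto_nhds_unique (hl.congr' hev) hl'
        subst hxx
        have hij : j = i := hu r hJ i x hx hl j hx'
        rw [hri, hrj, hij]
      · have := tendsto_nhds_unique (hl.congr' hev)
          (h'.tendsto_left hr.1 (hsub.trans hD') hJ')
        exact absurd (this ▸ hx) (h'.notMem_guard r (hD' ⟨hr.1.le, hr.2⟩) i)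
    · have hl := h.tendsto_left hr.1 (hsub.trans hD) hJ
      by_cases hJ' : r ∈ J'
      · obtain ⟨j, x', hx', hl', hrj⟩ := h'.impact r hJ'
        have := tendsto_nhds_unique (hl.congr' hev) hl'
        exact absurd (this ▸ hx') (h.notMem_guard r (hD ⟨hr.1.le, hr.2⟩) j)
      · exact tendsto_nhds_unique (hl.congr' hev)
          (h'.tendsto_left hr.1 (hsub.trans hD') hJ')

/-- If trajectories with unique impacts start at `x` for arbitrarily long times, then there is one
for all times. -/
theorem exists_isTrajectoryOn_Ici
    (hv : ContMDiff I I.tangent 1 (fun x => (⟨x, S.field x⟩ : TangentBundle I M))) {x : M}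
    (h : ∀ b : ℝ, 0 ≤ b → ∃ c J, S.IsTrajectoryOn c J (Icc 0 b) ∧ S.HasUniqueImpacts c J ∧
      c 0 = x) : ∃ c J, S.IsTrajectoryOn c J (Ici 0) ∧ c 0 = x := by
  have : Nonempty M := ⟨x⟩
  choose! C K hC hK hC0 using h
  have heq : ∀ b b', 0 ≤ b → b ≤ b' → EqOn (C b) (C b') (Icc 0 b) := fun b b' hb hbb' =>
    (hC b hb).eqOn hv (hK b hb) (hC b' (hb.trans hbb')) Subset.rfl (Icc_subset_Icc_right hbb')
      (by rw [hC0 b hb, hC0 b' (hb.trans hbb')])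
  set c : ℝ → M := fun t => C t t with hc
  have hcC : ∀ b, 0 ≤ b → EqOn c (C b) (Icc 0 b) := fun b hb t ht =>
    heq t b ht.1 ht.2 ⟨ht.1, le_rfl⟩
  set J : Set ℝ := {t | 0 < t ∧ ¬ Tendsto c (𝓝[<] t) (𝓝 (c t))} with hJ
  have hev : ∀ b t, 0 ≤ b → 0 < t → t ≤ b → c =ᶠ[𝓝[<] t] C b := fun b t hb ht htb => by
    filter_upwards [Ico_mem_nhdsLT ht] with s hs
    exact hcC b hb ⟨hs.1, hs.2.le.trans htb⟩
  have hJK : ∀ b t, 0 ≤ b → t ≤ b → t ∈ J → t ∈ K b := fun b t hb htb ht => by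
    rw [(hC b hb).mem_impacts_iff ht.1 (Icc_subset_Icc_right htb)]
    intro hl
    exact ht.2 (by
      rw [hcC b hb ⟨ht.1.le, htb⟩]
      exact hl.congr' (hev b t hb ht.1 htb).symm)
  have hKJ : ∀ b t, 0 ≤ b → t ∈ K b → t ∈ J := fun b t hb ht => by
    obtain ⟨h1, h2⟩ := (hC b hb).impacts_subset ht
    have h2' : 0 < t := h2
    refine ⟨h2, fun hl => ?_⟩
    rw [(hC b hb).mem_impacts_iff h2 (Icc_subset_Icc_right h1.2)] at ht
    refine ht ?_
    rw [← hcC b hb h1]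
    exact hl.congr' (hev b t hb h2 h1.2)
  refine ⟨c, J, ⟨fun t ht => ⟨ht.1.le, ht.1⟩, fun b => ?_, ?_, ?_, ?_⟩, hC0 0 le_rfl⟩
  · refine ((hC (max b 0) (le_max_right _ _)).impacts_finite b).subset ?_
    rintro t ⟨ht, htb⟩
    exact ⟨hJK _ t (le_max_right _ _) ((show t ≤ b from htb).trans (le_max_left _ _)) ht, htb⟩
  · intro a b hab hI hdis
    have ha : 0 ≤ a := hI ⟨le_rfl, hab.le⟩
    have hb : 0 ≤ b := ha.trans hab.le
    refine ((hC b hb).flow a b hab (Icc_subset_Icc_left ha) ?_).congr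
      ((hcC b hb).mono (Icc_subset_Icc_left ha))
    exact hdis.mono_right fun t ht => hKJ b t hb ht
  · intro t ht i
    exact (hC t ht).notMem_guard t ⟨ht, le_rfl⟩ i
  · intro t ht
    have ht0 : (0 : ℝ) ≤ t := ht.1.le
    obtain ⟨i, y, hy, hl, hr⟩ := (hC t ht0).impact t (hJK t t ht0 le_rfl ht)
    exact ⟨i, y, hy, hl.congr' (hev t t ht0 ht.1 le_rfl).symm, hr⟩

end HybridSystem

end Trajectory

section Transition

theorem le_orbitDist {M : Type*} {d : M → M → ℝ} {γ : ℝ → M} {x : M} {a : ℝ}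
    (h : ∀ z ∈ γ '' Ici 0, a ≤ d x z) : a ≤ orbitDist d γ x :=
  le_ciInf fun t => h _ ⟨t, t.2, rfl⟩

/-- `Φ x t` lies on the level `h = 0` exactly at the time `t = θ x`, for `x ∈ N` and `|t| ≤ δ`. -/
structure IsCrossingTime {M : Type*} (d : M → M → ℝ) (h : M → ℝ) (N : Set M) (δ K : ℝ)
    (Φ : M → ℝ → M) (θ : M → ℝ) : Prop where
  abs_lt : ∀ x ∈ N, |θ x| < δ
  zero_iff : ∀ x ∈ N, ∀ t ∈ Icc (-δ) δ, (h (Φ x t) = 0 ↔ t = θ x)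
  lipschitz : ∀ x ∈ N, ∀ z ∈ N, |θ x - θ z| ≤ K * d x z

theorem IsCrossingTime.mem_Ioo {M : Type*} {d : M → M → ℝ} {h : M → ℝ} {N : Set M} {δ K : ℝ}
    {Φ : M → ℝ → M} {θ : M → ℝ} (hθ : IsCrossingTime d h N δ K Φ θ) {x : M} (hx : x ∈ N) :
    θ x ∈ Ioo (-δ) δ :=
  _root_.abs_lt.1 (hθ.abs_lt x hx)

variable {E : Type*} [NormedAddCommGroup E] [NormedSpace ℝ E]
  {H : Type*} [TopologicalSpace H] {I : ModelWithCorners ℝ E H}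
  {M : Type*} [TopologicalSpace M] [ChartedSpace H M] {ι : Type*}

section OrbitDist

variable {d : M → M → ℝ} {γ : ℝ → M}

theorem orbitDist_le (hd : IsChartCompatibleDist I d) {z : M} (hz : z ∈ γ '' Ici 0) (x : M) :
    orbitDist d γ x ≤ d x z := by
  obtain ⟨t, ht, rfl⟩ := hz
  exact ciInf_le ⟨0, by rintro _ ⟨t, rfl⟩; exact hd.nonneg _ _⟩ (⟨t, ht⟩ : Ici (0 : ℝ))

end OrbitDist

theorem IsFlowBox.continuousAt {d : M → M → ℝ} (hd : IsChartCompatibleDist I d)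
    {v : ∀ x : M, TangentSpace I x} {U N : Set M} {δ K : ℝ} {Φ : M → ℝ → M}
    (h : IsFlowBox d v U N δ K Φ) {x : M} (hx : x ∈ N) {t : ℝ} (ht : t ∈ Ioo (-δ) δ) :
    ContinuousAt (fun p : M × ℝ => Φ p.1 p.2) (x, t) := by
  rw [ContinuousAt, hd.tendsto_nhds_iff]
  have h1 : Tendsto (fun p : M × ℝ => K * (d x p.1 + |t - p.2|)) (𝓝 (x, t)) (𝓝 0) := by
    have h2 : Tendsto (fun p : M × ℝ => d x p.1) (𝓝 (x, t)) (𝓝 0) :=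
      (hd.tendsto_self x).comp (continuous_fst.tendsto (x, t))
    have h3 : Tendsto (fun p : M × ℝ => |t - p.2|) (𝓝 (x, t)) (𝓝 |t - t|) :=
      ((continuous_const.sub continuous_snd).abs.tendsto (x, t))
    have h4 := (h2.add h3).const_mul K
    simpa using h4
  refine squeeze_zero' (Eventually.of_forall fun p => hd.nonneg _ _) ?_ h1
  filter_upwards [prod_mem_nhds (h.isOpen.mem_nhds hx) (Icc_mem_nhds ht.1 ht.2)] with p hp
  exact h.lipschitz x hx p.1 hp.1 t (Ioo_subset_Icc_self ht) p.2 hp.2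

section Crossing

variable {d : M → M → ℝ} {v : ∀ x : M, TangentSpace I x} {h : M → ℝ} {U N : Set M} {δ K : ℝ}
  {Φ : M → ℝ → M} {θ : M → ℝ}

theorem IsCrossingTime.continuousAt (hd : IsChartCompatibleDist I d)
    (hθ : IsCrossingTime d h N δ K Φ θ) (hN : IsOpen N) {x : M} (hx : x ∈ N) :
    ContinuousAt θ x := by
  rw [ContinuousAt, tendsto_iff_norm_sub_tendsto_zero]
  have h1 := (hd.tendsto_self x).const_mul K
  rw [mul_zero] at h1
  refine squeeze_zero' (Eventually.of_forall fun _ => norm_nonneg _) ?_ h1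
  filter_upwards [hN.mem_nhds hx] with z hz
  rw [Real.norm_eq_abs, abs_sub_comm]
  exact hθ.lipschitz x hx z hz

theorem IsCrossingTime.dist_le (hbox : IsFlowBox d v U N δ K Φ)
    (hθ : IsCrossingTime d h N δ K Φ θ) {x z : M} (hx : x ∈ N) (hz : z ∈ N) :
    d (Φ x (θ x)) (Φ z (θ z)) ≤ K * (1 + K) * d x z := by
  have h1 := hbox.lipschitz x hx z hz _ (Ioo_subset_Icc_self (hθ.mem_Ioo hx)) _
    (Ioo_subset_Icc_self (hθ.mem_Ioo hz))
  calc _ ≤ _ := h1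
    _ ≤ K * (d x z + K * d x z) := by
      have := hθ.lipschitz x hx z hz
      have := hbox.nonneg
      gcongr
    _ = _ := by ring

/-- Along the flow up to the crossing time, the distance to the orbit is controlled by the initial
distance to a point whose trajectory up to the crossing time lies on the orbit. -/
theorem IsCrossingTime.orbitDist_le (hd : IsChartCompatibleDist I d)
    (hbox : IsFlowBox d v U N δ K Φ) (hθ : IsCrossingTime d h N δ K Φ θ) {γ : ℝ → M} {x z : M}
    (hx : x ∈ N) (hz : z ∈ N) (hz0 : 0 < θ z) (hzγ : ∀ r ∈ Ico 0 (θ z), Φ z r ∈ γ '' Ici 0) {r : ℝ}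
    (hr : r ∈ Icc 0 (θ x)) : orbitDist d γ (Φ x r) ≤ K * (1 + K) * d x z := by
  have hK := hbox.nonneg
  have hdn := hd.nonneg x z
  have hδ := hbox.pos
  have hxθ := hθ.mem_Ioo hx
  have hzθ := hθ.mem_Ioo hz
  have hr' : r ∈ Icc (-δ) δ := ⟨by linarith [hr.1], by linarith [hr.2, hxθ.2]⟩
  have key : ∀ r' ∈ Ico 0 (θ z), orbitDist d γ (Φ x r) ≤ K * (d x z + |r - r'|) := fun r' h' =>
    (HybridMech.orbitDist_le hd (hzγ r' h') _).trans
      (hbox.lipschitz x hx z hz r hr' r' ⟨by linarith [h'.1], by linarith [h'.2, hzθ.2]⟩)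
  rcases lt_or_ge r (θ z) with hlt | hge
  · have h1 := key r ⟨hr.1, hlt⟩
    rw [sub_self, abs_zero, add_zero] at h1
    nlinarith [mul_nonneg (mul_nonneg hK hK) hdn]
  · refine le_of_forall_pos_le_add fun ε hε => ?_
    set η := ε / (K + 1) with hη
    have hη0 : 0 < η := by positivity
    have hKη : K * η ≤ ε := by
      rw [hη, mul_div_assoc', div_le_iff₀ (by positivity)]
      nlinarith
    have h2 := key (max 0 (θ z - η)) ⟨le_max_left _ _, max_lt hz0 (by linarith)⟩
    have h3 : |r - max 0 (θ z - η)| ≤ K * d x z + η := by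
      have h4 := hθ.lipschitz x hx z hz
      have h5 : θ x - θ z ≤ K * d x z := (le_abs_self _).trans h4
      rw [abs_of_nonneg (by linarith [max_lt hz0 (show θ z - η < θ z by linarith)])]
      linarith [le_max_right 0 (θ z - η), hr.2]
    calc _ ≤ _ := h2
      _ ≤ K * (d x z + (K * d x z + η)) := by gcongr
      _ = K * (1 + K) * d x z + K * η := by ring
      _ ≤ _ := by linarith

end Crossing

namespace HybridSystem

variable {S : HybridSystem I M ι} {γ : ℝ → M} {J : Set ℝ} {d : M → M → ℝ}

/-- From every point of `N₁` a trajectory with unique impacts leads to `N₂` in a time at most `θ`.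
Its distance to the orbit of `γ`, and the distance of its end point to the points of the orbit in
`N₂`, are controlled by the distance of its initial point to the points of the orbit in `N₁`. -/
def Transits (S : HybridSystem I M ι) (d : M → M → ℝ) (γ : ℝ → M) (θ K : ℝ) (N₁ N₂ : Set M) :
    Prop :=
  ∀ x ∈ N₁, ∃ c J t, 0 < t ∧ t ≤ θ ∧ S.IsTrajectoryOn c J (Icc 0 t) ∧ S.HasUniqueImpacts c J ∧
    c 0 = x ∧ c t ∈ N₂ ∧ ∀ z ∈ N₁ ∩ γ '' Ici 0, (∃ z₂ ∈ N₂ ∩ γ '' Ici 0, d (c t) z₂ ≤ K * d x z) ∧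
      ∀ r ∈ Icc 0 t, orbitDist d γ (c r) ≤ K * d x z

theorem Transits.mono {θ θ' K K' : ℝ} {N₁ N₁' N₂ : Set M} (h : S.Transits d γ θ K N₁ N₂)
    (hd : IsChartCompatibleDist I d) (hθ : θ ≤ θ') (hK : K ≤ K') (hN : N₁' ⊆ N₁) :
    S.Transits d γ θ' K' N₁' N₂ := by
  intro x hx
  obtain ⟨c, J, t, h1, h2, h3, h4, h5, h6, h7⟩ := h x (hN hx)
  refine ⟨c, J, t, h1, h2.trans hθ, h3, h4, h5, h6, fun z hz => ?_⟩
  obtain ⟨⟨z₂, h8, h9⟩, h10⟩ := h7 z ⟨hN hz.1, hz.2⟩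
  have h11 : K * d x z ≤ K' * d x z := mul_le_mul_of_nonneg_right hK (hd.nonneg _ _)
  exact ⟨⟨z₂, h8, h9.trans h11⟩, fun r hr => (h10 r hr).trans h11⟩

theorem Transits.trans {θ θ' K K' : ℝ} {N₁ N₂ N₃ : Set M} (h : S.Transits d γ θ K N₁ N₂)
    (h' : S.Transits d γ θ' K' N₂ N₃) (hd : IsChartCompatibleDist I d) (hK : 0 ≤ K) (hK' : 0 ≤ K') :
    S.Transits d γ (θ + θ') (K + K' * K) N₁ N₃ := by
  intro x hx
  obtain ⟨c, J, t, h1, h2, h3, h4, h5, h6, h7⟩ := h x hx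
  obtain ⟨c', J', t', h1', h2', h3', h4', h5', h6', h7'⟩ := h' _ h6
  obtain ⟨e, Je, he1, he2, he3, he4⟩ := h3.concat h1.le h1'.le h3' h4 h4' h5'.symm
  refine ⟨e, Je, t + t', by linarith, by linarith, he1, he2, by rw [he3 0 h1.le, h5], ?_, ?_⟩
  · rw [he4 _ (by linarith), add_sub_cancel_left]
    exact h6'
  · intro z hz
    obtain ⟨⟨z₂, h8, h9⟩, h10⟩ := h7 z hz
    obtain ⟨⟨z₃, h8', h9'⟩, h10'⟩ := h7' z₂ h8
    have hdn := hd.nonneg x z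
    have h11 : K' * d (c t) z₂ ≤ (K + K' * K) * d x z := by
      have := mul_le_mul_of_nonneg_left h9 hK'
      nlinarith [mul_nonneg hK hdn]
    have h12 : K * d x z ≤ (K + K' * K) * d x z := by
      nlinarith [mul_nonneg (mul_nonneg hK' hK) hdn]
    refine ⟨⟨z₃, h8', ?_⟩, fun r hr => ?_⟩
    · rw [he4 _ (by linarith), add_sub_cancel_left]
      exact h9'.trans h11
    · rcases le_total r t with hrt | hrt
      · rw [he3 r hrt]
        exact (h10 r ⟨hr.1, hrt⟩).trans h12
      · rw [he4 r hrt]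
        exact (h10' _ ⟨by linarith, by linarith [hr.2]⟩).trans h11

theorem IsFlowBox.isTrajectoryOn {U N : Set M} {δ K : ℝ} {Φ : M → ℝ → M}
    (hbox : IsFlowBox d S.field U N δ K Φ) {x : M} (hx : x ∈ N) {t : ℝ} (htδ : t ≤ δ)
    (hG : ∀ r ∈ Icc 0 t, ∀ i, Φ x r ∉ S.guard i) : S.IsTrajectoryOn (Φ x) ∅ (Icc 0 t) where
  impacts_subset := empty_subset _
  impacts_finite := fun b => by simp
  flow := fun a b hab hI _ => (hbox.integral x hx).mono fun r hr => by
    have h1 := hI ⟨le_rfl, hab.le⟩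
    have h2 := hI ⟨hab.le, le_rfl⟩
    exact ⟨by linarith [hbox.pos, hr.1, h1.1], by linarith [hr.2, h2.2]⟩
  notMem_guard := hG
  impact := fun t ht => absurd ht (notMem_empty t)

theorem hasUniqueImpacts_empty (c : ℝ → M) : S.HasUniqueImpacts c ∅ :=
  fun t ht => absurd ht (notMem_empty t)

theorem isOpen_compl_closure_guards [Finite ι] (S : HybridSystem I M ι) :
    IsOpen {x | ∀ i, x ∉ closure (S.guard i)} := by
  have : {x | ∀ i, x ∉ closure (S.guard i)} = ⋂ i, (closure (S.guard i))ᶜ := by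
    ext x
    simp
  rw [this]
  exact isOpen_iInter_of_finite fun i => isClosed_closure.isOpen_compl

variable [CompleteSpace E] [I.Boundaryless] [IsManifold I 1 M] [T2Space M]

theorem IsTrajectoryOn.mem_orbit
    (hv : ContMDiff I I.tangent 1 (fun x => (⟨x, S.field x⟩ : TangentBundle I M)))
    {c : ℝ → M} {J' : Set ℝ} {t : ℝ} (h : S.IsTrajectoryOn c J' (Icc 0 t))
    (hγ : S.IsTrajectoryOn γ J (Ici 0)) (hu : S.HasUniqueImpacts c J')
    (h0 : c 0 ∈ γ '' Ici 0) : ∀ r ∈ Icc 0 t, c r ∈ γ '' Ici 0 := by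
  obtain ⟨s, hs, hs0⟩ := h0
  intro r hr
  have h1 := h.eqOn hv hu (hγ.shift (s := s) hs) Subset.rfl (fun r hr => hr.1)
    (by simp [hs0]) hr
  exact ⟨r + s, add_nonneg hr.1 hs, h1.symm⟩

theorem IsFlowBox.eq_of_isMIntegralCurveOn
    (hv : ContMDiff I I.tangent 1 (fun x => (⟨x, S.field x⟩ : TangentBundle I M)))
    {U N : Set M} {δ K : ℝ} {Φ : M → ℝ → M} (hbox : IsFlowBox d S.field U N δ K Φ) {s q : ℝ}
    (hsq : s < q) (hq : q - s ≤ δ) (hγ : IsMIntegralCurveOn γ S.field (Icc s q)) (hs : γ s ∈ N) :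
    ∀ r ∈ Icc 0 (q - s), Φ (γ s) r = γ (r + s) := by
  refine IsMIntegralCurveOn_Icc_eqOn hv (by linarith) ((hbox.integral _ hs).mono ?_)
    ((hγ.comp_add s).mono ?_) (by simp [hbox.zero _ hs])
  · exact Icc_subset_Icc (by linarith [hbox.pos]) hq
  · exact fun r hr => ⟨by linarith [hr.1], by linarith [hr.2]⟩

/-- The points of `γ` shortly before it reaches a point at which the field crosses a level have
their crossing time at the arrival of `γ` at this point. -/
theorem eventually_crossingTime_eq
    (hv : ContMDiff I I.tangent 1 (fun x => (⟨x, S.field x⟩ : TangentBundle I M)))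
    {h : M → ℝ} {U N : Set M} {δ K : ℝ} {Φ : M → ℝ → M} {θ : M → ℝ}
    (hbox : IsFlowBox d S.field U N δ K Φ) (hθ : IsCrossingTime d h N δ K Φ θ) {a p : ℝ} {y : M}
    (hap : a < p) (hγf : ∀ s q, a ≤ s → s < q → q < p → IsMIntegralCurveOn γ S.field (Icc s q))
    (hlim : Tendsto γ (𝓝[<] p) (𝓝 y)) (hy : y ∈ N) (hy0 : h y = 0) :
    ∀ᶠ s in 𝓝[<] p, γ s ∈ N ∧ θ (γ s) = p - s ∧ Φ (γ s) (p - s) = y := by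
  have hδ := hbox.pos
  have hmax : max a (p - δ) < p := max_lt hap (by linarith)
  filter_upwards [hlim (hbox.isOpen.mem_nhds hy), Ioo_mem_nhdsLT hmax] with s hs hs'
  have has : a < s := (le_max_left _ _).trans_lt hs'.1
  have hsδ : p - s < δ := by linarith [le_max_right a (p - δ), hs'.1]
  have hps : p - s ∈ Ioo (-δ) δ := ⟨by linarith [hs'.2], hsδ⟩
  have hΦ : ∀ r ∈ Ico 0 (p - s), Φ (γ s) r = γ (r + s) := by
    intro r hr
    have hmid : r < (r + (p - s)) / 2 := by linarith [hr.2]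
    exact IsFlowBox.eq_of_isMIntegralCurveOn hv hbox (q := s + (r + (p - s)) / 2)
      (by linarith [hr.1]) (by linarith [hr.2])
      (hγf s _ has.le (by linarith [hr.1]) (by linarith [hr.2])) hs r
      ⟨hr.1, by linarith⟩
  have hend : Φ (γ s) (p - s) = y := by
    have h1 : Tendsto (Φ (γ s)) (𝓝[<] (p - s)) (𝓝 (Φ (γ s) (p - s))) :=
      ((hbox.integral _ hs).continuousOn.continuousAt (Icc_mem_nhds hps.1 hps.2)).tendsto.mono_left
        nhdsWithin_le_nhds
    have h2 : Tendsto (fun r => γ (r + s)) (𝓝[<] (p - s)) (𝓝 y) := by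
      refine hlim.comp (tendsto_nhdsWithin_of_tendsto_nhds_of_eventually_within _ ?_ ?_)
      · have := ((continuous_add_const s).tendsto (p - s)).mono_left
          (nhdsWithin_le_nhds (s := Iio (p - s)))
        simpa using this
      · filter_upwards [self_mem_nhdsWithin] with r hr
        have : r < p - s := hr
        exact mem_Iio.2 (by linarith)
    refine tendsto_nhds_unique_of_eventuallyEq h1 h2 ?_
    filter_upwards [Ico_mem_nhdsLT (show 0 < p - s by linarith [hs'.2])] with r hr using hΦ r hr
  refine ⟨hs, ?_, hend⟩
  exact ((hθ.zero_iff _ hs _ (Ioo_subset_Icc_self hps)).1 (by rw [hend, hy0])).symm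

variable [Finite ι]

/-- Transition along the flow. -/
theorem exists_transits_of_flow (hd : IsChartCompatibleDist I d)
    (hv : ContMDiff I I.tangent 1 (fun x => (⟨x, S.field x⟩ : TangentBundle I M)))
    (hγ : S.IsTrajectoryOn γ J (Ici 0)) (htr : S.IsTransverse γ J)
    {U N : Set M} {δ K : ℝ} {Φ : M → ℝ → M} (hbox : IsFlowBox d S.field U N δ K Φ) {s q : ℝ}
    (hs0 : 0 ≤ s) (hsq : s < q) (hq : q - s < δ) (hγf : IsMIntegralCurveOn γ S.field (Icc s q))
    (hs : γ s ∈ N) {N₂ : Set M} (hN₂ : N₂ ∈ 𝓝 (γ q)) :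
    ∃ N₁ ∈ 𝓝 (γ s), S.Transits d γ δ K N₁ N₂ := by
  have hflow := IsFlowBox.eq_of_isMIntegralCurveOn hv hbox hsq hq.le hγf hs
  have hδ := hbox.pos
  have hioo : ∀ r ∈ Icc 0 (q - s), r ∈ Ioo (-δ) δ := fun r hr =>
    ⟨by linarith [hr.1], by linarith [hr.2]⟩
  have hev : ∀ᶠ x in 𝓝 (γ s), ∀ r ∈ Icc 0 (q - s), ∀ i, Φ x r ∉ closure (S.guard i) := by
    refine isCompact_Icc.eventually_forall_of_forall_eventually
      (P := fun x r => ∀ i, Φ x r ∉ closure (S.guard i)) fun r hr => ?_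
    refine (hbox.continuousAt hd hs (hioo r hr)).eventually
      (S.isOpen_compl_closure_guards.mem_nhds ?_)
    intro i
    beta_reduce
    rw [hflow r hr]
    exact htr.off_guards _ (by linarith [hr.1]) i
  have hqmem : q - s ∈ Icc 0 (q - s) := ⟨by linarith, le_rfl⟩
  have hev2 : ∀ᶠ x in 𝓝 (γ s), Φ x (q - s) ∈ N₂ := by
    have h1 : ContinuousAt (fun x => Φ x (q - s)) (γ s) :=
      ContinuousAt.comp (f := fun x : M => (x, q - s)) (g := fun p : M × ℝ => Φ p.1 p.2)
        (hbox.continuousAt hd hs (hioo _ hqmem)) (by fun_prop)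
    refine h1.eventually ?_
    beta_reduce
    rw [hflow _ hqmem, sub_add_cancel]
    exact hN₂
  refine ⟨_, inter_mem (hbox.isOpen.mem_nhds hs) (inter_mem hev hev2), ?_⟩
  have htraj : ∀ x ∈ N ∩ ({x | ∀ r ∈ Icc 0 (q - s), ∀ i, Φ x r ∉ closure (S.guard i)} ∩
      {x | Φ x (q - s) ∈ N₂}), S.IsTrajectoryOn (Φ x) ∅ (Icc 0 (q - s)) := fun x hx =>
    IsFlowBox.isTrajectoryOn hbox hx.1 hq.le fun r hr i hi => hx.2.1 r hr i (subset_closure hi)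
  intro x hx
  refine ⟨Φ x, ∅, q - s, by linarith, hq.le, htraj x hx, hasUniqueImpacts_empty _,
    hbox.zero x hx.1, hx.2.2, fun z hz => ?_⟩
  have horb := (htraj z hz.1).mem_orbit hv hγ (hasUniqueImpacts_empty _)
    (by rw [hbox.zero z hz.1.1]; exact hz.2)
  have hlip : ∀ r ∈ Icc 0 (q - s), d (Φ x r) (Φ z r) ≤ K * d x z := fun r hr => by
    have := hbox.lipschitz x hx.1 z hz.1.1 r (Ioo_subset_Icc_self (hioo r hr)) r
      (Ioo_subset_Icc_self (hioo r hr))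
    simpa using this
  exact ⟨⟨Φ z (q - s), ⟨hz.1.2.2, horb _ hqmem⟩, hlip _ hqmem⟩, fun r hr =>
    (orbitDist_le hd (horb r hr) _).trans (hlip r hr)⟩

/-- Transition to a transverse section. -/
theorem exists_transits_of_section (hd : IsChartCompatibleDist I d)
    (hv : ContMDiff I I.tangent 1 (fun x => (⟨x, S.field x⟩ : TangentBundle I M)))
    (hγ : S.IsTrajectoryOn γ J (Ici 0)) (htr : S.IsTransverse γ J) {p : ℝ} (hp : 0 < p)
    (hpJ : p ∉ J) {Sec V : Set M} (hmem : γ p ∈ Sec) (hV : V ∈ 𝓝 (γ p))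
    (htan : S.field (γ p) ∉ hypersurfaceTangent I Sec (γ p)) :
    ∃ a, 0 ≤ a ∧ a < p ∧ ∃ T K, 0 ≤ K ∧ ∀ s, a < s → s < p →
      ∃ N₁ ∈ 𝓝 (γ s), S.Transits d γ T K N₁ (Sec ∩ V) := by
  obtain ⟨U, h, hyU, hh, hpos⟩ := exists_isLocalDefiningFunction_pos htan
  have hG : {x | ∀ i, x ∉ closure (S.guard i)} ∈ 𝓝 (γ p) :=
    S.isOpen_compl_closure_guards.mem_nhds fun i => htr.off_guards p hp.le i
  obtain ⟨N, δ, K, Φ, hyN, hbox, θ, -, hθ1, hθ2⟩ :=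
    exists_isFlowBox_crossing hd hv hh hyU hmem hpos (inter_mem hG hV)
  have hθ : IsCrossingTime d h N δ K Φ θ := ⟨fun x hx => (hθ1 x hx).1,
    fun x hx t ht => (hθ1 x hx).2 t ht, hθ2⟩
  obtain ⟨a₀, ha₀, ha₀p, hflow⟩ := hγ.exists_flow_left hp Icc_subset_Ici_self hpJ
  have hev := eventually_crossingTime_eq (γ := γ) hv hbox hθ ha₀p
    (fun s q has _ hqp => hflow.mono (Icc_subset_Icc has hqp.le)) (hflow.tendsto_left ha₀p) hyN
    ((hh.mem_iff _ hyU).1 hmem)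
  obtain ⟨a, hap, ha⟩ := mem_nhdsLT_iff_exists_Ioo_subset.1 hev
  refine ⟨max a 0, le_max_right _ _, max_lt hap hp, δ, K * (1 + K),
    mul_nonneg hbox.nonneg (by linarith [hbox.nonneg]), fun s has hsp => ?_⟩
  obtain ⟨hsN, hsθ, -⟩ := ha ⟨(le_max_left _ _).trans_lt has, hsp⟩
  refine ⟨N ∩ {x | 0 < θ x}, inter_mem (hbox.isOpen.mem_nhds hsN)
    ((hθ.continuousAt hd hbox.isOpen hsN).eventually
      (lt_mem_nhds (by rw [hsθ]; linarith))), ?_⟩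
  have hmemU : ∀ x ∈ N, 0 < θ x → ∀ r ∈ Icc 0 (θ x), Φ x r ∈
      {x | ∀ i, x ∉ closure (S.guard i)} ∩ V ∩ U := fun x hx h0 r hr =>
    hbox.mem x hx r ⟨by linarith [hr.1, hbox.pos], hr.2.trans (hθ.mem_Ioo hx).2.le⟩
  have hθmem : ∀ x ∈ N, θ x ∈ Icc (-δ) δ := fun x hx => Ioo_subset_Icc_self (hθ.mem_Ioo hx)
  have htraj : ∀ x ∈ N, 0 < θ x → S.IsTrajectoryOn (Φ x) ∅ (Icc 0 (θ x)) := fun x hx h0 =>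
    IsFlowBox.isTrajectoryOn hbox hx (hθ.mem_Ioo hx).2.le fun r hr i hi =>
      (hmemU x hx h0 r hr).1.1 i (subset_closure hi)
  have hend : ∀ x ∈ N, 0 < θ x → Φ x (θ x) ∈ Sec ∩ V := fun x hx h0 => by
    have h1 := hmemU x hx h0 (θ x) ⟨h0.le, le_rfl⟩
    exact ⟨(hh.mem_iff _ h1.2).2 ((hθ.zero_iff x hx _ (hθmem x hx)).2 rfl), h1.1.2⟩
  rintro x ⟨hx, hx0⟩
  refine ⟨Φ x, ∅, θ x, hx0, (hθ.mem_Ioo hx).2.le, htraj x hx hx0, hasUniqueImpacts_empty _,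
    hbox.zero x hx, hend x hx hx0, ?_⟩
  rintro z ⟨⟨hz, hz0⟩, hzγ⟩
  have hz0' : 0 < θ z := hz0
  have horb := (htraj z hz hz0').mem_orbit hv hγ (hasUniqueImpacts_empty _)
    (by rw [hbox.zero z hz]; exact hzγ)
  exact ⟨⟨Φ z (θ z), ⟨hend z hz hz0', horb _ ⟨hz0'.le, le_rfl⟩⟩, hθ.dist_le hbox hx hz⟩,
    fun r hr => hθ.orbitDist_le hd hbox hx hz hz0' (fun r hr => horb r (Ico_subset_Icc_self hr)) hr⟩

end HybridSystem

end Transition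

namespace HybridSystem

section TransitionAlong

variable {E : Type*} [NormedAddCommGroup E] [NormedSpace ℝ E]
  {H : Type*} [TopologicalSpace H] {I : ModelWithCorners ℝ E H}
  {M : Type*} [TopologicalSpace M] [ChartedSpace H M] {ι : Type*}
  {S : HybridSystem I M ι} {γ : ℝ → M} {J : Set ℝ} {d : M → M → ℝ}

/-- Every neighbourhood of `γ q` is reached from some neighbourhood of `γ s`, for `a ≤ s < q ≤ b`,
with uniform constants. -/
def TransitsAlong (S : HybridSystem I M ι) (d : M → M → ℝ) (γ : ℝ → M) (T K a b : ℝ) : Prop :=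
  ∀ s q, a ≤ s → s < q → q ≤ b → ∀ N₂ ∈ 𝓝 (γ q), ∃ N₁ ∈ 𝓝 (γ s), S.Transits d γ T K N₁ N₂

theorem TransitsAlong.mono {T K a b b' : ℝ} (h : S.TransitsAlong d γ T K a b) (hb : b' ≤ b) :
    S.TransitsAlong d γ T K a b' := fun s q has hsq hqb => h s q has hsq (hqb.trans hb)

theorem TransitsAlong.trans (hd : IsChartCompatibleDist I d) {T T' K K' a b c : ℝ}
    (h : S.TransitsAlong d γ T K a b) (h' : S.TransitsAlong d γ T' K' b c) (hT : 0 ≤ T)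
    (hT' : 0 ≤ T') (hK : 0 ≤ K) (hK' : 0 ≤ K') :
    S.TransitsAlong d γ (T + T') (K + K' + K' * K) a c := by
  intro s q has hsq hqc N₂ hN₂
  have hKK := mul_nonneg hK' hK
  rcases le_or_gt q b with hqb | hqb
  · obtain ⟨N₁, hN₁, h1⟩ := h s q has hsq hqb N₂ hN₂
    exact ⟨N₁, hN₁, h1.mono hd (by linarith) (by linarith) Subset.rfl⟩
  · rcases le_or_gt b s with hbs | hbs
    · obtain ⟨N₁, hN₁, h1⟩ := h' s q hbs hsq hqc N₂ hN₂
      exact ⟨N₁, hN₁, h1.mono hd (by linarith) (by linarith) Subset.rfl⟩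
    · obtain ⟨N, hN, h1⟩ := h' b q le_rfl hqb hqc N₂ hN₂
      obtain ⟨N₁, hN₁, h2⟩ := h s b has hbs le_rfl N hN
      exact ⟨N₁, hN₁, (h2.trans h1 hd hK hK').mono hd le_rfl (by linarith) Subset.rfl⟩

theorem hasUniqueImpacts_singleton [T2Space M] {c : ℝ → M} {t : ℝ} {i : ι} {x : M}
    (hl : Tendsto c (𝓝[<] t) (𝓝 x)) (h : ∀ j, x ∈ S.guard j → j = i) :
    S.HasUniqueImpacts c {t} := by
  rintro _ rfl j x' hx' hl' k hk
  have := tendsto_nhds_unique hl hl'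
  subst this
  rw [h j hx', h k hk]

/-- The trajectory that follows the flow until it reaches the guard `i` at the time `θ`. -/
theorem IsFlowBox.isTrajectoryOn_impact {U N : Set M} {δ K : ℝ} {Φ : M → ℝ → M}
    (hbox : IsFlowBox d S.field U N δ K Φ) {x : M} (hx : x ∈ N) {θ : ℝ} (hθ : θ ∈ Ioo 0 δ)
    {i : ι} (hi : Φ x θ ∈ S.guard i) (hG : ∀ r ∈ Ico 0 θ, ∀ j, Φ x r ∉ S.guard j)
    (hG' : ∀ j, S.reset i (Φ x θ) ∉ S.guard j) :
    ∃ c, S.IsTrajectoryOn c {θ} (Icc 0 θ) ∧ Tendsto c (𝓝[<] θ) (𝓝 (Φ x θ)) ∧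
      (∀ r, r < θ → c r = Φ x r) ∧ c θ = S.reset i (Φ x θ) := by
  have hδ := hbox.pos
  set c : ℝ → M := fun r => if r < θ then Φ x r else S.reset i (Φ x θ) with hc
  have hc1 : ∀ r, r < θ → c r = Φ x r := fun r hr => by simp [hc, hr]
  have hc2 : c θ = S.reset i (Φ x θ) := by simp [hc]
  have hl : Tendsto c (𝓝[<] θ) (𝓝 (Φ x θ)) := by
    have h1 : Tendsto (Φ x) (𝓝[<] θ) (𝓝 (Φ x θ)) :=
      ((hbox.integral x hx).continuousOn.continuousAt
        (Icc_mem_nhds (by linarith [hθ.1]) hθ.2)).tendsto.mono_left nhdsWithin_le_nhds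
    refine h1.congr' ?_
    filter_upwards [self_mem_nhdsWithin] with r hr using (hc1 r hr).symm
  refine ⟨c, ⟨?_, fun b => (finite_singleton θ).inter_of_left _, ?_, ?_, ?_⟩, hl, hc1, hc2⟩
  · rintro _ rfl
    exact ⟨⟨hθ.1.le, le_rfl⟩, hθ.1⟩
  · intro a b hab hI hdis
    have ha := hI ⟨le_rfl, hab.le⟩
    have hb := hI ⟨hab.le, le_rfl⟩
    have hbθ : b < θ := lt_of_le_of_ne hb.2 fun h =>
      Set.disjoint_left.1 hdis (show b ∈ Ioc a b from ⟨hab, le_rfl⟩) h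
    refine ((hbox.integral x hx).mono (Icc_subset_Icc (by linarith [ha.1])
      (by linarith [hθ.2]))).congr fun r hr => hc1 r (hr.2.trans_lt hbθ)
  · intro r hr j
    rcases hr.2.eq_or_lt with h1 | h1
    · rw [h1, hc2]
      exact hG' j
    · rw [hc1 r h1]
      exact hG r ⟨hr.1, h1⟩ j
  · rintro _ rfl
    exact ⟨i, Φ x _, hi, hl, hc2⟩

variable [CompleteSpace E] [I.Boundaryless] [IsManifold I 1 M] [T2Space M] [Finite ι]

/-- Transition along the flow, in an interval in which `γ` stays in a flow box. -/
theorem transitsAlong_of_flow (hd : IsChartCompatibleDist I d)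
    (hv : ContMDiff I I.tangent 1 (fun x => (⟨x, S.field x⟩ : TangentBundle I M)))
    (hγ : S.IsTrajectoryOn γ J (Ici 0)) (htr : S.IsTransverse γ J)
    {U N : Set M} {δ K : ℝ} {Φ : M → ℝ → M} (hbox : IsFlowBox d S.field U N δ K Φ) {a b : ℝ}
    (ha : 0 ≤ a) (hba : b - a < δ) (hab : IsMIntegralCurveOn γ S.field (Icc a b))
    (hN : ∀ s ∈ Icc a b, γ s ∈ N) : S.TransitsAlong d γ δ K a b := by
  intro s q has hsq hqb N₂ hN₂
  exact exists_transits_of_flow hd hv hγ htr hbox (ha.trans has) hsq (by linarith)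
    (hab.mono (Icc_subset_Icc has hqb)) (hN s ⟨has, hsq.le.trans hqb⟩) hN₂

/-- Transition through an impact. -/
theorem exists_transits_of_impact (hd : IsChartCompatibleDist I d)
    (hv : ContMDiff I I.tangent 1 (fun x => (⟨x, S.field x⟩ : TangentBundle I M)))
    (hR : ∀ i, ContMDiffOn I I 1 (S.reset i) (S.guard i))
    (hγ : S.IsTrajectoryOn γ J (Ici 0)) (htr : S.IsTransverse γ J) {p : ℝ} (hpJ : p ∈ J) :
    ∃ a, 0 ≤ a ∧ a < p ∧ ∃ T K, 0 ≤ T ∧ 0 ≤ K ∧ ∀ s, a < s → s < p → ∀ N₂ ∈ 𝓝 (γ p),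
      ∃ N₁ ∈ 𝓝 (γ s), S.Transits d γ T K N₁ N₂ := by
  have hp : 0 < p := (hγ.impacts_subset hpJ).2
  obtain ⟨i, y, hy, hlim, hyp⟩ := hγ.impact p hpJ
  obtain ⟨U, h, hyU, hh, hpos⟩ :=
    exists_isLocalDefiningFunction_pos (htr.transversal p hpJ i y hy hlim)
  obtain ⟨KR, hKR, W, hW, hWR⟩ := hh.exists_lipschitz hd hyU hy (hR i y hy)
  have hG : {x | ∀ j, j ≠ i → x ∉ closure (S.guard j)} ∈ 𝓝 y := by
    have : {x | ∀ j, j ≠ i → x ∉ closure (S.guard j)} =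
        ⋂ j, {x | j ≠ i → x ∉ closure (S.guard j)} := by
      ext x
      simp
    rw [this, iInter_mem]
    intro j
    by_cases hj : j = i
    · simp [hj]
    · filter_upwards [isClosed_closure.isOpen_compl.mem_nhds
        (htr.single p hpJ i y hy hlim j hj)] with x hx _ using hx
  obtain ⟨N, δ, K, Φ, hyN, hbox, θ, -, hθ1, hθ2⟩ :=
    exists_isFlowBox_crossing hd hv hh hyU hy hpos (inter_mem hG hW)
  have hθ : IsCrossingTime d h N δ K Φ θ := ⟨fun x hx => (hθ1 x hx).1,
    fun x hx t ht => (hθ1 x hx).2 t ht, hθ2⟩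
  have hδ := hbox.pos
  have hK := hbox.nonneg
  obtain ⟨a₀, ha₀, ha₀p, hdis⟩ := hγ.exists_left hp
  have hev := eventually_crossingTime_eq (γ := γ) hv hbox hθ ha₀p
    (fun s q has hsq hqp => hγ.flow s q hsq (fun r hr => ha₀.trans (has.trans hr.1))
      (hdis.mono_left (show Ioc s q ⊆ Ico a₀ p from fun r hr =>
        ⟨has.trans hr.1.le, hr.2.trans_lt hqp⟩))) hlim hyN
    ((hh.mem_iff _ hyU).1 hy)
  obtain ⟨a, hap, ha⟩ := mem_nhdsLT_iff_exists_Ioo_subset.1 hev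
  have hKK : 0 ≤ K * (1 + K) := mul_nonneg hK (by linarith)
  refine ⟨max a 0, le_max_right _ _, max_lt hap hp, δ, KR * (K * (1 + K)) + K * (1 + K), hδ.le,
    by positivity, fun s has hsp N₂ hN₂ => ?_⟩
  obtain ⟨hsN, hsθ, hsy⟩ := ha ⟨(le_max_left _ _).trans_lt has, hsp⟩
  have hθmem : ∀ x ∈ N, θ x ∈ Icc (-δ) δ := fun x hx => Ioo_subset_Icc_self (hθ.mem_Ioo hx)
  have hend : ∀ x ∈ N, Φ x (θ x) ∈ S.guard i ∩ W := fun x hx => by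
    have h1 := hbox.mem x hx _ (hθmem x hx)
    exact ⟨(hh.mem_iff _ h1.2).2 ((hθ.zero_iff x hx _ (hθmem x hx)).2 rfl), h1.1.2⟩
  have hRlip : ∀ x ∈ N, ∀ z ∈ N, d (S.reset i (Φ x (θ x))) (S.reset i (Φ z (θ z))) ≤
      KR * (K * (1 + K)) * d x z := fun x hx z hz =>
    (hWR _ (hend x hx) _ (hend z hz)).trans (by
      rw [mul_assoc]
      exact mul_le_mul_of_nonneg_left (hθ.dist_le hbox hx hz) hKR)
  set N₂' := N₂ ∩ {x | ∀ i, x ∉ closure (S.guard i)} with hN₂'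
  have hN₂'mem : N₂' ∈ 𝓝 (γ p) :=
    inter_mem hN₂ (S.isOpen_compl_closure_guards.mem_nhds fun i => htr.off_guards p hp.le i)
  have hcont : ∀ᶠ x in 𝓝 (γ s), S.reset i (Φ x (θ x)) ∈ N₂' := by
    have h1 : Tendsto (fun x => S.reset i (Φ x (θ x))) (𝓝 (γ s)) (𝓝 (γ p)) := by
      rw [hd.tendsto_nhds_iff]
      have h2 := (hd.tendsto_self (γ s)).const_mul (KR * (K * (1 + K)))
      rw [mul_zero] at h2
      refine squeeze_zero' (Eventually.of_forall fun _ => hd.nonneg _ _) ?_ h2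
      filter_upwards [hbox.isOpen.mem_nhds hsN] with x hx
      have h3 := hRlip _ hsN x hx
      rwa [hsθ, hsy, ← hyp] at h3
    exact h1 hN₂'mem
  have hpos' : ∀ᶠ x in 𝓝 (γ s), 0 < θ x :=
    (hθ.continuousAt hd hbox.isOpen hsN).eventually (lt_mem_nhds (by rw [hsθ]; linarith))
  refine ⟨_, inter_mem (hbox.isOpen.mem_nhds hsN) (inter_mem hpos' hcont), ?_⟩
  have htraj : ∀ x ∈ N ∩ ({x | 0 < θ x} ∩ {x | S.reset i (Φ x (θ x)) ∈ N₂'}), ∃ c,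
      S.IsTrajectoryOn c {θ x} (Icc 0 (θ x)) ∧ S.HasUniqueImpacts c {θ x} ∧
      (∀ r, r < θ x → c r = Φ x r) ∧ c (θ x) = S.reset i (Φ x (θ x)) := by
    rintro x ⟨hx, hx0, hx2⟩
    have hguard : ∀ r ∈ Icc 0 (θ x), ∀ j, Φ x r ∈ S.guard j → j = i := by
      intro r hr j hj
      by_contra hne
      exact (hbox.mem x hx r ⟨by linarith [hr.1], hr.2.trans (hθmem x hx).2⟩).1.1 j hne
        (subset_closure hj)
    obtain ⟨c, h1, h2, h3, h4⟩ := IsFlowBox.isTrajectoryOn_impact hbox hx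
      ⟨hx0, (hθ.mem_Ioo hx).2⟩ (hend x hx).1 (fun r hr j hj => by
        have hrδ : r ∈ Icc (-δ) δ := ⟨by linarith [hr.1], hr.2.le.trans (hθmem x hx).2⟩
        have hji := hguard r (Ico_subset_Icc_self hr) j hj
        subst hji
        have := (hh.mem_iff _ (hbox.mem x hx r hrδ).2).1 hj
        exact hr.2.ne ((hθ.zero_iff x hx r hrδ).1 this))
      (fun j hj => hx2.2 j (subset_closure hj))
    exact ⟨c, h1, hasUniqueImpacts_singleton h2 (hguard _ ⟨le_of_lt hx0, le_rfl⟩), h3, h4⟩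
  rintro x hx
  obtain ⟨c, hc1, hc2, hc3, hc4⟩ := htraj x hx
  have hx0 : 0 < θ x := hx.2.1
  refine ⟨c, {θ x}, θ x, hx0, (hθmem x hx.1).2, hc1, hc2, ?_, by rw [hc4]; exact hx.2.2.1, ?_⟩
  · rw [hc3 0 hx0, hbox.zero x hx.1]
  rintro z ⟨hz, hzγ⟩
  obtain ⟨e, he1, he2, he3, he4⟩ := htraj z hz
  have hz0 : 0 < θ z := hz.2.1
  have horb := he1.mem_orbit hv hγ he2 (by rw [he3 0 hz0, hbox.zero z hz.1]; exact hzγ)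
  have hdn := hd.nonneg x z
  have hle1 : KR * (K * (1 + K)) * d x z ≤ (KR * (K * (1 + K)) + K * (1 + K)) * d x z := by
    nlinarith [mul_nonneg hKK hdn]
  have hle2 : K * (1 + K) * d x z ≤ (KR * (K * (1 + K)) + K * (1 + K)) * d x z := by
    nlinarith [mul_nonneg (mul_nonneg hKR hKK) hdn]
  have hde : d (c (θ x)) (e (θ z)) ≤ (KR * (K * (1 + K)) + K * (1 + K)) * d x z := by
    rw [hc4, he4]
    exact (hRlip x hx.1 z hz.1).trans hle1
  have heγ := horb (θ z) ⟨hz0.le, le_rfl⟩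
  refine ⟨⟨e (θ z), ⟨by rw [he4]; exact hz.2.2.1, heγ⟩, hde⟩, fun r hr => ?_⟩
  rcases hr.2.eq_or_lt with h1 | h1
  · rw [h1]
    exact (orbitDist_le hd heγ _).trans hde
  · rw [hc3 r h1]
    refine (hθ.orbitDist_le hd hbox hx.1 hz.1 hz0 (fun r hr => ?_) hr).trans hle2
    rw [← he3 r hr.2]
    exact horb r (Ico_subset_Icc_self hr)

theorem exists_transitsAlong_right (hd : IsChartCompatibleDist I d)
    (hv : ContMDiff I I.tangent 1 (fun x => (⟨x, S.field x⟩ : TangentBundle I M)))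
    (hγ : S.IsTrajectoryOn γ J (Ici 0)) (htr : S.IsTransverse γ J) {p b : ℝ} (hp : 0 ≤ p)
    (hpb : p < b) :
    ∃ e ∈ Ioc p b, ∃ T K, 0 ≤ T ∧ 0 ≤ K ∧ S.TransitsAlong d γ T K p e := by
  obtain ⟨N, δ, K, Φ, hyN, hbox⟩ := exists_isFlowBox hd hv (γ p) univ_mem
  obtain ⟨e, hpe, heb, hdis⟩ := hγ.exists_right hpb
  have hflow := hγ.flow p e hpe (fun r hr => hp.trans hr.1) hdis
  have hcont := hflow.continuousOn p ⟨le_rfl, hpe.le⟩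
  rw [ContinuousWithinAt, nhdsWithin_Icc_eq_nhdsGE hpe] at hcont
  obtain ⟨u, hpu, hu⟩ := (mem_nhdsGE_iff_exists_Ico_subset.1 (hcont (hbox.isOpen.mem_nhds hyN)))
  have hpu' : p < u := hpu
  have hδ := hbox.pos
  set m := min e (min ((p + u) / 2) (p + δ / 2)) with hm
  have hpm : p < m := lt_min hpe (lt_min (by linarith) (by linarith))
  have h1 : m ≤ e := min_le_left _ _
  have h2 : m ≤ (p + u) / 2 := (min_le_right _ _).trans (min_le_left _ _)
  have h3 : m ≤ p + δ / 2 := (min_le_right _ _).trans (min_le_right _ _)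
  exact ⟨m, ⟨hpm, h1.trans heb⟩, δ, K, hδ.le, hbox.nonneg,
    transitsAlong_of_flow hd hv hγ htr hbox hp (by linarith)
      (hflow.mono (Icc_subset_Icc_right h1)) fun s hs => hu ⟨hs.1, by linarith [hs.2]⟩⟩

theorem exists_transitsAlong_left (hd : IsChartCompatibleDist I d)
    (hv : ContMDiff I I.tangent 1 (fun x => (⟨x, S.field x⟩ : TangentBundle I M)))
    (hR : ∀ i, ContMDiffOn I I 1 (S.reset i) (S.guard i))
    (hγ : S.IsTrajectoryOn γ J (Ici 0)) (htr : S.IsTransverse γ J) {p : ℝ} (hp : 0 < p) :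
    ∃ a ∈ Ico 0 p, ∃ T K, 0 ≤ T ∧ 0 ≤ K ∧ S.TransitsAlong d γ T K a p := by
  obtain ⟨a₀, ha₀, ha₀p, hdis⟩ := hγ.exists_left hp
  obtain ⟨y, hlim⟩ : ∃ y, Tendsto γ (𝓝[<] p) (𝓝 y) := by
    by_cases hpJ : p ∈ J
    · obtain ⟨i, y, -, hlim, -⟩ := hγ.impact p hpJ
      exact ⟨y, hlim⟩
    · exact ⟨γ p, hγ.tendsto_left hp Icc_subset_Ici_self hpJ⟩
  obtain ⟨N, δ, K, Φ, hyN, hbox⟩ := exists_isFlowBox hd hv y univ_mem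
  have hδ := hbox.pos
  obtain ⟨l, hlp, hl⟩ := mem_nhdsLT_iff_exists_Ioo_subset.1 (hlim (hbox.isOpen.mem_nhds hyN))
  have hlp' : l < p := hlp
  by_cases hpJ : p ∈ J
  · obtain ⟨a₁, ha₁, ha₁p, T, K', hT, hK', himp⟩ := exists_transits_of_impact hd hv hR hγ htr hpJ
    set m := max (max a₀ ((a₁ + p) / 2)) (max ((l + p) / 2) (p - δ / 2)) with hm
    have h1 : a₀ ≤ m := (le_max_left _ _).trans (le_max_left _ _)
    have h2 : (a₁ + p) / 2 ≤ m := (le_max_right _ _).trans (le_max_left _ _)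
    have h3 : (l + p) / 2 ≤ m := (le_max_left _ _).trans (le_max_right _ _)
    have h4 : p - δ / 2 ≤ m := (le_max_right _ _).trans (le_max_right _ _)
    have hmp : m < p := max_lt (max_lt ha₀p (by linarith)) (max_lt (by linarith) (by linarith))
    refine ⟨m, ⟨ha₀.trans h1, hmp⟩, δ + T, K + K', by linarith, by linarith [hbox.nonneg], ?_⟩
    intro s q hms hsq hqp N₂ hN₂
    rcases hqp.eq_or_lt with h5 | h5
    · subst h5
      obtain ⟨N₁, hN₁, h6⟩ := himp s (by linarith) hsq N₂ hN₂
      exact ⟨N₁, hN₁, h6.mono hd (by linarith) (by linarith [hbox.nonneg]) Subset.rfl⟩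
    · have hint : IsMIntegralCurveOn γ S.field (Icc s q) := hγ.flow s q hsq
        (fun r hr => ha₀.trans ((h1.trans hms).trans hr.1))
        (hdis.mono_left (show Ioc s q ⊆ Ico a₀ p from fun r hr =>
          ⟨(h1.trans hms).trans hr.1.le, hr.2.trans_lt h5⟩))
      obtain ⟨N₁, hN₁, h6⟩ := exists_transits_of_flow hd hv hγ htr hbox
        (ha₀.trans (h1.trans hms)) hsq (by linarith) hint
        (hl ⟨by linarith, by linarith⟩) hN₂
      exact ⟨N₁, hN₁, h6.mono hd (by linarith) (by linarith) Subset.rfl⟩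
  · obtain ⟨a₁, ha₁, ha₁p, hflow⟩ := hγ.exists_flow_left hp Icc_subset_Ici_self hpJ
    have hyp : y = γ p :=
      tendsto_nhds_unique hlim (hγ.tendsto_left hp Icc_subset_Ici_self hpJ)
    set m := max a₁ (max ((l + p) / 2) (p - δ / 2)) with hm
    have h1 : a₁ ≤ m := le_max_left _ _
    have h3 : (l + p) / 2 ≤ m := (le_max_left _ _).trans (le_max_right _ _)
    have h4 : p - δ / 2 ≤ m := (le_max_right _ _).trans (le_max_right _ _)
    have hmp : m < p := max_lt ha₁p (max_lt (by linarith) (by linarith))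
    refine ⟨m, ⟨ha₁.trans h1, hmp⟩, δ, K, hδ.le, hbox.nonneg,
      transitsAlong_of_flow hd hv hγ htr hbox (ha₁.trans h1) (by linarith)
        (hflow.mono (Icc_subset_Icc_left h1)) fun s hs => ?_⟩
    rcases hs.2.eq_or_lt with h5 | h5
    · rw [h5, ← hyp]
      exact hyN
    · exact hl ⟨by linarith [hs.1], h5⟩

theorem exists_transitsAlong (hd : IsChartCompatibleDist I d)
    (hv : ContMDiff I I.tangent 1 (fun x => (⟨x, S.field x⟩ : TangentBundle I M)))
    (hR : ∀ i, ContMDiffOn I I 1 (S.reset i) (S.guard i))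
    (hγ : S.IsTrajectoryOn γ J (Ici 0)) (htr : S.IsTransverse γ J) {b : ℝ} (hb : 0 ≤ b) :
    ∃ T K, 0 ≤ T ∧ 0 ≤ K ∧ S.TransitsAlong d γ T K 0 b := by
  refine Icc_induction (P := fun r => ∃ T K, 0 ≤ T ∧ 0 ≤ K ∧ S.TransitsAlong d γ T K 0 r)
    ?_ ?_ ?_ b ⟨hb, le_rfl⟩
  · exact ⟨0, 0, le_rfl, le_rfl, fun s q h1 h2 h3 => absurd (h1.trans_lt h2) (not_lt.2 h3)⟩
  · rintro r hr ⟨T, K, hT, hK, h⟩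
    obtain ⟨e, he, T', K', hT', hK', h'⟩ := exists_transitsAlong_right hd hv hγ htr hr.1 hr.2
    exact ⟨e, he, fun s hs => ⟨T + T', K + K' + K' * K, by positivity, by positivity,
      h.trans hd (h'.mono hs.2) hT hT' hK hK'⟩⟩
  · intro r hr hlt
    obtain ⟨a, ha, T', K', hT', hK', h'⟩ := exists_transitsAlong_left hd hv hR hγ htr hr.1
    obtain ⟨T, K, hT, hK, h⟩ := hlt a ha
    exact ⟨T + T', K + K' + K' * K, by positivity, by positivity, h.trans hd h' hT hT' hK hK'⟩

/-- Transition to a transverse section from everywhere along the orbit before it meets the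
section. -/
theorem exists_transits_to_section (hd : IsChartCompatibleDist I d)
    (hv : ContMDiff I I.tangent 1 (fun x => (⟨x, S.field x⟩ : TangentBundle I M)))
    (hR : ∀ i, ContMDiffOn I I 1 (S.reset i) (S.guard i))
    (hγ : S.IsTrajectoryOn γ J (Ici 0)) (htr : S.IsTransverse γ J) {p : ℝ} (hp : 0 < p)
    (hpJ : p ∉ J) {Sec V : Set M} (hmem : γ p ∈ Sec) (hV : V ∈ 𝓝 (γ p))
    (htan : S.field (γ p) ∉ hypersurfaceTangent I Sec (γ p)) :
    ∃ T K, 0 ≤ K ∧ ∀ s, 0 ≤ s → s < p →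
      ∃ N₁ ∈ 𝓝 (γ s), S.Transits d γ T K N₁ (Sec ∩ V) := by
  obtain ⟨a, ha, hap, T₁, K₁, hK₁, h₁⟩ :=
    exists_transits_of_section hd hv hγ htr hp hpJ hmem hV htan
  obtain ⟨T, K, hT, hK, h⟩ := exists_transitsAlong hd hv hR hγ htr hp.le
  have hmid : a < (a + p) / 2 := by linarith
  obtain ⟨N, hN, hNV⟩ := h₁ ((a + p) / 2) hmid (by linarith)
  refine ⟨T + T₁, K₁ + (K + K₁ * K), by positivity, fun s hs hsp => ?_⟩
  rcases lt_or_ge a s with has | has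
  · obtain ⟨N₁, hN₁, h2⟩ := h₁ s has hsp
    exact ⟨N₁, hN₁, h2.mono hd (by linarith)
      (by linarith [mul_nonneg hK₁ hK]) Subset.rfl⟩
  · obtain ⟨N₁, hN₁, h2⟩ := h s ((a + p) / 2) hs (by linarith) (by linarith) N hN
    exact ⟨N₁, hN₁, (h2.trans hNV hd hK hK₁).mono hd le_rfl (by linarith) Subset.rfl⟩

end TransitionAlong

end HybridSystem

section LinearContraction

/-- A map whose derivative along the regular zero level of a function has spectral radius less
than one contracts this level towards its fixed point, for a suitable size function. -/
theorem exists_contraction_of_complexSpectralRadius_lt_one {E : Type*} [NormedAddCommGroup E]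
    [NormedSpace ℝ E] [FiniteDimensional ℝ E] {h : E → ℝ} {u₀ : E} (hh : DifferentiableAt ℝ h u₀)
    (hl : fderiv ℝ h u₀ ≠ 0) {V : Submodule ℝ E} (hV : ∀ w, w ∈ V ↔ fderiv ℝ h u₀ w = 0)
    {S : Set E} (hS : ∀ᶠ u in 𝓝[S] u₀, h u = h u₀) {f : E → E} (hf0 : f u₀ = u₀) {D : E →L[ℝ] E}
    (hf : HasFDerivWithinAt f D S u₀) {A : Module.End ℝ V} (hA : ∀ w : V, D w = A w)
    (hr : complexSpectralRadius A < 1) :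
    ∃ κ, 0 < κ ∧ κ < 1 ∧ ∃ C, 0 < C ∧ ∃ N : E → ℝ, (∀ u, 0 ≤ N u) ∧
      (∀ u, N u ≤ C * ‖u - u₀‖) ∧ ∀ᶠ u in 𝓝[S] u₀, ‖u - u₀‖ ≤ C * N u ∧ N (f u) ≤ κ * N u := by
  obtain ⟨κ, hκ0, hκ1, C₀, hC₀, ν, hadd, hle, hge, hνA⟩ := exists_adapted_norm A hr
  set ℓ := fderiv ℝ h u₀ with hℓ
  obtain ⟨e, he⟩ : ∃ e, ℓ e = 1 := by
    obtain ⟨e, he⟩ := ContinuousLinearMap.exists_ne_zero hl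
    exact ⟨(ℓ e)⁻¹ • e, by simp [he]⟩
  set pr : E →L[ℝ] V := (ContinuousLinearMap.id ℝ E - ℓ.smulRight e).codRestrict V
    (fun v => (hV _).2 (by simp [he])) with hpr
  have hprc : ∀ v, (pr v : E) = v - ℓ v • e := fun v => rfl
  have hνn : ∀ v, 0 ≤ ν v := fun v => (norm_nonneg v).trans (hle v)
  have hNle : ∀ v, ν (pr v) ≤ C₀ * ‖pr‖ * ‖v‖ := fun v => (hge _).trans (by
    rw [mul_assoc]
    exact mul_le_mul_of_nonneg_left (pr.le_opNorm v) hC₀.le)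
  have ho1 : (fun u => ℓ (u - u₀)) =o[𝓝[S] u₀] fun u => u - u₀ := by
    have h1 := (hh.hasFDerivAt.isLittleO.mono (nhdsWithin_le_nhds (s := S))).neg_left
    refine h1.congr' ?_ EventuallyEq.rfl
    filter_upwards [hS] with u hu
    simp [hu, hℓ]
  have ho2 : (fun u => f u - u₀ - D (pr (u - u₀))) =o[𝓝[S] u₀] fun u => u - u₀ := by
    have h1 := hf.isLittleO
    have h2 : (fun u => ℓ (u - u₀) • D e) =o[𝓝[S] u₀] fun u => u - u₀ := by
      have h3 : (fun u => ℓ (u - u₀) • D e) =O[𝓝[S] u₀] fun u => ℓ (u - u₀) :=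
        Asymptotics.IsBigO.of_bound ‖D e‖ (Eventually.of_forall fun u => by
          rw [norm_smul, mul_comm])
      exact h3.trans_isLittleO ho1
    refine (h1.add h2).congr_left fun u => ?_
    rw [hf0, hprc, map_sub D (u - u₀), map_smul]
    abel
  set ε := (1 - κ) / (4 * (C₀ * ‖pr‖ + 1)) with hε
  have hCpr : 0 ≤ C₀ * ‖pr‖ := mul_nonneg hC₀.le pr.opNorm_nonneg
  have hε0 : 0 < ε := div_pos (by linarith) (by linarith)
  have hεle : C₀ * ‖pr‖ * ε ≤ (1 - κ) / 4 := by
    rw [hε, mul_div_assoc', div_le_div_iff₀ (by linarith) (by norm_num)]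
    nlinarith
  refine ⟨(1 + κ) / 2, by linarith, by linarith, C₀ * ‖pr‖ + 2, by linarith,
    fun u => ν (pr (u - u₀)), fun u => hνn _, fun u => (hNle _).trans
      (mul_le_mul_of_nonneg_right (by linarith) (norm_nonneg _)), ?_⟩
  filter_upwards [ho1.def (c := 1 / (2 * (‖e‖ + 1))) (by positivity), ho2.def hε0] with u h1 h2
  have hsmall : ‖u - u₀‖ ≤ 2 * ν (pr (u - u₀)) := by
    have h3 : ‖ℓ (u - u₀) • e‖ ≤ 1 / 2 * ‖u - u₀‖ := by
      rw [norm_smul]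
      calc _ ≤ 1 / (2 * (‖e‖ + 1)) * ‖u - u₀‖ * (‖e‖ + 1) := by
            gcongr
            linarith
        _ = _ := by
          have : ‖e‖ + 1 ≠ 0 := by positivity
          field_simp
    have h4 : ‖u - u₀‖ ≤ ‖(pr (u - u₀) : E)‖ + ‖ℓ (u - u₀) • e‖ := by
      have : u - u₀ = (pr (u - u₀) : E) + ℓ (u - u₀) • e := by rw [hprc]; abel
      calc _ = ‖(pr (u - u₀) : E) + ℓ (u - u₀) • e‖ := by rw [← this]
        _ ≤ _ := norm_add_le _ _
    have h5 : ‖(pr (u - u₀) : E)‖ ≤ ν (pr (u - u₀)) := hle (pr (u - u₀))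
    linarith
  refine ⟨hsmall.trans (mul_le_mul_of_nonneg_right (by linarith) (hνn _)), ?_⟩
  have hsplit : pr (f u - u₀) = A (pr (u - u₀)) + pr (f u - u₀ - D (pr (u - u₀))) := by
    have h6 : pr (A (pr (u - u₀)) : E) = A (pr (u - u₀)) := by
      apply Subtype.ext
      rw [hprc, (hV _).1 (A (pr (u - u₀))).2]
      simp
    rw [map_sub pr (f u - u₀), hA, h6]
    abel
  show ν (pr (f u - u₀)) ≤ _
  rw [hsplit]
  calc _ ≤ ν (A (pr (u - u₀))) + ν (pr (f u - u₀ - D (pr (u - u₀)))) := hadd _ _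
    _ ≤ κ * ν (pr (u - u₀)) + C₀ * ‖pr‖ * (ε * ‖u - u₀‖) :=
      add_le_add (hνA _) ((hNle _).trans (mul_le_mul_of_nonneg_left h2 hCpr))
    _ ≤ κ * ν (pr (u - u₀)) + (1 - κ) / 4 * (2 * ν (pr (u - u₀))) := by
      rw [← mul_assoc]
      gcongr
    _ = _ := by ring

end LinearContraction

section Contraction

variable {E : Type*} [NormedAddCommGroup E] [NormedSpace ℝ E] [FiniteDimensional ℝ E]
  {H : Type*} [TopologicalSpace H] {I : ModelWithCorners ℝ E H} [I.Boundaryless]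
  {M : Type*} [TopologicalSpace M] [ChartedSpace H M]

theorem IsLocalDefiningFunction.mem_hypersurfaceTangent_iff {S U : Set M} {h : M → ℝ}
    {y : M} (hh : IsLocalDefiningFunction I S U h) (hyU : y ∈ U) (hyS : y ∈ S) (w : E) :
    (w : TangentSpace I y) ∈ hypersurfaceTangent I S y ↔
      fderiv ℝ (h ∘ (extChartAt I y).symm) (extChartAt I y y) w = 0 := by
  have := FiniteDimensional.complete ℝ E
  refine ⟨fun hw => ?_, fun hw U' k hyU' hk => ?_⟩
  · have h1 := hw U h hyU hh
    rw [← hh.fderiv_chart hyU]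
    exact h1
  · have h1 : fderiv ℝ (k ∘ (extChartAt I y).symm) (extChartAt I y y) w = 0 := by
      have hcont : ContinuousAt (extChartAt I y).symm (extChartAt I y y) :=
        continuousAt_extChartAt_symm y
      have hev : ∀ᶠ u in 𝓝 (extChartAt I y y), (extChartAt I y).symm u ∈ U ∩ U' :=
        hcont.eventually (by
          rw [extChartAt_to_inv]
          exact inter_mem (hh.isOpen.mem_nhds hyU) (hk.isOpen.mem_nhds hyU'))
      refine fderiv_apply_eq_zero_of_zero_level (hh.contDiffAt_chart hyU) ?_ ?_
        ((hk.contDiffAt_chart hyU').differentiableAt (by simp)) ?_ hw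
      · simpa using (hh.mem_iff y hyU).1 hyS
      · rw [← hh.fderiv_chart hyU]
        exact hh.regular y hyU
      · filter_upwards [hev] with u hu h0
        exact (hk.mem_iff _ hu.2).1 ((hh.mem_iff _ hu.1).2 h0)
    rw [← hk.fderiv_chart hyU'] at h1
    exact h1

/-- If the monodromy has spectral radius less than one, the Poincaré map contracts a neighbourhood
of its fixed point in the section, for a size function comparable to the distance. -/
theorem exists_contraction_of_isMonodromy {d : M → M → ℝ} (hd : IsChartCompatibleDist I d)
    {Sec : Set M} {x₀ : M} {P : M → M} (hSec : IsEmbeddedHypersurface I Sec) (hx₀ : x₀ ∈ Sec)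
    (hP0 : P x₀ = x₀) (hPSec : ∀ᶠ x in 𝓝[Sec] x₀, P x ∈ Sec)
    {Mon : Module.End ℝ (hypersurfaceTangent I Sec x₀)} (hMon : IsMonodromy Sec x₀ P Mon)
    (hr : complexSpectralRadius Mon < 1) {W : Set M} (hW : W ∈ 𝓝 x₀) :
    ∃ κ, 0 < κ ∧ κ < 1 ∧ ∃ C, 0 < C ∧ ∃ N : M → ℝ, ∃ V ∈ 𝓝 x₀, V ⊆ W ∧ ∀ x ∈ Sec ∩ V,
      P x ∈ Sec ∩ V ∧ 0 ≤ N x ∧ d x x₀ ≤ C * N x ∧ N x ≤ C * d x x₀ ∧ N (P x) ≤ κ * N x := by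
  obtain ⟨U, h, hxU, hh⟩ := hSec x₀ hx₀
  obtain ⟨D, hD, hDM⟩ := hMon
  obtain ⟨K, hK, B, hB, hbi⟩ := hd.bilipschitz x₀
  set φ := extChartAt I x₀ with hφ
  have hcont : ContinuousAt φ.symm (φ x₀) := continuousAt_extChartAt_symm x₀
  have hsymm : φ.symm (φ x₀) = x₀ := extChartAt_to_inv x₀
  have hder : HasFDerivWithinAt (φ ∘ P ∘ φ.symm) (D : E →L[ℝ] E) (φ.symm ⁻¹' Sec) (φ x₀) := by
    have h1 := hD.2
    simp only [I.range_eq_univ, inter_univ] at h1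
    rw [writtenInExtChartAt, hP0] at h1
    exact h1
  have hlevel : ∀ᶠ u in 𝓝[φ.symm ⁻¹' Sec] (φ x₀), (h ∘ φ.symm) u = (h ∘ φ.symm) (φ x₀) := by
    have h1 : ∀ᶠ u in 𝓝 (φ x₀), φ.symm u ∈ U :=
      hcont.eventually (by rw [hsymm]; exact hh.isOpen.mem_nhds hxU)
    filter_upwards [nhdsWithin_le_nhds h1, self_mem_nhdsWithin] with u hu huS
    simp only [Function.comp_apply, hsymm]
    rw [(hh.mem_iff _ hu).1 huS, (hh.mem_iff _ hxU).1 hx₀]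
  obtain ⟨κ, hκ0, hκ1, C, hC, N, hN0, hNle, hev⟩ :=
    exists_contraction_of_complexSpectralRadius_lt_one
      ((hh.contDiffAt_chart hxU).differentiableAt (by simp))
      (by rw [← hh.fderiv_chart hxU]; exact hh.regular x₀ hxU)
      (V := hypersurfaceTangent I Sec x₀)
      (fun w => hh.mem_hypersurfaceTangent_iff hxU hx₀ w) hlevel
      (show φ (P (φ.symm (φ x₀))) = φ x₀ by rw [hsymm, hP0]) hder (A := Mon) hDM hr
  have hev' : ∀ᶠ x in 𝓝[Sec] x₀, ‖φ x - φ x₀‖ ≤ C * N (φ x) ∧ N (φ (P x)) ≤ κ * N (φ x) := by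
    have h1 : Tendsto φ (𝓝[Sec] x₀) (𝓝[φ.symm ⁻¹' Sec] (φ x₀)) := by
      refine tendsto_nhdsWithin_of_tendsto_nhds_of_eventually_within _
        ((continuousAt_extChartAt x₀).tendsto.mono_left nhdsWithin_le_nhds) ?_
      filter_upwards [nhdsWithin_le_nhds (extChartAt_source_mem_nhds (I := I) x₀),
        self_mem_nhdsWithin] with x hx hxS
      simpa [φ.left_inv hx] using hxS
    filter_upwards [h1.eventually hev,
      nhdsWithin_le_nhds (extChartAt_source_mem_nhds (I := I) x₀)] with x hx hxs
    simpa only [Function.comp_apply, φ.left_inv hxs] using hx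
  have hPB : ∀ᶠ x in 𝓝[Sec] x₀, P x ∈ B ∧ (P x ∈ Sec → ‖φ (P x) - φ x₀‖ ≤ C * N (φ (P x))) := by
    have h1 : Tendsto P (𝓝[Sec] x₀) (𝓝 x₀) := by
      simpa [ContinuousWithinAt, hP0] using hD.1
    have h2 := eventually_nhdsWithin_iff.1 hev'
    filter_upwards [h1.eventually hB, h1.eventually h2] with x hx1 hx2
    exact ⟨hx1, fun h => (hx2 h).1⟩
  have hall := eventually_nhdsWithin_iff.1 (hev'.and (hPB.and hPSec))
  obtain ⟨r, hr0, hball⟩ := (hd.nhds_basis x₀).mem_iff.1 (inter_mem (inter_mem hW hB) hall)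
  have hx₀B := mem_of_mem_nhds hB
  set ρ := r / (2 * (K * C)) with hρ
  have hKC : 0 < K * C := mul_pos hK hC
  have hρ0 : 0 < ρ := by positivity
  have hNd : ∀ x ∈ B, N (φ x) ≤ C * K * d x x₀ := fun x hx => by
    have h1 := (hbi x hx x₀ hx₀B).1
    rw [inv_mul_le_iff₀ hK] at h1
    rw [mul_assoc]
    exact (hNle _).trans (mul_le_mul_of_nonneg_left h1 hC.le)
  refine ⟨κ, hκ0, hκ1, C * K, mul_pos hC hK, fun x => N (φ x),
    {x | d x₀ x < r ∧ N (φ x) < ρ}, ?_, fun x hx => (hball hx.1).1.1, ?_⟩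
  · have h1 : {x | d x₀ x < min r (ρ / (C * K))} ∈ 𝓝 x₀ :=
      hd.ball_mem_nhds x₀ (lt_min hr0 (by positivity))
    filter_upwards [h1, hB] with x hx hxB
    refine ⟨hx.trans_le (min_le_left _ _), (hNd x hxB).trans_lt ?_⟩
    rw [hd.symm, mul_comm, ← lt_div_iff₀ (by positivity)]
    exact hx.trans_le (min_le_right _ _)
  · rintro x ⟨hxS, hxr, hxN⟩
    obtain ⟨⟨-, hxB⟩, hx⟩ := hball hxr
    obtain ⟨⟨h1, h2⟩, ⟨hPxB, h3⟩, hPxS⟩ := hx hxS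
    have hdist : ∀ y ∈ B, ‖φ y - φ x₀‖ ≤ C * N (φ y) → d y x₀ ≤ C * K * N (φ y) :=
      fun y hy hyN => (hbi y hy x₀ hx₀B).2.trans (by
        calc _ ≤ K * (C * N (φ y)) := mul_le_mul_of_nonneg_left hyN hK.le
          _ = _ := by ring)
    have h4 : N (φ (P x)) < ρ :=
      h2.trans_lt (lt_of_le_of_lt (mul_le_of_le_one_left (hN0 _) hκ1.le) hxN)
    refine ⟨⟨hPxS, ?_, h4⟩, hN0 _, hdist x hxB h1, hNd x hxB, h2⟩
    rw [hd.symm]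
    calc _ ≤ C * K * N (φ (P x)) := hdist _ hPxB (h3 hPxS)
      _ ≤ C * K * ρ := by gcongr
      _ = r / 2 := by
        rw [hρ]
        field_simp
      _ < r := by linarith

end Contraction

namespace HybridSystem

section Stability

variable {E : Type*} [NormedAddCommGroup E] [NormedSpace ℝ E]
  {H : Type*} [TopologicalSpace H] {I : ModelWithCorners ℝ E H}
  {M : Type*} [TopologicalSpace M] [ChartedSpace H M] {ι : Type*}
  {S : HybridSystem I M ι} {γ : ℝ → M} {J : Set ℝ} {T : ℝ} {d : M → M → ℝ}

theorem IsPeriodicOrbit.add_period_notMem [T2Space M] (h : S.IsPeriodicOrbit γ J T) {τ : ℝ}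
    (hτ : 0 < τ) (hJ : τ ∉ J) : τ + T ∉ J := by
  have hT := h.period_pos
  rw [h.trajectory.mem_impacts_iff (by linarith) Icc_subset_Ici_self, not_not]
  have h1 := h.trajectory.tendsto_left hτ Icc_subset_Ici_self hJ
  rw [h.periodic τ hτ.le]
  have h2 : Tendsto (fun t => t - T) (𝓝[<] (τ + T)) (𝓝[<] τ) := by
    refine tendsto_nhdsWithin_of_tendsto_nhds_of_eventually_within _ ?_ ?_
    · have := ((continuous_sub_right T).tendsto (τ + T)).mono_left
        (nhdsWithin_le_nhds (s := Iio (τ + T)))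
      simpa using this
    · filter_upwards [self_mem_nhdsWithin] with t ht
      have : t < τ + T := ht
      exact mem_Iio.2 (by linarith)
  refine (h1.comp h2).congr' ?_
  filter_upwards [Ioo_mem_nhdsLT (show T < τ + T by linarith)] with t ht
  have := h.periodic (t - T) (by linarith [ht.1])
  rw [sub_add_cancel] at this
  exact this.symm

theorem IsPeriodicOrbit.exists_eq_of_lt (h : S.IsPeriodicOrbit γ J T) {t : ℝ} (ht : 0 ≤ t) :
    ∃ s, 0 ≤ s ∧ s < T ∧ γ s = γ t := by
  have hT := h.period_pos
  have key : ∀ n : ℕ, ∀ s, 0 ≤ s → γ (s + n * T) = γ s := by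
    intro n
    induction n with
    | zero => intro s _; simp
    | succ n ih =>
      intro s hs
      rw [Nat.cast_succ, add_mul, one_mul, ← add_assoc,
        h.periodic _ (add_nonneg hs (by positivity)), ih s hs]
  have h1 : (⌊t / T⌋₊ : ℝ) ≤ t / T := Nat.floor_le (by positivity)
  have h2 : t / T < ⌊t / T⌋₊ + 1 := Nat.lt_floor_add_one _
  rw [le_div_iff₀ hT] at h1
  rw [div_lt_iff₀ hT] at h2
  refine ⟨t - ⌊t / T⌋₊ * T, by linarith, by linarith, ?_⟩
  rw [← key ⌊t / T⌋₊ _ (by linarith), sub_add_cancel]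

/-- `c` is a trajectory with unique impacts on `[0, t]`, from `x` to `y`. -/
structure IsSegment (S : HybridSystem I M ι) (c : ℝ → M) (J : Set ℝ) (t : ℝ) (x y : M) : Prop where
  isTrajectoryOn : S.IsTrajectoryOn c J (Icc 0 t)
  hasUniqueImpacts : S.HasUniqueImpacts c J
  left : c 0 = x
  right : c t = y

theorem IsSegment.concat {c c' : ℝ → M} {J J' : Set ℝ} {t t' : ℝ} {x y z : M}
    (h : S.IsSegment c J t x y) (h' : S.IsSegment c' J' t' y z) (ht : 0 ≤ t) (ht' : 0 ≤ t') :
    ∃ e Je, S.IsSegment e Je (t + t') x z ∧ (∀ r ≤ t, e r = c r) ∧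
      ∀ r, t ≤ r → e r = c' (r - t) := by
  obtain ⟨e, Je, he1, he2, he3, he4⟩ := h.isTrajectoryOn.concat ht ht' h'.isTrajectoryOn
    h.hasUniqueImpacts h'.hasUniqueImpacts (by rw [h.right, h'.left])
  refine ⟨e, Je, ⟨he1, he2, by rw [he3 0 ht, h.left], ?_⟩, he3, he4⟩
  rw [he4 _ (by linarith), add_sub_cancel_left, h'.right]

theorem IsSegment.mono {c : ℝ → M} {J : Set ℝ} {t t' : ℝ} {x y : M}
    (h : S.IsSegment c J t x y) (ht : t' ≤ t) :
    S.IsSegment c (J ∩ Icc 0 t') t' x (c t') :=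
  ⟨h.isTrajectoryOn.mono (Icc_subset_Icc_right ht), h.hasUniqueImpacts.mono inter_subset_left,
    h.left, rfl⟩

/-- Decay estimates along the iterates of a contracting return map. -/
theorem exists_isSegment_of_return {Good : Set M} {P : M → M} {N : M → ℝ} {δ Θ K κ lam : ℝ}
    (hδ : 0 ≤ δ) (hK : 0 ≤ K) (hlam : 0 ≤ lam) (hκ : Real.exp (lam * Θ) * κ ≤ 1)
    (hN : ∀ x ∈ Good, 0 ≤ N x) (hP : ∀ x ∈ Good, P x ∈ Good ∧ N (P x) ≤ κ * N x)
    (hret : ∀ x ∈ Good, ∃ c J t, δ ≤ t ∧ t ≤ Θ ∧ S.IsSegment c J t x (P x) ∧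
      ∀ r ∈ Icc 0 t, orbitDist d γ (c r) ≤ K * N x) (n : ℕ) :
    ∀ x ∈ Good, ∃ c J t y, n * δ ≤ t ∧ 0 ≤ t ∧ S.IsSegment c J t x y ∧
      ∀ r ∈ Icc 0 t, orbitDist d γ (c r) ≤ K * Real.exp (lam * Θ) * Real.exp (-lam * r) * N x := by
  have hfirst : ∀ x ∈ Good, ∀ r, r ≤ Θ →
      K * N x ≤ K * Real.exp (lam * Θ) * Real.exp (-lam * r) * N x := by
    intro x hx r hr
    have h1 : 1 ≤ Real.exp (lam * Θ) * Real.exp (-lam * r) := by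
      rw [← Real.exp_add]
      exact Real.one_le_exp (by nlinarith)
    have h2 := mul_nonneg hK (hN x hx)
    calc K * N x ≤ K * N x * (Real.exp (lam * Θ) * Real.exp (-lam * r)) :=
          le_mul_of_one_le_right h2 h1
      _ = _ := by ring
  induction n with
  | zero =>
    intro x hx
    obtain ⟨c, J', t, h1, h2, h3, h4⟩ := hret x hx
    refine ⟨c, _, 0, _, by simp, le_rfl, h3.mono (hδ.trans h1), fun r hr => ?_⟩
    exact (h4 r ⟨hr.1, hr.2.trans (hδ.trans h1)⟩).trans
      (hfirst x hx r (by linarith [hr.2]))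
  | succ n ih =>
    intro x hx
    obtain ⟨c, J', t, h1, h2, h3, h4⟩ := hret x hx
    obtain ⟨hPG, hPN⟩ := hP x hx
    obtain ⟨c', J'', t', y, h1', h2', h3', h4'⟩ := ih _ hPG
    obtain ⟨e, Je, he, hel, her⟩ := h3.concat h3' (hδ.trans h1) h2'
    refine ⟨e, Je, t + t', y, ?_, by linarith, he, fun r hr => ?_⟩
    · push_cast
      linarith
    · rcases le_total r t with hrt | hrt
      · rw [hel r hrt]
        exact (h4 r ⟨hr.1, hrt⟩).trans (hfirst x hx r (hrt.trans h2))
      · rw [her r hrt]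
        refine (h4' (r - t) ⟨by linarith, by linarith [hr.2]⟩).trans ?_
        have h5 : Real.exp (-lam * (r - t)) = Real.exp (-lam * r) * Real.exp (lam * t) := by
          rw [← Real.exp_add]
          ring_nf
        have h6 : Real.exp (lam * t) * N (P x) ≤ N x := by
          have h7 : Real.exp (lam * t) ≤ Real.exp (lam * Θ) :=
            Real.exp_le_exp.2 (mul_le_mul_of_nonneg_left h2 hlam)
          calc _ ≤ Real.exp (lam * Θ) * (κ * N x) :=
                mul_le_mul h7 hPN (hN _ hPG) (Real.exp_pos _).le
            _ = Real.exp (lam * Θ) * κ * N x := by ring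
            _ ≤ 1 * N x := mul_le_mul_of_nonneg_right hκ (hN x hx)
            _ = _ := one_mul _
        calc _ = K * Real.exp (lam * Θ) * Real.exp (-lam * r) * (Real.exp (lam * t) * N (P x)) := by
              rw [h5]
              ring
          _ ≤ _ := by gcongr

variable [CompleteSpace E] [I.Boundaryless] [IsManifold I 1 M]

/-- The return times to a transverse section are bounded from below. -/
theorem exists_le_return_time [Finite ι] (hd : IsChartCompatibleDist I d)
    (hv : ContMDiff I I.tangent 1 (fun x => (⟨x, S.field x⟩ : TangentBundle I M)))
    {Sec : Set M} {x₀ : M} (hx₀ : x₀ ∈ Sec) (htan : S.field x₀ ∉ hypersurfaceTangent I Sec x₀)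
    (hG : ∀ i, x₀ ∉ closure (S.guard i)) :
    ∃ δ, 0 < δ ∧ ∀ᶠ x in 𝓝[Sec] x₀, ∀ c J t, 0 < t → S.IsTrajectoryOn c J (Icc 0 t) → c 0 = x →
      c t ∈ Sec → δ ≤ t := by
  have := hd.t2Space
  obtain ⟨U, h, hxU, hh, hpos⟩ := exists_isLocalDefiningFunction_pos htan
  obtain ⟨N, δ, K, Φ, hyN, hbox, θ, -, hθ1, -⟩ :=
    exists_isFlowBox_crossing hd hv hh hxU hx₀ hpos (S.isOpen_compl_closure_guards.mem_nhds hG)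
  have hδ := hbox.pos
  refine ⟨δ, hδ, ?_⟩
  filter_upwards [nhdsWithin_le_nhds (hbox.isOpen.mem_nhds hyN),
    nhdsWithin_le_nhds (hh.isOpen.mem_nhds hxU), self_mem_nhdsWithin] with x hx hxU' hxS
  intro c J' t ht hc hc0 hct
  by_contra! hlt
  have hθx : θ x = 0 := by
    refine (((hθ1 x hx).2 0 ⟨by linarith, hδ.le⟩).1 ?_).symm
    rw [hbox.zero x hx]
    exact (hh.mem_iff x hxU').1 hxS
  have hIcc : ∀ r ∈ Icc 0 t, r ∈ Icc (-δ) δ := fun r hr => ⟨by linarith [hr.1], by linarith [hr.2]⟩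
  have htraj : S.IsTrajectoryOn (Φ x) ∅ (Icc 0 t) :=
    IsFlowBox.isTrajectoryOn hbox hx hlt.le fun r hr i hi =>
      (hbox.mem x hx r (hIcc r hr)).1 i (subset_closure hi)
  have htt : t ∈ Icc 0 t := ⟨ht.le, le_rfl⟩
  have heq : Φ x t = c t := htraj.eqOn hv (hasUniqueImpacts_empty _) hc Subset.rfl Subset.rfl
    (by rw [hbox.zero x hx, hc0]) htt
  have hmem := (hbox.mem x hx t (hIcc t htt)).2
  rw [← heq] at hct
  have := ((hθ1 x hx).2 t (hIcc t htt)).1 ((hh.mem_iff _ hmem).1 hct)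
  linarith

/-- Near its fixed point, the Poincaré map is realized by trajectories with unique impacts, with
bounds for the return times and for the distance to the orbit. -/
theorem IsPoincareMap.eventually_exists_isSegment [Finite ι] (hd : IsChartCompatibleDist I d)
    (hv : ContMDiff I I.tangent 1 (fun x => (⟨x, S.field x⟩ : TangentBundle I M)))
    (hR : ∀ i, ContMDiffOn I I 1 (S.reset i) (S.guard i))
    (hγ : S.IsPeriodicOrbit γ J T) (htr : S.IsTransverse γ J) {τ : ℝ} (hτ : 0 < τ) (hτJ : τ ∉ J)
    {Sec : Set M} {P : M → M} (hP : S.IsPoincareMap γ Sec (γ τ) P) :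
    ∃ δ Θ K, 0 < δ ∧ 0 ≤ K ∧ ∀ᶠ x in 𝓝[Sec] (γ τ), P x ∈ Sec ∧ ∃ c J t, δ ≤ t ∧ t ≤ Θ ∧
      S.IsSegment c J t x (P x) ∧ ∀ r ∈ Icc 0 t, orbitDist d γ (c r) ≤ K * d x (γ τ) := by
  have := hd.t2Space
  have hT := hγ.period_pos
  have hmem : γ τ ∈ Sec := by
    have h1 : γ τ ∈ γ '' Ici 0 ∩ Sec := by rw [hP.inter]; rfl
    exact h1.2
  obtain ⟨δ, hδ, hδev⟩ := exists_le_return_time hd hv hmem hP.transversal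
    (htr.off_guards τ hτ.le)
  have hper := hγ.periodic τ hτ.le
  obtain ⟨Θ, K, hK, h⟩ := exists_transits_to_section hd hv hR hγ.trajectory htr
    (p := τ + T) (by linarith) (hγ.add_period_notMem hτ hτJ) (Sec := Sec) (V := univ)
    (by rwa [hper]) univ_mem (by rw [hper]; exact hP.transversal)
  obtain ⟨N₁, hN₁, htrans⟩ := h τ hτ.le (by linarith)
  refine ⟨δ, Θ, K, hδ, hK, ?_⟩
  filter_upwards [hP.return_map, hδev, nhdsWithin_le_nhds hN₁] with x hx hxδ hxN
  obtain ⟨c', J', t', ht', hc', hc'0, hfirst, hc't, hPx⟩ := hx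
  obtain ⟨c, J₁, t, ht, htΘ, hc, hu, hc0, hct, hz⟩ := htrans x hxN
  have hle : t' ≤ t := by
    by_contra! hlt
    have h1 : c t = c' t := hc.eqOn hv hu hc' Subset.rfl (Icc_subset_Icc_right hlt.le)
      (by rw [hc0, hc'0]) ⟨ht.le, le_rfl⟩
    exact hfirst t ⟨ht, hlt⟩ (h1 ▸ hct.1)
  have heq : c t' = c' t' := hc.eqOn hv hu hc' (Icc_subset_Icc_right hle) Subset.rfl
    (by rw [hc0, hc'0]) ⟨ht'.le, le_rfl⟩
  have hseg : S.IsSegment c J₁ t x (c t) := ⟨hc, hu, hc0, rfl⟩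
  refine ⟨hPx ▸ hc't, c, J₁ ∩ Icc 0 t', t', hxδ c' J' t' ht' hc' hc'0 hc't,
    hle.trans htΘ, ?_, fun r hr => ?_⟩
  · rw [hPx, ← heq]
    exact hseg.mono hle
  · exact (hz (γ τ) ⟨mem_of_mem_nhds hN₁, τ, hτ.le, rfl⟩).2 r ⟨hr.1, hr.2.trans hle⟩

end Stability

section Main

variable {E : Type*} [NormedAddCommGroup E] [NormedSpace ℝ E] [FiniteDimensional ℝ E]
  {H : Type*} [TopologicalSpace H] {I : ModelWithCorners ℝ E H} [I.Boundaryless]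
  {M : Type*} [TopologicalSpace M] [ChartedSpace H M] [IsManifold I 1 M] {ι : Type*} [Finite ι]
  {S : HybridSystem I M ι} {γ : ℝ → M} {J : Set ℝ} {T : ℝ}

/-- Near every point of a periodic orbit whose monodromy has spectral radius less than one, there
start arbitrarily long trajectories with unique impacts that approach the orbit exponentially. -/
theorem exists_isSegment_near_orbit {d : M → M → ℝ} (hd : IsChartCompatibleDist I d)
    (hv : ContMDiff I I.tangent 1 (fun x => (⟨x, S.field x⟩ : TangentBundle I M)))
    (hR : ∀ i, ContMDiffOn I I 1 (S.reset i) (S.guard i))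
    (hγ : S.IsPeriodicOrbit γ J T) (htr : S.IsTransverse γ J) {τ : ℝ} (hτ : 0 < τ) (hτJ : τ ∉ J)
    {Sec : Set M} {P : M → M} (hP : S.IsPoincareMap γ Sec (γ τ) P)
    {Mon : Module.End ℝ (hypersurfaceTangent I Sec (γ τ))} (hMon : IsMonodromy Sec (γ τ) P Mon)
    (hr : complexSpectralRadius Mon < 1) :
    ∃ C lam : ℝ, 0 < C ∧ 0 < lam ∧ ∀ s, 0 ≤ s → ∃ N₁ ∈ 𝓝 (γ s), ∀ x ∈ N₁, ∀ b : ℝ,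
      ∃ c J t y, b ≤ t ∧ S.IsSegment c J t x y ∧ ∀ z ∈ N₁ ∩ γ '' Ici 0, ∀ r ∈ Icc 0 t,
        orbitDist d γ (c r) ≤ C * Real.exp (-lam * r) * d x z := by
  have := FiniteDimensional.complete ℝ E
  have := hd.t2Space
  have hT := hγ.period_pos
  have hmem : γ τ ∈ Sec := by
    have h1 : γ τ ∈ γ '' Ici 0 ∩ Sec := by rw [hP.inter]; rfl
    exact h1.2
  obtain ⟨δ, Θ, K, hδ, hK, hev⟩ := hP.eventually_exists_isSegment hd hv hR hγ htr hτ hτJ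
  obtain ⟨κ, hκ0, hκ1, C, hC, N, V, hV, hVW, hcontr⟩ := exists_contraction_of_isMonodromy hd
    hP.hypersurface hmem hP.fixed (hev.mono fun x hx => hx.1) hMon hr
    (eventually_nhdsWithin_iff.1 hev)
  have hδΘ : δ ≤ Θ := by
    obtain ⟨-, c, J', t, h1, h2, -⟩ := hVW (mem_of_mem_nhds hV) hmem
    exact h1.trans h2
  have hΘ : 0 < Θ := hδ.trans_le hδΘ
  set lam := -Real.log κ / Θ with hlam
  have hlam0 : 0 < lam := div_pos (neg_pos.2 (Real.log_neg hκ0 hκ1)) hΘ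
  have hκlam : Real.exp (lam * Θ) * κ ≤ 1 := by
    rw [hlam, div_mul_cancel₀ _ hΘ.ne', Real.exp_neg, Real.exp_log hκ0, inv_mul_cancel₀ hκ0.ne']
  have hiter := exists_isSegment_of_return (S := S) (d := d) (γ := γ) (Good := Sec ∩ V) (P := P)
    (N := N) (K := K * C) hδ.le (mul_nonneg hK hC.le) hlam0.le hκlam (fun x hx => (hcontr x hx).2.1)
    (fun x hx => ⟨(hcontr x hx).1, (hcontr x hx).2.2.2.2⟩) (fun x hx => by
      obtain ⟨-, c, J', t, h1, h2, h3, h4⟩ := hVW hx.2 hx.1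
      refine ⟨c, J', t, h1, h2, h3, fun r hr => (h4 r hr).trans ?_⟩
      rw [mul_assoc]
      exact mul_le_mul_of_nonneg_left (hcontr x hx).2.2.1 hK)
  have hper := hγ.periodic τ hτ.le
  obtain ⟨Θ', K', hK', h⟩ := exists_transits_to_section hd hv hR hγ.trajectory htr
    (p := τ + T) (by linarith) (hγ.add_period_notMem hτ hτJ) (Sec := Sec) (V := V)
    (by rwa [hper]) (by rwa [hper]) (by rw [hper]; exact hP.transversal)
  set A := K * C * Real.exp (lam * Θ) * C with hA
  have hA0 : 0 ≤ A := by positivity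
  refine ⟨(A + 1) * K' * Real.exp (lam * Θ') + 1, lam, by positivity, hlam0, fun s hs => ?_⟩
  obtain ⟨s', hs', hs'T, hγs⟩ := hγ.exists_eq_of_lt hs
  obtain ⟨N₁, hN₁, htrans⟩ := h s' hs' (by linarith)
  refine ⟨N₁, hγs ▸ hN₁, fun x hx b => ?_⟩
  obtain ⟨c, J₁, t, ht, htΘ, hc, hu, hc0, hct, hz⟩ := htrans x hx
  obtain ⟨n, hn⟩ := exists_nat_ge (b / δ)
  obtain ⟨c', J₂, t', y, hnt, ht', hseg', hest⟩ := hiter n _ hct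
  have hseg : S.IsSegment c J₁ t x (c t) := ⟨hc, hu, hc0, rfl⟩
  obtain ⟨e, Je, he, hel, her⟩ := hseg.concat hseg' ht.le ht'
  refine ⟨e, Je, t + t', y, ?_, he, fun z hzm r hr => ?_⟩
  · rw [div_le_iff₀ hδ] at hn
    linarith
  have hdn := hd.nonneg x z
  obtain ⟨⟨z₂, ⟨hz₂, hz₂γ⟩, hz₂d⟩, hcr⟩ := hz z hzm
  have hz₂' : z₂ = γ τ := by
    have : z₂ ∈ γ '' Ici 0 ∩ Sec := ⟨hz₂γ, hz₂.1⟩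
    rwa [hP.inter] at this
  subst hz₂'
  have hexp : Real.exp (-lam * r) * Real.exp (lam * Θ') * K' * (A + 1) * d x z ≤
      ((A + 1) * K' * Real.exp (lam * Θ') + 1) * Real.exp (-lam * r) * d x z := by
    have := mul_nonneg (Real.exp_pos (-lam * r)).le hdn
    linarith
  refine le_trans ?_ hexp
  rcases le_total r t with hrt | hrt
  · rw [hel r hrt]
    refine (hcr r ⟨hr.1, hrt⟩).trans ?_
    have h1 : 1 ≤ Real.exp (-lam * r) * Real.exp (lam * Θ') := by
      rw [← Real.exp_add]
      exact Real.one_le_exp (by nlinarith)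
    have h2 : 1 ≤ Real.exp (-lam * r) * Real.exp (lam * Θ') * (A + 1) :=
      one_le_mul_of_one_le_of_one_le h1 (by linarith)
    calc K' * d x z ≤ K' * d x z * (Real.exp (-lam * r) * Real.exp (lam * Θ') * (A + 1)) :=
          le_mul_of_one_le_right (mul_nonneg hK' hdn) h2
      _ = _ := by ring
  · rw [her r hrt]
    refine (hest (r - t) ⟨by linarith, by linarith [hr.2]⟩).trans ?_
    have h1 : Real.exp (-lam * (r - t)) ≤ Real.exp (-lam * r) * Real.exp (lam * Θ') := by
      rw [← Real.exp_add]
      exact Real.exp_le_exp.2 (by nlinarith)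
    have h2 : N (c t) ≤ C * (K' * d x z) :=
      (hcontr _ hct).2.2.2.1.trans (mul_le_mul_of_nonneg_left hz₂d hC.le)
    calc _ ≤ K * C * Real.exp (lam * Θ) * (Real.exp (-lam * r) * Real.exp (lam * Θ')) *
          (C * (K' * d x z)) := by
          have := (hcontr _ hct).2.1
          gcongr
      _ = Real.exp (-lam * r) * Real.exp (lam * Θ') * K' * A * d x z := by
          rw [hA]
          ring
      _ ≤ _ := by
          gcongr
          linarith

/-- A transverse periodic orbit whose monodromy has spectral radius less than one is locally
exponentially orbitally stable. -/
theorem IsPeriodicOrbit.isExpOrbitallyStable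
    (hv : ContMDiff I I.tangent 1 (fun x => (⟨x, S.field x⟩ : TangentBundle I M)))
    (hR : ∀ i, ContMDiffOn I I 1 (S.reset i) (S.guard i))
    (hγ : S.IsPeriodicOrbit γ J T) (htr : S.IsTransverse γ J) {τ : ℝ} (hτ : 0 < τ) (hτJ : τ ∉ J)
    {Sec : Set M} {P : M → M} (hP : S.IsPoincareMap γ Sec (γ τ) P)
    {Mon : Module.End ℝ (hypersurfaceTangent I Sec (γ τ))} (hMon : IsMonodromy Sec (γ τ) P Mon)
    (hr : complexSpectralRadius Mon < 1) : S.IsExpOrbitallyStable γ := by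
  intro d hd
  have := FiniteDimensional.complete ℝ E
  have := hd.t2Space
  obtain ⟨C, lam, hC, hlam, h⟩ :=
    exists_isSegment_near_orbit hd hv hR hγ htr hτ hτJ hP hMon hr
  choose! N₁ hN₁ hseg using h
  have hball : ∀ s, 0 ≤ s → ∃ ε, 0 < ε ∧ {y | d (γ s) y < ε} ⊆ N₁ s := fun s hs =>
    (hd.nhds_basis (γ s)).mem_iff.1 (hN₁ s hs)
  choose! ε hε hεN using hball
  refine ⟨⋃ s ∈ Ici (0 : ℝ), interior {y | d (γ s) y < ε s / 2},
    isOpen_biUnion fun s _ => isOpen_interior, ?_, C, lam, hC, hlam, fun x hx => ?_⟩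
  · rintro _ ⟨s, hs, rfl⟩
    exact mem_biUnion hs (mem_interior_iff_mem_nhds.2
      (hd.ball_mem_nhds (γ s) (half_pos (hε s hs))))
  · obtain ⟨s, hs, hxs⟩ := mem_iUnion₂.1 hx
    have hs0 : 0 ≤ s := hs
    have hxs' : d (γ s) x < ε s / 2 :=
      interior_subset (s := {y | d (γ s) y < ε s / 2}) hxs
    have hεs := hε s hs0
    have hxN : x ∈ N₁ s := hεN s hs0 (show d (γ s) x < ε s by linarith)
    have hγs : γ s ∈ γ '' Ici 0 := ⟨s, hs, rfl⟩
    refine ⟨exists_isTrajectoryOn_Ici hv fun b hb => ?_, fun c J' hc hc0 t ht => ?_⟩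
    · obtain ⟨c, J', t, y, hbt, hsg, -⟩ := hseg s hs0 x hxN b
      have := hsg.mono hbt
      exact ⟨c, _, this.isTrajectoryOn, this.hasUniqueImpacts, this.left⟩
    · obtain ⟨c', J'', t', y, htt', hsg, hest⟩ := hseg s hs0 x hxN t
      have heq : c' t = c t := hsg.isTrajectoryOn.eqOn hv hsg.hasUniqueImpacts hc
        (Icc_subset_Icc_right htt') Icc_subset_Ici_self (by rw [hsg.left, hc0]) ⟨ht, le_rfl⟩
      rw [← heq]
      have hpos : 0 < C * Real.exp (-lam * t) := by positivity
      rw [← div_le_iff₀' hpos]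
      refine le_orbitDist fun z hz => ?_
      rw [div_le_iff₀' hpos]
      by_cases hzs : d (γ s) z < ε s
      · exact hest z ⟨hεN s hs0 hzs, hz⟩ t ⟨ht, htt'⟩
      · refine (hest (γ s) ⟨mem_of_mem_nhds (hN₁ s hs0), hγs⟩ t ⟨ht, htt'⟩).trans
          (mul_le_mul_of_nonneg_left ?_ hpos.le)
        have h1 := hd.triangle (γ s) x z
        rw [hd.symm x (γ s)]
        linarith [not_lt.1 hzs]

end Main

end HybridSystem

section Vertical

variable {E : Type*} [NormedAddCommGroup E] [NormedSpace ℝ E]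
  {Q : Type*} [TopologicalSpace Q] [ChartedSpace E Q]
  {F : Type*} [NormedAddCommGroup F] [NormedSpace ℝ F]
  {B : Type*} [TopologicalSpace B] [ChartedSpace F B]
  {L : Type*} [NormedAddCommGroup L] [NormedSpace ℝ L]
  {G : Type*} [TopologicalSpace G] [ChartedSpace L G] [Group G] [MulAction G Q]

theorem IsPrincipalBundle.contMDiff_smul {pr : Q → B}
    (hpr : IsPrincipalBundle (E := E) (F := F) (L := L) G pr) (q : Q) :
    ContMDiff 𝓘(ℝ, L) 𝓘(ℝ, E) ∞ (fun a : G => a • q) :=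
  hpr.smooth_action.comp (contMDiff_id.prodMk contMDiff_const)

/-- The generators of the action are tangent to vertical surfaces. -/
theorem IsVertical.differential_infGen {pr : Q → B}
    (hpr : IsPrincipalBundle (E := E) (F := F) (L := L) G pr) {S : Set Q}
    (hS : IsVertical (F := F) pr S) {U : Set Q} {h : Q → ℝ}
    (hh : IsLocalDefiningFunction 𝓘(ℝ, E) S U h) {q : Q} (hq : q ∈ U) (hqS : q ∈ S)
    (ξ : LieAlg L G) : differential (E := E) h q (infGen G q ξ) = 0 := by
  obtain ⟨Sig, -, rfl⟩ := hS
  have hsm := (hpr.contMDiff_smul q).mdifferentiableAt (x := (1 : G)) (by simp)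
  have hone : (1 : G) • q = q := one_smul G q
  have hd : MDifferentiableAt 𝓘(ℝ, E) 𝓘(ℝ) h ((fun a : G => a • q) 1) := by
    rw [show (fun a : G => a • q) 1 = q from hone]
    exact (hh.smooth.contMDiffAt (hh.isOpen.mem_nhds hq)).mdifferentiableAt (by simp)
  have hcomp := mfderiv_comp (1 : G) hd hsm
  have hzero : (h ∘ fun a : G => a • q) =ᶠ[𝓝 1] fun _ => (0 : ℝ) := by
    have hc : Tendsto (fun a : G => a • q) (𝓝 1) (𝓝 q) := by
      simpa [ContinuousAt] using hsm.continuousAt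
    filter_upwards [hc.eventually (hh.isOpen.mem_nhds hq)] with a ha
    refine (hh.mem_iff _ ha).1 ?_
    have h1 : pr (a • q) = pr q := ((hpr.fibre q (a • q)).2 ⟨a, rfl⟩).symm
    rw [mem_preimage, h1]
    exact hqS
  rw [hzero.mfderiv_eq, mfderiv_const] at hcomp
  have hbase : ∀ q', q' = q → ∀ w : E, (mfderiv 𝓘(ℝ, E) 𝓘(ℝ) h q' : E →L[ℝ] ℝ) w = 0 →
      (mfderiv 𝓘(ℝ, E) 𝓘(ℝ) h q : E →L[ℝ] ℝ) w = 0 := by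
    rintro _ rfl w hw
    exact hw
  exact hbase _ hone _ (congrArg (fun A : L →L[ℝ] ℝ => A ξ) hcomp).symm

end Vertical

section Connection

variable {E : Type*} [NormedAddCommGroup E] [NormedSpace ℝ E]
  {Q : Type*} [TopologicalSpace Q] [ChartedSpace E Q] [IsManifold 𝓘(ℝ, E) ∞ Q]
  {F : Type*} [NormedAddCommGroup F] [NormedSpace ℝ F]
  {B : Type*} [TopologicalSpace B] [ChartedSpace F B]
  {L : Type*} [NormedAddCommGroup L] [NormedSpace ℝ L]
  {G : Type*} [TopologicalSpace G] [ChartedSpace L G] [Group G] [MulAction G Q]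

/-- Impacts on a vertical surface preserve the mechanical connection. -/
theorem HybridMechanicalSystem.preservesConnection_of_isVertical {ι U : Type*} {pr : Q → B}
    (hpr : IsPrincipalBundle (E := E) (F := F) (L := L) G pr)
    (S : HybridMechanicalSystem E Q G ι U) {i : ι} (hi : IsVertical (F := F) pr (S.surface i))
    (u : U) : S.PreservesConnection L i u := by
  intro x hx
  obtain ⟨U', h, hU', hh⟩ := S.surface_hypersurface i x.proj hx
  obtain ⟨ε, -, hp, -⟩ := S.impact_law i u x.proj hx x.2 U' h hU' hh
  have hJ : (momentumMap G S.metric x.proj (S.postVelocity i u x.proj x.2) : LieAlg L G →L[ℝ] ℝ) =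
      momentumMap G S.metric x.proj x.2 := by
    ext ξ
    have h1 := hp (infGen G x.proj ξ)
    rw [IsVertical.differential_infGen hpr hi hh hU' hx, mul_zero, add_zero] at h1
    exact h1
  exact congrArg (lockedInertia G S.metric x.proj).inverse hJ

end Connection

end HybridMech

theorem mainTheorem1
    {E : Type*} [NormedAddCommGroup E] [NormedSpace ℝ E] [FiniteDimensional ℝ E]
    {Q : Type*} [TopologicalSpace Q] [ChartedSpace E Q] [IsManifold 𝓘(ℝ, E) ∞ Q]
    [T2Space Q] [SecondCountableTopology Q]
    {F : Type*} [NormedAddCommGroup F] [NormedSpace ℝ F] [FiniteDimensional ℝ F]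
    {B : Type*} [TopologicalSpace B] [ChartedSpace F B] [IsManifold 𝓘(ℝ, F) ∞ B]
    {L : Type*} [NormedAddCommGroup L] [NormedSpace ℝ L] [FiniteDimensional ℝ L]
    {G : Type*} [TopologicalSpace G] [ChartedSpace L G] [Group G] [LieGroup 𝓘(ℝ, L) ∞ G]
    [MulAction G Q]
    (pr : Q → B) (hpr : IsPrincipalBundle (E := E) (F := F) (L := L) G pr)
    {ι U : Type*} [Finite ι]
    (S : HybridMechanicalSystem E Q G ι U)
    (k : ι → TangentBundle 𝓘(ℝ, E) Q → U)
    (hk : ∀ i, ContMDiffOn 𝓘(ℝ, E).tangent 𝓘(ℝ, E).tangent 1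
      ((S.closedLoop k).reset i) ((S.closedLoop k).guard i))
    (γ : ℝ → TangentBundle 𝓘(ℝ, E) Q) (J : Set ℝ) (T : ℝ)
    (hγ : (S.closedLoop k).IsPeriodicOrbit γ J T) :
    (∀ i, (S.closedLoop k).Encounters γ J i → IsVertical (F := F) pr (S.surface i) →
      ∀ u, S.PreservesConnection L i u) ∧
    (∀ k' : ι → TangentBundle 𝓘(ℝ, E) Q → U,
      (∃ i, (S.closedLoop k).Encounters γ J i ∧ S.CorrectsSymmetry L k' i) →
      ∃ i, (S.closedLoop k).Encounters γ J i ∧ ¬ IsVertical (F := F) pr (S.surface i) ∧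
        ∃ u, ¬ S.PreservesConnection L i u) ∧
    (IsDissipative S.force → (S.closedLoop k).IsTransverse γ J →
      ∀ (τ : ℝ), 0 < τ → τ ∉ J →
      ∀ (Sec : Set (TangentBundle 𝓘(ℝ, E) Q))
        (P : TangentBundle 𝓘(ℝ, E) Q → TangentBundle 𝓘(ℝ, E) Q)
        (Mon : Module.End ℝ (hypersurfaceTangent 𝓘(ℝ, E).tangent Sec (γ τ))),
      (S.closedLoop k).IsPoincareMap γ Sec (γ τ) P →
      IsMonodromy Sec (γ τ) P Mon →
      complexSpectralRadius Mon < 1 →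
      (S.closedLoop k).IsExpOrbitallyStable γ) := by
  refine ⟨fun i _ hi u => S.preservesConnection_of_isVertical hpr hi u, ?_, ?_⟩
  · rintro k' ⟨i, hi, x, hx, hne⟩
    have hu : ¬ S.PreservesConnection L i (k' i x) := fun h => hne (h x hx)
    exact ⟨i, hi, fun hv => hu (S.preservesConnection_of_isVertical hpr hv _), _, hu⟩
  · intro _ htr τ hτ hτJ Sec P Mon hP hMon hr
    exact hγ.isExpOrbitallyStable S.field_smooth hk htr hτ hτJ hP hMon hr
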